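/- \textbf{Setting.} A server is located at a point $s$ of a finite metric space $X$ with $n$ points; moving it is instantaneous and costs the distance travelled. An input is a finite sequence of $k$ requests; a request $q$ is released at a time $r_q$ on a point of $X$, and is served at the first time from $r_q$ on at which the server is at that point. In \emph{online service with delay}, each request $q$ has a nondecreasing continuous delay function $y_q:[r_q,\infty)\to\mathbb{R}$ with $y_q(r_q)=0$ and $y_q(t)\to\infty$ as $t\to\infty$; every request must be served, and the cost of a solution is the total movement of the server plus the sum of $y_q(t_q)$ over all requests $q$, where $t_q$ is the time at which $q$ is served. In \emph{online service with deadlines}, each request $q$ has a deadline $d_q\ge r_q$ and must be served in $[r_q,d_q]$; the cost is the total movement of the server. A deterministic online algorithm learns of a request, including its whole delay function or its deadline, at the release time of the request; its movements up to time $t$ depend only on the requests released by time $t$. In particular, $k$ is not known in advance. \textbf{Theorem.} There is an absolute constant $C>0$ such that for every finite metric space $X$ with $n$ points and every initial location $s\in X$ of the server, there is a deterministic online algorithm for online service with delay which, on every input with $k$ requests, produces a solution of cost at most $$C\,\bigl(1+\log\min\{n,k\}\bigr)\cdot \mathrm{OPT},$$ where $\mathrm{OPT}$ is the infimum of the costs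 of all (offline) solutions of this input starting at $s$, and $\log 0$ is read as $0$. The same holds for online service with deadlines. That is, both problems admit $O(\log\min\{n,k\})$-competitive deterministic online algorithms. -/

import Mathlib

open Filter Set

namespace OnlineService

/-- A request: the point of the metric space on which it is released, and its release time. -/
structure Request (X : Type*) where
  location : X
  release : ℝ

/-- A request of online service with delay. `delay t` is the total delay cost which the request
has accrued by time `t` if it is still pending; only its values on `[release, ∞)` matter. -/
structure DelayRequest (X : Type*) extends Request X where
  delay : ℝ → ℝ
  delay_release : delay release = 0
  delay_mono : MonotoneOn delay (Ici release)
  delay_continuous : ContinuousOn delay (Ici release)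
  delay_tendsto : Tendsto delay atTop atTop

/-- A request of online service with deadlines: it must be served during
`[release, deadline]`. -/
structure DeadlineRequest (X : Type*) extends Request X where
  deadline : ℝ
  release_le_deadline : release ≤ deadline

/-- An input: finitely many requests (of type `Q`, released at the times given by `rel`),
listed in order of arrival. -/
structure Input (Q : Type*) (rel : Q → ℝ) where
  requests : List Q
  sorted : requests.Pairwise (fun q q' => rel q ≤ rel q')

/-- The number of requests of an input. -/
def Input.numRequests {Q : Type*} {rel : Q → ℝ} (I : Input Q rel) : ℕ := I.requests.length

/-- What has been revealed of the input by time `t`: the requests released by then, each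
together with its deadline or its delay function. -/
noncomputable def Input.upTo {Q : Type*} {rel : Q → ℝ} (I : Input Q rel) (t : ℝ) : List Q :=
  I.requests.filter (fun q => decide (rel q ≤ t))

/-- A schedule of the server: a finite chronological list of movements `(t, p)`, meaning that
at time `t` the server moves, instantaneously, from wherever it is to the point `p`. Several
movements may take place at the same time, one after the other. -/
structure Schedule (X : Type*) where
  moves : List (ℝ × X)
  chronological : moves.Pairwise (fun m m' => m.1 ≤ m'.1)

namespace Schedule

variable {X : Type*}

/-- The movements which are performed by time `t`. -/
noncomputable def upTo (σ : Schedule X) (t : ℝ) : List (ℝ × X) :=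
  σ.moves.filter (fun m => decide (m.1 ≤ t))

/-- The location of the server just before its movements at time `t`, when it started
at `s`. -/
noncomputable def positionBefore (s : X) (σ : Schedule X) (t : ℝ) : X :=
  ((σ.moves.filter (fun m => decide (m.1 < t))).map Prod.snd).getLastD s

/-- At time `t` the server is, at least momentarily, at the point `p`: it is there before its
movements at time `t`, or one of these movements ends there. -/
def VisitsAt (s : X) (σ : Schedule X) (p : X) (t : ℝ) : Prop :=
  σ.positionBefore s t = p ∨ (t, p) ∈ σ.moves

/-- The times at which the server is at the location of the (already released) request. -/
def visitTimes (s : X) (σ : Schedule X) (q : Request X) : Set ℝ :=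
  {t | q.release ≤ t ∧ σ.VisitsAt s q.location t}

/-- The time at which a request is served: the first time, from its release on, at which the
server is at its location. (The infimum is attained, see `serviceTime_mem`.) -/
noncomputable def serviceTime (s : X) (σ : Schedule X) (q : Request X) : ℝ :=
  sInf (σ.visitTimes s q)

/-- Total distance travelled along a list of movements that starts at `s`. -/
noncomputable def travel [MetricSpace X] : X → List (ℝ × X) → ℝ
  | _, [] => 0
  | s, m :: l => dist s m.2 + travel m.2 l

/-- The movement cost of a schedule that starts at `s`. -/
noncomputable def movementCost [MetricSpace X] (s : X) (σ : Schedule X) : ℝ :=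
  travel s σ.moves

theorem serviceTime_mem (s : X) (σ : Schedule X) (q : Request X)
    (h : (σ.visitTimes s q).Nonempty) : σ.serviceTime s q ∈ σ.visitTimes s q := by
  have hbdd : BddBelow (σ.visitTimes s q) := ⟨q.release, fun t ht => ht.1⟩
  have hrel : q.release ≤ σ.serviceTime s q := le_csInf h fun t ht => ht.1
  set a := σ.serviceTime s q with ha
  obtain ⟨b, hab, hb⟩ : ∃ b, a < b ∧ ∀ m ∈ σ.moves, a < m.1 → b ≤ m.1 := by
    generalize σ.moves = l
    induction l with
    | nil => exact ⟨a + 1, by linarith, by simp⟩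
    | cons m l ih =>
      obtain ⟨b, hab, hb⟩ := ih
      by_cases hm : a < m.1
      · refine ⟨min b m.1, lt_min hab hm, fun m' hm' h' => ?_⟩
        rcases List.mem_cons.1 hm' with rfl | h1
        · exact min_le_right _ _
        · exact (min_le_left _ _).trans (hb m' h1 h')
      · refine ⟨b, hab, fun m' hm' h' => ?_⟩
        rcases List.mem_cons.1 hm' with rfl | h1
        · exact absurd h' hm
        · exact hb m' h1 h'
  obtain ⟨t, ht, htb⟩ := exists_lt_of_csInf_lt h hab
  have hat : a ≤ t := csInf_le hbdd ht
  rcases hat.eq_or_lt with hat | hat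
  · rw [hat]; exact ht
  refine ⟨hrel, ?_⟩
  have hpos : σ.positionBefore s t = q.location := by
    rcases ht.2 with h1 | h1
    · exact h1
    · exact absurd (hb _ h1 hat) (not_le.2 htb)
  have hfil : σ.moves.filter (fun m => decide (m.1 < t)) = σ.upTo a := by
    refine List.filter_congr fun m hm => decide_eq_decide.2 ⟨fun h1 => ?_, fun h1 => ?_⟩
    · by_contra h2
      exact absurd (hb m hm (not_le.1 h2)) (not_le.2 (h1.trans htb))
    · exact h1.trans_lt hat
  unfold positionBefore at hpos
  rw [hfil] at hpos
  by_cases hex : ∃ m ∈ σ.moves, m.1 = a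
  · right
    obtain ⟨m, hm, hma⟩ := hex
    have hmem : m ∈ σ.upTo a := List.mem_filter.2 ⟨hm, by simp [hma]⟩
    have hne : σ.upTo a ≠ [] := List.ne_nil_of_mem hmem
    have hsub : (σ.upTo a).Pairwise (fun m m' => m.1 ≤ m'.1) :=
      σ.chronological.sublist List.filter_sublist
    obtain ⟨l, x, hx⟩ := (List.eq_nil_or_concat (σ.upTo a)).resolve_left hne
    have hx_mem : x ∈ σ.upTo a := by rw [hx]; simp
    have hx_le : x.1 ≤ a := by simpa using (List.mem_filter.1 hx_mem).2
    have hmx : m.1 ≤ x.1 := by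
      rw [hx] at hmem hsub
      simp only [List.concat_eq_append, List.pairwise_append, List.mem_append,
        List.mem_singleton] at hmem hsub
      rcases hmem with h1 | rfl
      · exact hsub.2.2 m h1 x rfl
      · exact le_rfl
    have hxa : x.1 = a := le_antisymm hx_le (hma ▸ hmx)
    rw [hx] at hpos
    have hxq : x.2 = q.location := by simpa using hpos
    have : (a, q.location) = x := Prod.ext hxa.symm hxq.symm
    rw [this]
    exact (List.mem_filter.1 hx_mem).1
  · left
    rw [← hpos]
    unfold positionBefore upTo
    congr 2
    refine List.filter_congr fun m hm => decide_eq_decide.2 ⟨le_of_lt, fun h1 => ?_⟩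
    exact lt_of_le_of_ne h1 fun h2 => hex ⟨m, hm, h2⟩

end Schedule

/-- A deterministic online algorithm: it maps every input to a schedule of the server, and the
movements which it performs by time `t` depend only on what has been revealed of the input
by time `t`. -/
structure OnlineAlgorithm (X Q : Type*) (rel : Q → ℝ) where
  run : Input Q rel → Schedule X
  causal : ∀ (I J : Input Q rel) (t : ℝ), I.upTo t = J.upTo t →
    (run I).upTo t = (run J).upTo t

/-- Inputs of online service with delay on `X`. -/
abbrev DelayInput (X : Type*) := Input (DelayRequest X) (fun q => q.release)

/-- Inputs of online service with deadlines on `X`. -/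
abbrev DeadlineInput (X : Type*) := Input (DeadlineRequest X) (fun q => q.release)

/-- Deterministic online algorithms for online service with delay on `X`. -/
abbrev DelayAlgorithm (X : Type*) := OnlineAlgorithm X (DelayRequest X) (fun q => q.release)

/-- Deterministic online algorithms for online service with deadlines on `X`. -/
abbrev DeadlineAlgorithm (X : Type*) :=
  OnlineAlgorithm X (DeadlineRequest X) (fun q => q.release)

variable {X : Type*}

/-- A schedule is a solution of an input with delay if it eventually serves every request. -/
def DelayInput.IsSolution (s : X) (I : DelayInput X) (σ : Schedule X) : Prop :=
  ∀ q ∈ I.requests, (σ.visitTimes s q.toRequest).Nonempty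

/-- The cost of a solution with delay: the movement cost plus, for every request, its delay
cost at the time when it is served. -/
noncomputable def DelayInput.cost [MetricSpace X] (s : X) (I : DelayInput X)
    (σ : Schedule X) : ℝ :=
  σ.movementCost s + (I.requests.map (fun q => q.delay (σ.serviceTime s q.toRequest))).sum

/-- A schedule is a solution of an input with deadlines if it serves every request between its
release and its deadline. -/
def DeadlineInput.IsSolution (s : X) (I : DeadlineInput X) (σ : Schedule X) : Prop :=
  ∀ q ∈ I.requests, ∃ t ∈ σ.visitTimes s q.toRequest, t ≤ q.deadline

/-- `A`, with the server starting at `s`, is `ρ`-competitive for online service with delay,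
where the ratio `ρ` may depend on the input: it always produces a solution, whose cost is at
most `ρ` times the cost of any (offline) solution, that is, `ρ` times the optimum. -/
def DelayAlgorithm.IsCompetitive [MetricSpace X] (A : DelayAlgorithm X) (s : X)
    (ρ : DelayInput X → ℝ) : Prop :=
  ∀ I : DelayInput X, DelayInput.IsSolution s I (A.run I) ∧
    ∀ σ : Schedule X, DelayInput.IsSolution s I σ →
      DelayInput.cost s I (A.run I) ≤ ρ I * DelayInput.cost s I σ

/-- `A`, with the server starting at `s`, is `ρ`-competitive for online service with deadlines,
where the cost of a solution is its movement cost. -/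
def DeadlineAlgorithm.IsCompetitive [MetricSpace X] (A : DeadlineAlgorithm X) (s : X)
    (ρ : DeadlineInput X → ℝ) : Prop :=
  ∀ I : DeadlineInput X, DeadlineInput.IsSolution s I (A.run I) ∧
    ∀ σ : Schedule X, DeadlineInput.IsSolution s I σ →
      (A.run I).movementCost s ≤ ρ I * σ.movementCost s

end OnlineService

/-! Deadlines are treated as delay costs with jumps: a deadline becomes a jump by more than the
algorithm can ever pay for a single request, so the algorithm meets it. It remains to handle general
requests.

The algorithm. A pending request has a reach, the maximum of a remembered radius and its distance
from the server; its level is the least `j` with reach at most `2 ^ j`. Once the unpaid delay of the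
requests of level at most `j` amounts to `2 ^ j` for some `j`, a service of the least such level `ℓ`
takes place. It uses a closed tour and a time horizon such that the tour and the delay of the missed
requests up to the horizon cost at most `8 * 2 ^ ℓ`. Unless nothing is missed, the horizon is so
late that no tour costs less than this budget. The delay of the missed requests is prepaid up to the
horizon, and their radius becomes `2 ^ (ℓ + 1)`. Finally the server moves to a point near which 3/4
of the weight of the requests of level exactly `ℓ` lies, or it stays if there is none. Movement and
delay cost at most `(10 + 9) * 2 ^ ℓ` per service, so the sum of `2 ^ ℓ` over all services has to be
bounded by the offline cost (`sum_two_zpow_level_le`).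

Charging (`exists_charge`). Fix an offline schedule `σ`, and look at its movement since the last
service of level at least `ℓ`; all requests eligible now were released since. Steps shorter than `2
^ ℓ / (128 * N)` are ignored, where `N` counts the available points, and longer ones are capped at
`2 ^ ℓ`. If the remaining movement is at least `2 ^ ℓ / 128`, it pays. Otherwise everything that `σ`
visited lies on a tour of length `2 ^ ℓ / 32` (`exists_short_tour`), and there are two situations.
If some request of level exactly `ℓ` with unpaid delay owes its reach to an earlier service that
missed it, that parent service has level `ℓ - 1` and its horizon has passed. The same argument is
applied to the movement of `σ` since the last service before the parent of at least the parent's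
level: a short tour through the points visited was a candidate plan for the parent, so by maximality
the requests off this tour accrue delay `2 ^ ℓ`, which `σ` pays as well. If all these reaches are
genuine distances, then either a quarter of the weight is still pending in `σ`, which pays; or most
of the weight is near the server of `σ`, so the target is near it too, while the two servers had
been at distance at least `2 ^ ℓ / 4` before. Such an approach is paid by a potential, the distance
of the two servers cut into dyadic bands: it can only decrease after it has increased, through
movement of `σ` or through other services (`sum_approach_le`).

The logarithm. A step of `σ` matters at about `log N` levels only (`sum_trunc_le`), and at each
level the charged time intervals are disjoint. Skipping the points that are neither the start nor a
request location gives `N ≤ min n k + 1`. -/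

namespace OnlineService

/-! ### Walks, closed tours and truncated step lengths. -/

section Walks

variable {X : Type*} [MetricSpace X]

/-- The length of the walk that starts at a point and goes through the points of a list. -/
noncomputable def pathLength : X → List X → ℝ
  | _, [] => 0
  | s, x :: l => dist s x + pathLength x l

/-- The length of the closed walk from `a` through the points of a list and back to `a`. -/
noncomputable def tour (a : X) (l : List X) : ℝ := pathLength a (l ++ [a])

/-- The sum of a function of the step lengths over the steps of a walk. -/
noncomputable def stepSum (g : ℝ → ℝ) : X → List X → ℝ
  | _, [] => 0
  | s, x :: l => g (dist s x) + stepSum g x l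

theorem pathLength_nonneg (s : X) (l : List X) : 0 ≤ pathLength s l := by
  induction l generalizing s with
  | nil => exact le_rfl
  | cons x l ih => exact add_nonneg dist_nonneg (ih x)

theorem tour_nonneg (a : X) (l : List X) : 0 ≤ tour a l := pathLength_nonneg _ _

theorem tour_nil (a : X) : tour a [] = 0 := by simp [tour, pathLength]

theorem tour_singleton_self (a : X) : tour a [a] = 0 := by simp [tour, pathLength]

theorem pathLength_append (s : X) (l l' : List X) :
    pathLength s (l ++ l') = pathLength s l + pathLength (l.getLastD s) l' := by
  induction l generalizing s with
  | nil => simp [pathLength]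
  | cons x l ih =>
    rw [List.cons_append, pathLength, pathLength, ih x, List.getLastD_cons]
    ring

theorem dist_add_dist_le_pathLength {x : X} (s e : X) {l : List X} (h : x ∈ l) :
    dist s x + dist x e ≤ pathLength s (l ++ [e]) := by
  have key : ∀ (l : List X) (s : X), dist s e ≤ pathLength s (l ++ [e]) := by
    intro l
    induction l with
    | nil => intro s; simp [pathLength]
    | cons y l ih => intro s; exact (dist_triangle s y e).trans (by
        simpa [pathLength] using ih y)
  induction l generalizing s with
  | nil => simp at h
  | cons y l ih =>
    rw [List.cons_append, pathLength]
    rcases List.mem_cons.1 h with rfl | h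
    · linarith [key l x]
    · linarith [ih y h, dist_triangle s y x]

theorem two_mul_dist_le_tour {x a : X} {l : List X} (h : x ∈ l) : 2 * dist a x ≤ tour a l := by
  have := dist_add_dist_le_pathLength a a h
  rw [dist_comm x a] at this
  rw [tour]; linarith

theorem dist_le_tour {x y a : X} {l : List X} (hx : x ∈ l) (hy : y ∈ l) :
    dist x y ≤ tour a l := by
  linarith [two_mul_dist_le_tour (a := a) hx, two_mul_dist_le_tour (a := a) hy,
    dist_triangle_left x y a]

theorem pathLength_insert_le (s x y : X) (l₁ l₂ : List X) :
    pathLength s (l₁ ++ x :: y :: l₂) ≤ pathLength s (l₁ ++ x :: l₂) + 2 * dist x y := by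
  induction l₁ generalizing s with
  | nil =>
    cases l₂ with
    | nil =>
      simp only [List.nil_append, pathLength]
      linarith [dist_nonneg (x := x) (y := y)]
    | cons z l =>
      simp only [List.nil_append, pathLength]
      linarith [dist_triangle_left y z x]
  | cons z l ih =>
    simp only [List.cons_append, pathLength]
    linarith [ih z]

theorem pathLength_concat_le (s a c : X) (l : List X) :
    pathLength s (l ++ [a]) ≤ pathLength s (l ++ [c]) + dist a c := by
  rw [pathLength_append, pathLength_append]
  simp only [pathLength]
  linarith [dist_triangle_right (l.getLastD s) a c]

theorem tour_le_tour_add (a c : X) (l : List X) : tour a l ≤ tour c l + 2 * dist a c := by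
  cases l with
  | nil => rw [tour_nil, tour_nil]; positivity
  | cons x l =>
    have h := pathLength_concat_le x a c l
    simp only [tour, List.cons_append, pathLength]
    linarith [dist_triangle a c x]

theorem tour_le_card_mul {D : ℝ} (hD : ∀ x y : X, dist x y ≤ D) (a : X) (l : List X) :
    tour a l ≤ (l.length + 1) * D := by
  have key : ∀ (l : List X) (s : X), pathLength s l ≤ l.length * D := by
    intro l
    induction l with
    | nil => intro s; simp [pathLength]
    | cons x l ih =>
      intro s
      rw [pathLength, List.length_cons]
      push_cast
      linarith [ih x, hD s x]
  simpa [tour] using key (l ++ [a]) a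

/-- A walk in which steps shorter than `θ` are free can be turned into a closed tour at twice
the price, except for `2 * θ` for every point of the tour. -/
theorem exists_tour_of_walk {θ : ℝ} (hθ : 0 ≤ θ) (c : X) (w : List X) :
    ∀ (x : X) (l : List X), l.Nodup → x ∈ l → ∃ l' : List X, l'.Nodup ∧ l ⊆ l' ∧ w ⊆ l' ∧
      (∀ z ∈ l', z ∈ l ∨ z ∈ w) ∧
      tour c l' + 2 * θ * l.length ≤
        tour c l + 2 * stepSum (fun d => if d < θ then 0 else d) x w + 2 * θ * l'.length := by
  induction w with
  | nil =>
    intro x l hl hx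
    exact ⟨l, hl, List.Subset.refl l, by simp, fun z hz => Or.inl hz, by simp [stepSum]⟩
  | cons y w ih =>
    intro x l hl hx
    have hg : 0 ≤ (if dist x y < θ then 0 else dist x y) := by split_ifs <;> simp
    have hg' : dist x y ≤ (if dist x y < θ then 0 else dist x y) + θ := by
      split_ifs <;> linarith
    by_cases hy : y ∈ l
    · obtain ⟨l', h1, h2, h3, h4, h5⟩ := ih y l hl hy
      refine ⟨l', h1, h2, List.cons_subset.2 ⟨h2 hy, h3⟩, fun z hz => ?_, ?_⟩
      · exact (h4 z hz).imp_right (List.mem_cons_of_mem y)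
      · rw [stepSum]; linarith
    -- The new point `y` is inserted right after `x`. The detour costs at most `2 * dist x y`; up to
    -- `2 * θ` of this is paid by the growth of the list.
    · obtain ⟨l₁, l₂, rfl⟩ := List.append_of_mem hx
      have hperm : (l₁ ++ x :: y :: l₂).Perm (y :: (l₁ ++ x :: l₂)) := by
        have := List.perm_middle (a := y) (l₁ := l₁ ++ [x]) (l₂ := l₂)
        simpa using this
      have hnd : (l₁ ++ x :: y :: l₂).Nodup := hperm.nodup_iff.2 (List.nodup_cons.2 ⟨hy, hl⟩)
      obtain ⟨l', h1, h2, h3, h4, h5⟩ := ih y _ hnd (by simp)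
      have hsub : l₁ ++ x :: l₂ ⊆ l₁ ++ x :: y :: l₂ := fun z hz =>
        hperm.mem_iff.2 (List.mem_cons_of_mem y hz)
      refine ⟨l', h1, List.Subset.trans hsub h2, List.cons_subset.2 ⟨h2 (by simp), h3⟩,
        fun z hz => ?_, ?_⟩
      · rcases h4 z hz with h | h
        · rcases List.mem_cons.1 (hperm.mem_iff.1 h) with rfl | h
          · exact Or.inr (by simp)
          · exact Or.inl h
        · exact Or.inr (List.mem_cons_of_mem y h)
      · have hins : tour c (l₁ ++ x :: y :: l₂) ≤ tour c (l₁ ++ x :: l₂) + 2 * dist x y := by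
          have := pathLength_insert_le c x y l₁ (l₂ ++ [c])
          simpa [tour] using this
        have hlen : ((l₁ ++ x :: y :: l₂).length : ℝ) = (l₁ ++ x :: l₂).length + 1 := by
          rw [hperm.length_eq]; simp
        rw [hlen] at h5
        rw [stepSum]
        linarith

/-- The part of a step of length `d` that matters at scale `2 ^ ℓ` if there are `N` points. -/
noncomputable def trunc (N : ℕ) (ℓ : ℤ) (d : ℝ) : ℝ :=
  if d < 2 ^ ℓ / (128 * N) then 0 else min d (2 ^ ℓ)

theorem trunc_nonneg (N : ℕ) (ℓ : ℤ) {d : ℝ} (hd : 0 ≤ d) : 0 ≤ trunc N ℓ d := by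
  unfold trunc
  split_ifs
  · exact le_rfl
  · exact le_min hd (by positivity)

theorem stepSum_nonneg {g : ℝ → ℝ} (hg : ∀ d, 0 ≤ d → 0 ≤ g d) (x : X) (w : List X) :
    0 ≤ stepSum g x w := by
  induction w generalizing x with
  | nil => exact le_rfl
  | cons y w ih => exact add_nonneg (hg _ dist_nonneg) (ih y)

/-- A total below the cap `2 ^ ℓ` means that no step reaches the cap, so truncation only drops the
short steps. -/
theorem stepSum_trunc_eq (N : ℕ) (ℓ : ℤ) (x : X) (w : List X)
    (h : stepSum (trunc N ℓ) x w < 2 ^ ℓ) :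
    stepSum (fun d => if d < 2 ^ ℓ / (128 * N) then 0 else d) x w = stepSum (trunc N ℓ) x w := by
  induction w generalizing x with
  | nil => rfl
  | cons y w ih =>
    rw [stepSum] at h
    have h1 := trunc_nonneg N ℓ (dist_nonneg (x := x) (y := y))
    have h2 : 0 ≤ stepSum (trunc N ℓ) y w := stepSum_nonneg (fun d => trunc_nonneg N ℓ) y w
    rw [stepSum, stepSum, ih y (by linarith)]
    congr 1
    have h3 : trunc N ℓ (dist x y) < 2 ^ ℓ := by linarith
    unfold trunc at h3 ⊢
    split_ifs with h4
    · rfl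
    · rw [if_neg h4] at h3
      rcases min_lt_iff.1 h3 with h5 | h5
      · exact (min_eq_left h5.le).symm
      · exact absurd h5 (lt_irrefl _)

/-- Doubling the long steps costs at most `2 * 2 ^ ℓ / 128`. The short steps cost at most `2 * θ`
for each of at most `N` points, which is again `2 * 2 ^ ℓ / 128`. -/
theorem exists_short_tour {N : ℕ} (ℓ : ℤ) (x : X) (w : List X) (Y : Finset X)
    (hY : Y.card ≤ N) (hx : x ∈ Y) (hw : ∀ z ∈ w, z ∈ Y)
    (h : stepSum (trunc N ℓ) x w < 2 ^ ℓ / 128) :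
    ∃ l : List X, l.Nodup ∧ x ∈ l ∧ (∀ z ∈ w, z ∈ l) ∧ tour x l ≤ 2 ^ ℓ / 32 := by
  have hN : 0 < N := (Finset.card_pos.2 ⟨x, hx⟩).trans_le hY
  have hN' : (0 : ℝ) < N := by exact_mod_cast hN
  have h2 : (0 : ℝ) < 2 ^ ℓ := by positivity
  set θ : ℝ := 2 ^ ℓ / (128 * N) with hθ
  have hθ0 : 0 ≤ θ := by positivity
  obtain ⟨l, h1, h2, h3, h4, h5⟩ :=
    exists_tour_of_walk hθ0 x w x [x] (by simp) (by simp)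
  refine ⟨l, h1, h2 (by simp), fun z hz => h3 hz, ?_⟩
  have hlen : l.length ≤ N := by
    classical
    rw [← List.toFinset_card_of_nodup h1]
    refine (Finset.card_le_card fun z hz => ?_).trans hY
    rcases h4 z (List.mem_toFinset.1 hz) with h | h
    · rw [List.mem_singleton.1 h]; exact hx
    · exact hw z h
  have hlen' : (l.length : ℝ) ≤ N := by exact_mod_cast hlen
  have hstep := stepSum_trunc_eq N ℓ x w (by linarith)
  rw [tour_singleton_self, hstep] at h5
  have h6 : θ * N = 2 ^ ℓ / 128 := by rw [hθ]; field_simp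
  have h7 : θ * l.length ≤ θ * N := mul_le_mul_of_nonneg_left hlen' hθ0
  have h8 : (0 : ℝ) ≤ θ * ([x] : List X).length := by positivity
  linarith

end Walks

/-! ### Sums over levels, disjoint intervals and dyadic bands. -/

section Sums

theorem sum_two_zpow_le (Λ : Finset ℤ) (B : ℤ) (h : ∀ ℓ ∈ Λ, ℓ ≤ B) :
    ∑ ℓ ∈ Λ, (2 : ℝ) ^ ℓ ≤ 2 ^ (B + 1) := by
  induction Λ using Finset.induction_on_max generalizing B with
  | empty => simp; positivity
  | insert a Λ ha ih =>
    have hna : a ∉ Λ := fun h => lt_irrefl _ (ha a h)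
    rw [Finset.sum_insert hna]
    have h1 := ih (a - 1) fun ℓ hℓ => by have := ha ℓ hℓ; omega
    rw [sub_add_cancel] at h1
    have h2 : (2 : ℝ) ^ (a + 1) ≤ 2 ^ (B + 1) :=
      zpow_le_zpow_right₀ (by norm_num) (by have := h a (by simp); omega)
    rw [zpow_add_one₀ (by norm_num)] at h2
    linarith

/-- The levels with `2 ^ ℓ ≤ d` form a geometric series of sum at most `2 * d`. Above them, only
levels with `2 ^ ℓ ≤ 128 * N * d` contribute: at most `logb 2 (128 * N) + 1` levels, each at most
`d`. -/
theorem sum_trunc_le {N : ℕ} (hN : 0 < N) (Λ : Finset ℤ) {d : ℝ} (hd : 0 ≤ d) :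
    ∑ ℓ ∈ Λ, trunc N ℓ d ≤ d * (3 + Real.logb 2 (128 * N)) := by
  have hN' : (1 : ℝ) ≤ N := by exact_mod_cast hN
  rcases hd.eq_or_lt with rfl | hd
  · rw [zero_mul]
    refine (Finset.sum_eq_zero fun ℓ _ => ?_).le
    unfold trunc
    rw [if_pos (by positivity)]
  set R := Real.logb 2 (128 * N) with hR
  have hR0 : 0 ≤ R := Real.logb_nonneg (by norm_num) (by linarith)
  set x := Real.logb 2 d with hx
  have h2x : (2 : ℝ) ^ x = d := Real.rpow_logb (by norm_num) (by norm_num) hd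
  have h2R : (2 : ℝ) ^ R = 128 * N := Real.rpow_logb (by norm_num) (by norm_num) (by linarith)
  have hle : ∀ ℓ : ℤ, (2 : ℝ) ^ ℓ ≤ d ↔ ℓ ≤ ⌊x⌋ := fun ℓ => by
    rw [Int.le_floor, ← h2x, ← Real.rpow_intCast, Real.rpow_le_rpow_left_iff (by norm_num)]
  have hle' : ∀ ℓ : ℤ, (2 : ℝ) ^ ℓ ≤ 128 * N * d ↔ ℓ ≤ ⌊x + R⌋ := fun ℓ => by
    rw [Int.le_floor, ← h2R, ← h2x, ← Real.rpow_intCast, ← Real.rpow_add (by norm_num),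
      Real.rpow_le_rpow_left_iff (by norm_num), add_comm]
  rw [← Finset.sum_filter_add_sum_filter_not Λ (fun ℓ => ℓ ≤ ⌊x⌋)]
  have h1 : ∑ ℓ ∈ Λ with ℓ ≤ ⌊x⌋, trunc N ℓ d ≤ 2 * d := by
    calc _ ≤ ∑ ℓ ∈ Λ with ℓ ≤ ⌊x⌋, (2 : ℝ) ^ ℓ := Finset.sum_le_sum fun ℓ _ => by
          unfold trunc
          split_ifs
          · positivity
          · exact min_le_right _ _
      _ ≤ 2 ^ (⌊x⌋ + 1) := sum_two_zpow_le _ _ fun ℓ hℓ => (Finset.mem_filter.1 hℓ).2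
      _ ≤ 2 * d := by
          rw [zpow_add_one₀ (by norm_num)]
          linarith [(hle ⌊x⌋).2 le_rfl]
  have h2 : ∑ ℓ ∈ Λ with ¬ ℓ ≤ ⌊x⌋, trunc N ℓ d ≤ (R + 1) * d := by
    calc _ ≤ ∑ ℓ ∈ Finset.Ioc ⌊x⌋ ⌊x + R⌋, d := by
          rw [← Finset.sum_filter_ne_zero]
          refine (Finset.sum_le_sum (g := fun _ => d) fun ℓ _ => ?_).trans
            (Finset.sum_le_sum_of_subset_of_nonneg (fun ℓ hℓ => ?_) fun _ _ _ => hd.le)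
          · unfold trunc
            split_ifs
            · exact hd.le
            · exact min_le_left _ _
          · obtain ⟨hℓ, hne⟩ := Finset.mem_filter.1 hℓ
            have hlt := (Finset.mem_filter.1 hℓ).2
            refine Finset.mem_Ioc.2 ⟨not_le.1 hlt, (hle' ℓ).1 ?_⟩
            by_contra hcon
            refine hne ?_
            unfold trunc
            rw [if_pos]
            rw [lt_div_iff₀ (by positivity)]
            linarith
      _ = ((⌊x + R⌋ - ⌊x⌋).toNat : ℝ) * d := by simp
      _ ≤ (R + 1) * d := by
          refine mul_le_mul_of_nonneg_right ?_ hd.le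
          have hfl : ⌊x⌋ ≤ ⌊x + R⌋ := Int.floor_le_floor (by linarith)
          have : ((⌊x + R⌋ - ⌊x⌋).toNat : ℝ) = (⌊x + R⌋ : ℝ) - ⌊x⌋ := by
            have := Int.toNat_of_nonneg (sub_nonneg.2 hfl)
            exact_mod_cast this
          rw [this]
          linarith [Int.floor_le (x + R), Int.lt_floor_add_one x]
  linarith

/-- The intervals from `a i` to `b i` follow one another inside `[0, Y]`; empty ones count as zero.
-/
theorem sum_intervals_le (F : Finset ℕ) (a b : ℕ → ℝ) {Y : ℝ} (hY : 0 ≤ Y)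
    (ha : ∀ i ∈ F, 0 ≤ a i) (hb : ∀ i ∈ F, b i ≤ Y)
    (hab : ∀ i ∈ F, ∀ j ∈ F, i < j → b i ≤ a j) :
    ∑ i ∈ F, max 0 (b i - a i) ≤ Y := by
  induction F using Finset.induction_on_max generalizing Y with
  | empty => simpa using hY
  | insert m F hm ih =>
    have hnm : m ∉ F := fun h => lt_irrefl _ (hm m h)
    rw [Finset.sum_insert hnm]
    have h1 : ∑ i ∈ F, max 0 (b i - a i) ≤ min Y (a m) :=
      ih (le_min hY (ha m (by simp))) (fun i hi => ha i (by simp [hi]))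
        (fun i hi => le_min (hb i (by simp [hi])) (hab i (by simp [hi]) m (by simp) (hm i hi)))
        fun i hi j hj => hab i (by simp [hi]) j (by simp [hj])
    have h2 := hb m (by simp)
    rcases le_total 0 (b m - a m) with h | h
    · rw [max_eq_right h]; linarith [h1.trans (min_le_right _ _)]
    · rw [max_eq_left h]; linarith [h1.trans (min_le_left _ _)]

/-- The restriction of a distance to the range between `2 ^ (ℓ - 3)` and `2 ^ (ℓ - 2)`. -/
noncomputable def band (ℓ : ℤ) (x : ℝ) : ℝ := max (2 ^ (ℓ - 3)) (min x (2 ^ (ℓ - 2)))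

theorem band_mono (ℓ : ℤ) : Monotone (band ℓ) := fun _ _ h =>
  max_le_max le_rfl (min_le_min h le_rfl)

/-- The bands do not overlap: the lower end `2 ^ (ℓ - 3)` of one is the upper end of the band of `ℓ
- 1`. So they cut the interval from `x` to `y` into disjoint pieces. -/
theorem sum_band_sub_le (Λ : Finset ℤ) {x y : ℝ} (h : x ≤ y) :
    ∑ ℓ ∈ Λ, (band ℓ y - band ℓ x) ≤ y - x := by
  have key : ∀ (B : ℤ), (∀ ℓ ∈ Λ, ℓ ≤ B) →
      ∑ ℓ ∈ Λ, (band ℓ y - band ℓ x) ≤ min y (2 ^ (B - 2)) - min x (2 ^ (B - 2)) := by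
    induction Λ using Finset.induction_on_max with
    | empty => intro B _; simpa using Or.inl h
    | insert a Λ ha ih =>
      intro B hB
      have hna : a ∉ Λ := fun h => lt_irrefl _ (ha a h)
      rw [Finset.sum_insert hna]
      have h1 := ih (a - 1) fun ℓ hℓ => by have := ha ℓ hℓ; omega
      have e : a - 1 - 2 = a - 3 := by ring
      rw [e] at h1
      have h2 : (2 : ℝ) ^ (a - 2) ≤ 2 ^ (B - 2) :=
        zpow_le_zpow_right₀ (by norm_num) (by have := hB a (by simp); omega)
      have h3 : (2 : ℝ) ^ (a - 3) ≤ 2 ^ (a - 2) :=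
        zpow_le_zpow_right₀ (by norm_num) (by omega)
      have h4 : ∀ u v z : ℝ, v ≤ z → u ≤ v → (max u (min y v) - max u (min x v)) +
          (min y u - min x u) ≤ min y z - min x z := by
        intro u v z h2 h3
        simp only [min_def, max_def]
        split_ifs <;> linarith
      exact (add_le_add_right h1 _).trans (h4 _ _ _ h2 h3)
  obtain ⟨B, hB⟩ : ∃ B : ℤ, ∀ ℓ ∈ Λ, ℓ ≤ B := Λ.exists_le
  refine (key B hB).trans ?_
  simp only [min_def]
  split_ifs <;> linarith

theorem sum_band_max_le (Λ : Finset ℤ) (x y : ℝ) :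
    ∑ ℓ ∈ Λ, max 0 (band ℓ y - band ℓ x) ≤ max 0 (y - x) := by
  rcases le_total x y with h | h
  · rw [max_eq_right (sub_nonneg.2 h)]
    refine le_trans (Finset.sum_le_sum fun ℓ _ => ?_) (sum_band_sub_le Λ h)
    exact max_le (sub_nonneg.2 (band_mono ℓ h)) le_rfl
  · refine le_trans (Finset.sum_nonpos fun ℓ _ => ?_) (le_max_left _ _)
    exact max_le le_rfl (sub_nonpos.2 (band_mono ℓ h))

end Sums

/-! ### General requests and the algorithm. -/

/-- A request whose accrued cost may jump: `lower t` is its cost if it is served at time `t`,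
and `upper t` is the limit of this cost from the right. -/
structure GeneralRequest (X : Type*) extends Request X where
  lower : ℝ → ℝ
  upper : ℝ → ℝ
  lower_mono : Monotone lower
  upper_mono : Monotone upper
  lower_le_upper : ∀ t, lower t ≤ upper t
  upper_le_lower : ∀ s t, s < t → upper s ≤ lower t
  lower_eq_zero : ∀ t, t ≤ release → lower t = 0
  upper_eq_zero : ∀ t, t < release → upper t = 0
  lower_lsc : LowerSemicontinuous lower
  upper_usc : UpperSemicontinuous upper
  upper_unbounded : ∀ c, ∃ t, c ≤ upper t

theorem GeneralRequest.lower_nonneg {X : Type*} (q : GeneralRequest X) (t : ℝ) :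
    0 ≤ q.lower t := by
  rcases le_total t q.release with h | h
  · exact (q.lower_eq_zero t h).ge
  · rw [← q.lower_eq_zero q.release le_rfl]
    exact q.lower_mono h

/-- What the algorithm remembers: the time of its last service, the location of the server,
the requests it has served, and for every request a radius (`0` if it has not been considered
yet) and the delay cost which has already been paid for. -/
structure ServerState (X : Type*) where
  time : WithBot ℝ
  pos : X
  served : Set ℕ
  radius : ℕ → ℝ
  paid : ℕ → ℝ

/-- A service of a given level: the server goes around the route and returns; the delay of the
requests left behind is paid up to the horizon; finally the server moves to the target. -/
structure Service (X : Type*) where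
  time : ℝ
  level : ℤ
  route : List X
  horizon : ℝ
  target : X

section Definitions

variable {X : Type*} [MetricSpace X] (k : ℕ) (v : ℕ → GeneralRequest X) (S : ServerState X)

/-- The radius keeps a request from dropping to a lower level when the server happens to come
closer. -/
noncomputable def ServerState.reach (i : ℕ) : ℝ :=
  max (S.radius i) (dist S.pos (v i).location)

open Classical in
/-- The pending requests of level at most `j`. -/
noncomputable def eligible (t : ℝ) (j : ℤ) : Finset ℕ :=
  (Finset.range k).filter fun i =>
    (v i).release ≤ t ∧ i ∉ S.served ∧ 0 < S.reach v i ∧ S.reach v i ≤ 2 ^ j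

/-- The delay cost which has not been paid for yet. -/
noncomputable def excess (t : ℝ) (i : ℕ) : ℝ := max 0 ((v i).upper t - S.paid i)

/-- The pending requests of level exactly `j`. -/
noncomputable def outer (t : ℝ) (j : ℤ) : Finset ℕ :=
  (eligible k v S t j).filter fun i => 2 ^ (j - 1) < S.reach v i

/-- The excess is measured with `upper`, which makes the set of trigger times closed. Several
services may share one time, hence `≤`. -/
def Triggered (t : ℝ) : Prop :=
  S.time ≤ t ∧ ∃ j : ℤ, 2 ^ j ≤ ∑ i ∈ eligible k v S t j, excess v S t i

/-- Most of the weight of the requests of level exactly `j` is near the point `p`. -/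
def IsHeavy (t : ℝ) (j : ℤ) (p : X) : Prop :=
  3 / 4 * ∑ i ∈ outer k v S t j, excess v S t i ≤
    ∑ i ∈ (outer k v S t j).filter (fun i => dist p (v i).location ≤ 2 ^ j / 32), excess v S t i

open Classical in
/-- The eligible requests which are not on the route. -/
noncomputable def missed (t : ℝ) (j : ℤ) (l : List X) : Finset ℕ :=
  (eligible k v S t j).filter fun i => (v i).location ∉ l

/-- `budget` and `maximal` pin down the horizon from both sides: with `lower` the plan is still
affordable, with `upper` no tour without repetitions is below the budget. With continuous delay, the
two would use the same cost function. -/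
structure IsService (d : Service X) : Prop where
  least : IsLeast {t | Triggered k v S t} d.time
  threshold : 2 ^ d.level ≤ ∑ i ∈ eligible k v S d.time d.level, excess v S d.time i
  below : ∀ j < d.level, ∑ i ∈ eligible k v S d.time j, excess v S d.time i < 2 ^ j
  time_le_horizon : d.time ≤ d.horizon
  budget : tour S.pos d.route + ∑ i ∈ missed k v S d.time d.level d.route,
    ((v i).lower d.horizon - (v i).lower d.time) ≤ 8 * 2 ^ d.level
  maximal : missed k v S d.time d.level d.route = ∅ ∨
    ∀ l : List X, l.Nodup → 8 * 2 ^ d.level ≤ tour S.pos l +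
      ∑ i ∈ missed k v S d.time d.level l, ((v i).upper d.horizon - (v i).lower d.time)
  target_spec : IsHeavy k v S d.time d.level d.target ∨
    d.target = S.pos ∧ ∀ p, ¬ IsHeavy k v S d.time d.level p

open Classical in
-- The choice depends on the input only through the predicate `IsService k v S`, which is what
-- causality needs.
noncomputable def nextService : Option (Service X) :=
  if h : ∃ d, IsService k v S d then some h.choose else none

open Classical in
/-- The state after a service. -/
noncomputable def ServerState.advance (d : Service X) : ServerState X where
  time := d.time
  pos := d.target
  -- The middle alternative concerns requests released where the server was standing, which are
  -- served at their release.
  served := {i | i ∈ S.served ∨ (i < k ∧ (v i).release ≤ d.time ∧ S.reach v i = 0) ∨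
    (i ∈ eligible k v S d.time d.level ∧ (v i).location ∈ d.route)}
  radius i := if i ∈ eligible k v S d.time d.level then 2 ^ (d.level + 1) else
    if i < k ∧ (v i).release ≤ d.time then S.reach v i else S.radius i
  paid i := if i ∈ eligible k v S d.time d.level then
    max (S.paid i) ((v i).lower (if (v i).location ∈ d.route then d.time else d.horizon))
    else S.paid i

/-- The time `⊥` puts no lower bound on the first service, since releases may be arbitrarily early.
-/
def ServerState.init (s : X) : ServerState X := ⟨⊥, s, ∅, 0, 0⟩

noncomputable def stateAt (s : X) : ℕ → ServerState X
  | 0 => ServerState.init s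
  | n + 1 => match nextService k v (stateAt s n) with
    | none => stateAt s n
    | some d => (stateAt s n).advance k v d

/-- The movements of the server during a service. -/
def Service.moves (a : X) (d : Service X) : List (ℝ × X) :=
  (d.route ++ [a, d.target]).map fun x => (d.time, x)

/-- The movements during the first services. -/
noncomputable def movesAt (s : X) : ℕ → List (ℝ × X)
  | 0 => []
  | n + 1 => movesAt s n ++ match nextService k v (stateAt k v s n) with
    | none => []
    | some d => d.moves (stateAt k v s n).pos

end Definitions

/-! ### Causality: the run up to time `t` depends on the requests released by `t`. -/

section Causality

variable {X : Type*} {k k' : ℕ} {v v' : ℕ → GeneralRequest X} {S : ServerState X} {t : ℝ}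

/-- Two inputs have the same requests up to time `t`. -/
def Agree (t : ℝ) (k : ℕ) (v : ℕ → GeneralRequest X) (k' : ℕ) (v' : ℕ → GeneralRequest X) :
    Prop :=
  (∀ i, (i < k ∧ (v i).release ≤ t) ↔ (i < k' ∧ (v' i).release ≤ t)) ∧
    ∀ i < k, (v i).release ≤ t → v i = v' i

theorem Agree.symm (h : Agree t k v k' v') : Agree t k' v' k v :=
  ⟨fun i => (h.1 i).symm, fun i hi hr =>
    (h.2 i ((h.1 i).2 ⟨hi, hr⟩).1 ((h.1 i).2 ⟨hi, hr⟩).2).symm⟩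

theorem Agree.mono (h : Agree t k v k' v') {u : ℝ} (hu : u ≤ t) : Agree u k v k' v' := by
  refine ⟨fun i => ⟨fun hi => ?_, fun hi => ?_⟩, fun i hi hr => h.2 i hi (hr.trans hu)⟩
  · have h1 := (h.1 i).1 ⟨hi.1, hi.2.trans hu⟩
    exact ⟨h1.1, h.2 i hi.1 (hi.2.trans hu) ▸ hi.2⟩
  · have h1 := (h.1 i).2 ⟨hi.1, hi.2.trans hu⟩
    exact ⟨h1.1, (h.2 i h1.1 h1.2).symm ▸ hi.2⟩

variable [MetricSpace X]

theorem Agree.reach_eq (h : Agree t k v k' v') {i : ℕ} (hi : i < k) (hr : (v i).release ≤ t) :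
    S.reach v i = S.reach v' i := by
  rw [ServerState.reach, ServerState.reach, h.2 i hi hr]

theorem Agree.eligible_eq (h : Agree t k v k' v') (j : ℤ) :
    eligible k v S t j = eligible k' v' S t j := by
  classical
  ext i
  simp only [eligible, Finset.mem_filter, Finset.mem_range]
  constructor
  · rintro ⟨h1, h2, h3⟩
    rw [h.reach_eq h1 h2] at h3
    exact ⟨((h.1 i).1 ⟨h1, h2⟩).1, ((h.1 i).1 ⟨h1, h2⟩).2, h3⟩
  · rintro ⟨h1, h2, h3⟩
    rw [h.symm.reach_eq h1 h2] at h3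
    exact ⟨((h.1 i).2 ⟨h1, h2⟩).1, ((h.1 i).2 ⟨h1, h2⟩).2, h3⟩

theorem mem_eligible {i : ℕ} {j : ℤ} : i ∈ eligible k v S t j ↔
    i < k ∧ (v i).release ≤ t ∧ i ∉ S.served ∧ 0 < S.reach v i ∧ S.reach v i ≤ 2 ^ j := by
  classical
  simp [eligible]

theorem mem_missed {i : ℕ} {j : ℤ} {l : List X} :
    i ∈ missed k v S t j l ↔ i ∈ eligible k v S t j ∧ (v i).location ∉ l := by
  classical
  simp [missed]

theorem Agree.eq_of_mem (h : Agree t k v k' v') {i : ℕ} {j : ℤ}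
    (hi : i ∈ eligible k v S t j) : v i = v' i :=
  h.2 i (mem_eligible.1 hi).1 (mem_eligible.1 hi).2.1

theorem Agree.excess_eq (h : Agree t k v k' v') {i : ℕ} {j : ℤ}
    (hi : i ∈ eligible k v S t j) : excess v S t i = excess v' S t i := by
  rw [excess, excess, h.eq_of_mem hi]

theorem Agree.outer_eq (h : Agree t k v k' v') (j : ℤ) :
    outer k v S t j = outer k' v' S t j := by
  rw [outer, outer, ← h.eligible_eq]
  refine Finset.filter_congr fun i hi => ?_
  rw [h.reach_eq (mem_eligible.1 hi).1 (mem_eligible.1 hi).2.1]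

theorem Agree.missed_eq (h : Agree t k v k' v') (j : ℤ) (l : List X) :
    missed k v S t j l = missed k' v' S t j l := by
  classical
  rw [missed, missed, ← h.eligible_eq]
  refine Finset.filter_congr fun i hi => ?_
  rw [h.eq_of_mem hi]

theorem Agree.sum_eligible_eq (h : Agree t k v k' v') (j : ℤ) :
    ∑ i ∈ eligible k v S t j, excess v S t i = ∑ i ∈ eligible k' v' S t j, excess v' S t i := by
  rw [← h.eligible_eq]
  exact Finset.sum_congr rfl fun i hi => h.excess_eq hi

theorem Agree.triggered_iff (h : Agree t k v k' v') : Triggered k v S t ↔ Triggered k' v' S t := by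
  simp only [Triggered, h.sum_eligible_eq]

theorem Agree.isHeavy_iff (h : Agree t k v k' v') (j : ℤ) (p : X) :
    IsHeavy k v S t j p ↔ IsHeavy k' v' S t j p := by
  have h1 : ∀ i ∈ outer k v S t j, i ∈ eligible k v S t j := fun i hi =>
    Finset.filter_subset _ _ hi
  have e1 : ∑ i ∈ outer k v S t j, excess v S t i =
      ∑ i ∈ outer k' v' S t j, excess v' S t i := by
    rw [← h.outer_eq]
    exact Finset.sum_congr rfl fun i hi => h.excess_eq (h1 i hi)
  have e2 : (outer k v S t j).filter (fun i => dist p (v i).location ≤ 2 ^ j / 32) =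
      (outer k' v' S t j).filter (fun i => dist p (v' i).location ≤ 2 ^ j / 32) := by
    rw [← h.outer_eq]
    refine Finset.filter_congr fun i hi => ?_
    rw [h.eq_of_mem (h1 i hi)]
  rw [IsHeavy, IsHeavy, e1, ← e2]
  rw [Finset.sum_congr rfl fun i hi => h.excess_eq (h1 i (Finset.filter_subset _ _ hi))]

/-- The plan and the target involve only requests released by `d.time`. A horizon in the future is
harmless, because the delay functions are known at release. -/
theorem Agree.isService (h : Agree t k v k' v') {d : Service X} (hd : IsService k v S d)
    (hdt : d.time ≤ t) : IsService k' v' S d := by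
  have h' := h.mono hdt
  have hsum : ∀ (l : List X) (f : GeneralRequest X → ℝ),
      ∑ i ∈ missed k v S d.time d.level l, f (v i) =
        ∑ i ∈ missed k' v' S d.time d.level l, f (v' i) := by
    intro l f
    rw [← h'.missed_eq]
    exact Finset.sum_congr rfl fun i hi => by
      rw [h'.eq_of_mem (mem_missed.1 hi).1]
  refine ⟨⟨h'.triggered_iff.1 hd.least.1, fun u hu => ?_⟩, ?_, fun j hj => ?_,
    hd.time_le_horizon, ?_, ?_, ?_⟩
  · rcases le_total u t with hut | hut
    · exact hd.least.2 ((h.mono hut).triggered_iff.2 hu)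
    · exact hdt.trans hut
  · rw [← h'.sum_eligible_eq]; exact hd.threshold
  · rw [← h'.sum_eligible_eq]; exact hd.below j hj
  · rw [← hsum _ fun q => q.lower d.horizon - q.lower d.time]; exact hd.budget
  · refine hd.maximal.imp (fun h1 => h'.missed_eq _ _ ▸ h1) fun h1 l hl => ?_
    rw [← hsum _ fun q => q.upper d.horizon - q.lower d.time]; exact h1 l hl
  · simpa only [h'.isHeavy_iff] using hd.target_spec

theorem isService_of_nextService {d : Service X} (h : nextService k v S = some d) :
    IsService k v S d := by
  unfold nextService at h
  split_ifs at h with h1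
  rw [← Option.some.inj h]
  exact h1.choose_spec

/-- The least trigger time is unique, so any competing service also happens by time `t`. Hence the
two predicates are equal, and the choice picks the same witness. -/
theorem Agree.nextService_eq (h : Agree t k v k' v') {d : Service X}
    (hd : nextService k v S = some d) (hdt : d.time ≤ t) : nextService k' v' S = some d := by
  have h1 := isService_of_nextService hd
  have e : IsService k' v' S = IsService k v S := by
    funext d'
    refine propext ⟨fun h2 => ?_, fun h2 => h.isService h2 ?_⟩
    · refine h.symm.isService h2 ?_
      rw [h2.least.unique (h.isService h1 hdt).least]; exact hdt
    · rw [h2.least.unique h1.least]; exact hdt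
  have e2 : nextService k' v' S = nextService k v S := by
    unfold nextService
    generalize IsService k' v' S = P at e
    subst e
    rfl
  rw [e2, hd]

theorem Agree.advance_eq (h : Agree t k v k' v') {d : Service X} (hdt : d.time ≤ t) :
    S.advance k v d = S.advance k' v' d := by
  have h' := h.mono hdt
  have hrel : ∀ i, (i < k ∧ (v i).release ≤ d.time) ↔ (i < k' ∧ (v' i).release ≤ d.time) := h'.1
  unfold ServerState.advance
  congr 1
  · ext i
    refine or_congr Iff.rfl (or_congr ⟨fun hi => ?_, fun hi => ?_⟩ ⟨fun hi => ?_, fun hi => ?_⟩)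
    · obtain ⟨h1, h2⟩ := (hrel i).1 ⟨hi.1, hi.2.1⟩
      exact ⟨h1, h2, h'.reach_eq (S := S) hi.1 hi.2.1 ▸ hi.2.2⟩
    · obtain ⟨h1, h2⟩ := (hrel i).2 ⟨hi.1, hi.2.1⟩
      exact ⟨h1, h2, (h'.reach_eq (S := S) h1 h2).symm ▸ hi.2.2⟩
    · exact ⟨h'.eligible_eq (S := S) d.level ▸ hi.1, h'.eq_of_mem hi.1 ▸ hi.2⟩
    · exact ⟨h'.eligible_eq (S := S) d.level ▸ hi.1, h'.symm.eq_of_mem hi.1 ▸ hi.2⟩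
  · funext i
    rw [h'.eligible_eq]
    split_ifs with h1 h2 h3 h3
    · rfl
    · exact h'.reach_eq h2.1 h2.2
    · exact absurd ((hrel i).1 h2) h3
    · exact absurd ((hrel i).2 h3) h2
    · rfl
  · funext i
    by_cases h1 : i ∈ eligible k v S d.time d.level
    · rw [← h'.eligible_eq, if_pos h1, if_pos h1, h'.eq_of_mem h1]
    · rw [← h'.eligible_eq, if_neg h1, if_neg h1]

theorem stateAt_succ_of_none {s : X} {n : ℕ} (h : nextService k v (stateAt k v s n) = none) :
    stateAt k v s (n + 1) = stateAt k v s n := by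
  rw [stateAt, h]

theorem stateAt_succ_of_some {s : X} {n : ℕ} {d : Service X}
    (h : nextService k v (stateAt k v s n) = some d) :
    stateAt k v s (n + 1) = (stateAt k v s n).advance k v d := by
  rw [stateAt, h]

theorem movesAt_succ_of_none {s : X} {n : ℕ} (h : nextService k v (stateAt k v s n) = none) :
    movesAt k v s (n + 1) = movesAt k v s n := by
  rw [movesAt, h, List.append_nil]

theorem movesAt_succ_of_some {s : X} {n : ℕ} {d : Service X}
    (h : nextService k v (stateAt k v s n) = some d) :
    movesAt k v s (n + 1) = movesAt k v s n ++ d.moves (stateAt k v s n).pos := by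
  rw [movesAt, h]

theorem IsService.time_le {d : Service X} (h : IsService k v S d) : S.time ≤ d.time :=
  h.least.1.1

theorem time_eq_of_mem_moves {Y : Type*} {a : Y} {d : Service Y} {m : ℝ × Y} (h : m ∈ d.moves a) :
    m.1 = d.time := by
  obtain ⟨x, -, rfl⟩ := List.mem_map.1 h
  rfl

/-- No service after the first `n` ones takes place by time `t`. -/
def QuietUntil (k : ℕ) (v : ℕ → GeneralRequest X) (s : X) (t : ℝ) (n : ℕ) : Prop :=
  ∀ d, nextService k v (stateAt k v s n) = some d → t < d.time

theorem QuietUntil.succ {s : X} {n : ℕ} (h : QuietUntil k v s t n) :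
    QuietUntil k v s t (n + 1) := by
  intro d hd
  rcases hn : nextService k v (stateAt k v s n) with _ | d'
  · rw [stateAt_succ_of_none hn] at hd
    exact h d hd
  · rw [stateAt_succ_of_some hn] at hd
    have h1 := (isService_of_nextService hd).time_le
    have h2 : (d'.time : WithBot ℝ) ≤ d.time := h1
    exact (h d' hn).trans_le (WithBot.coe_le_coe.1 h2)

theorem QuietUntil.filter_movesAt {s : X} {n : ℕ} (h : QuietUntil k v s t n) :
    (movesAt k v s (n + 1)).filter (fun m => decide (m.1 ≤ t)) =
      (movesAt k v s n).filter (fun m => decide (m.1 ≤ t)) := by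
  rcases hn : nextService k v (stateAt k v s n) with _ | d
  · rw [movesAt_succ_of_none hn]
  · rw [movesAt_succ_of_some hn, List.filter_append]
    have : (d.moves (stateAt k v s n).pos).filter (fun m => decide (m.1 ≤ t)) = [] := by
      refine List.filter_eq_nil_iff.2 fun m hm => ?_
      rw [time_eq_of_mem_moves hm]
      simpa using h d hn
    rw [this, List.append_nil]

theorem Agree.filter_movesAt_eq (h : Agree t k v k' v') (s : X) (n : ℕ) :
    (movesAt k v s n).filter (fun m => decide (m.1 ≤ t)) =
      (movesAt k' v' s n).filter (fun m => decide (m.1 ≤ t)) := by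
  -- Invariant: the states agree, or both runs have no further service by time `t`.
  suffices H : (movesAt k v s n).filter (fun m => decide (m.1 ≤ t)) =
      (movesAt k' v' s n).filter (fun m => decide (m.1 ≤ t)) ∧
      (stateAt k v s n = stateAt k' v' s n ∨
        (QuietUntil k v s t n ∧ QuietUntil k' v' s t n)) from H.1
  induction n with
  | zero => exact ⟨rfl, Or.inl rfl⟩
  | succ n ih =>
    obtain ⟨ih1, ih2⟩ := ih
    have hquiet : QuietUntil k v s t n → QuietUntil k' v' s t n →
        (movesAt k v s (n + 1)).filter (fun m => decide (m.1 ≤ t)) =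
          (movesAt k' v' s (n + 1)).filter (fun m => decide (m.1 ≤ t)) ∧
        (stateAt k v s (n + 1) = stateAt k' v' s (n + 1) ∨
          (QuietUntil k v s t (n + 1) ∧ QuietUntil k' v' s t (n + 1))) := fun h1 h2 =>
      ⟨by rw [h1.filter_movesAt, h2.filter_movesAt, ih1], Or.inr ⟨h1.succ, h2.succ⟩⟩
    rcases ih2 with he | ⟨h1, h2⟩
    · by_cases hex : ∃ d, nextService k v (stateAt k v s n) = some d ∧ d.time ≤ t
      · obtain ⟨d, hd, hdt⟩ := hex
        have hd' := h.nextService_eq hd hdt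
        rw [he] at hd'
        constructor
        · rw [movesAt_succ_of_some hd, movesAt_succ_of_some hd', List.filter_append,
            List.filter_append, ih1, he]
        · left
          rw [stateAt_succ_of_some hd, stateAt_succ_of_some hd', ← he, h.advance_eq hdt]
      · refine hquiet (fun d hd => not_le.1 fun hdt => hex ⟨d, hd, hdt⟩) fun d hd =>
          not_le.1 fun hdt => hex ⟨d, ?_, hdt⟩
        rw [← he] at hd
        exact h.symm.nextService_eq hd hdt
    · exact hquiet h1 h2

theorem stateAt_of_le {s : X} {m n : ℕ} (h : nextService k v (stateAt k v s m) = none)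
    (hmn : m ≤ n) : stateAt k v s n = stateAt k v s m ∧ movesAt k v s n = movesAt k v s m := by
  induction n, hmn using Nat.le_induction with
  | base => exact ⟨rfl, rfl⟩
  | succ n _ ih =>
    rw [← ih.1] at h
    exact ⟨(stateAt_succ_of_none h).trans ih.1, (movesAt_succ_of_none h).trans ih.2⟩

theorem time_stateAt_le_succ (s : X) (n : ℕ) :
    (stateAt k v s n).time ≤ (stateAt k v s (n + 1)).time := by
  rcases hn : nextService k v (stateAt k v s n) with _ | d
  · rw [stateAt_succ_of_none hn]
  · rw [stateAt_succ_of_some hn]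
    exact (isService_of_nextService hn).time_le

theorem movesAt_time_le (s : X) (n : ℕ) :
    ∀ m ∈ movesAt k v s n, (m.1 : WithBot ℝ) ≤ (stateAt k v s n).time := by
  induction n with
  | zero => intro m hm; simp [movesAt] at hm
  | succ n ih =>
    intro m hm
    rcases hn : nextService k v (stateAt k v s n) with _ | d
    · rw [movesAt_succ_of_none hn] at hm
      exact (ih m hm).trans (time_stateAt_le_succ s n)
    · rw [movesAt_succ_of_some hn] at hm
      rcases List.mem_append.1 hm with hm | hm
      · exact (ih m hm).trans (time_stateAt_le_succ s n)
      · rw [time_eq_of_mem_moves hm, stateAt_succ_of_some hn]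
        exact le_rfl

theorem movesAt_pairwise (s : X) (n : ℕ) :
    (movesAt k v s n).Pairwise (fun m m' => m.1 ≤ m'.1) := by
  induction n with
  | zero => simp [movesAt]
  | succ n ih =>
    rcases hn : nextService k v (stateAt k v s n) with _ | d
    · rw [movesAt_succ_of_none hn]; exact ih
    · rw [movesAt_succ_of_some hn]
      refine List.pairwise_append.2 ⟨ih, ?_, fun m hm m' hm' => ?_⟩
      · refine List.pairwise_of_forall_mem_list fun m hm m' hm' => ?_
        rw [time_eq_of_mem_moves hm, time_eq_of_mem_moves hm']
      · rw [time_eq_of_mem_moves hm']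
        exact WithBot.coe_le_coe.1
          ((movesAt_time_le s n m hm).trans (isService_of_nextService hn).time_le)

open Classical in
/-- The number of services on the whole input. -/
noncomputable def serviceCount (k : ℕ) (v : ℕ → GeneralRequest X) (s : X) : ℕ :=
  -- For finite `X` the default `0` is not used, by `exists_nextService_eq_none`.
  if h : ∃ n, nextService k v (stateAt k v s n) = none then Nat.find h else 0

/-- The schedule which the algorithm produces. -/
noncomputable def generalSchedule (k : ℕ) (v : ℕ → GeneralRequest X) (s : X) : Schedule X :=
  ⟨movesAt k v s (serviceCount k v s), movesAt_pairwise s _⟩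

/-- The inputs may lead to different numbers of services; both runs are extended, without change, to
the larger number. -/
theorem Agree.upTo_eq (h : Agree t k v k' v') (s : X)
    (h1 : ∃ n, nextService k v (stateAt k v s n) = none)
    (h2 : ∃ n, nextService k' v' (stateAt k' v' s n) = none) :
    (generalSchedule k v s).upTo t = (generalSchedule k' v' s).upTo t := by
  have e1 : nextService k v (stateAt k v s (serviceCount k v s)) = none := by
    classical
    rw [serviceCount, dif_pos h1]; exact Nat.find_spec h1
  have e2 : nextService k' v' (stateAt k' v' s (serviceCount k' v' s)) = none := by
    classical
    rw [serviceCount, dif_pos h2]; exact Nat.find_spec h2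
  change (movesAt k v s _).filter _ = (movesAt k' v' s _).filter _
  rw [← (stateAt_of_le e1 (le_max_left _ (serviceCount k' v' s))).2,
    ← (stateAt_of_le e2 (le_max_right (serviceCount k v s) _)).2]
  exact h.filter_movesAt_eq s _

end Causality

/-! ### Semicontinuity of the unpaid delay. -/

section Excess

variable {X : Type*} {v : ℕ → GeneralRequest X} {S : ServerState X}

theorem excess_nonneg (t : ℝ) (i : ℕ) : 0 ≤ excess v S t i := le_max_left _ _

theorem upperSemicontinuous_excess (i : ℕ) : UpperSemicontinuous fun t => excess v S t i := by
  have hc : Continuous fun x : ℝ => max 0 (x - S.paid i) := by fun_prop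
  exact hc.comp_upperSemicontinuous (v i).upper_usc fun _ _ h =>
    max_le_max le_rfl (sub_le_sub_right h _)

theorem isClosed_setOf_le_coe (b : WithBot ℝ) : IsClosed {t : ℝ | b ≤ t} := by
  induction b with
  | bot => simp
  | coe a => simpa only [WithBot.coe_le_coe] using isClosed_le continuous_const continuous_id'

end Excess

/-! ### Existence of the next service. -/

section Existence

variable {X : Type*} [MetricSpace X] {k : ℕ} {v : ℕ → GeneralRequest X} {S : ServerState X}

open Classical in
/-- The requests of level at most `j` which have not been served yet, released or not. -/
noncomputable def unserved (k : ℕ) (v : ℕ → GeneralRequest X) (S : ServerState X) (j : ℤ) :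
    Finset ℕ :=
  (Finset.range k).filter fun i => i ∉ S.served ∧ 0 < S.reach v i ∧ S.reach v i ≤ 2 ^ j

theorem mem_unserved {i : ℕ} {j : ℤ} : i ∈ unserved k v S j ↔
    i < k ∧ i ∉ S.served ∧ 0 < S.reach v i ∧ S.reach v i ≤ 2 ^ j := by
  classical
  simp [unserved]

theorem eligible_subset_unserved (t : ℝ) (j : ℤ) : eligible k v S t j ⊆ unserved k v S j :=
  fun _ hi =>
    have h := mem_eligible.1 hi
    mem_unserved.2 ⟨h.1, h.2.2⟩

/-- Unreleased requests have no excess, so the index set can be made independent of `t`; then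
semicontinuity in `t` applies. -/
theorem sum_eligible_eq_sum_unserved (hpaid : ∀ i, 0 ≤ S.paid i) (t : ℝ) (j : ℤ) :
    ∑ i ∈ eligible k v S t j, excess v S t i = ∑ i ∈ unserved k v S j, excess v S t i := by
  refine Finset.sum_subset (eligible_subset_unserved t j) fun i hi hni => ?_
  have h := mem_unserved.1 hi
  have hr : t < (v i).release := by
    by_contra hr
    exact hni (mem_eligible.2 ⟨h.1, not_lt.1 hr, h.2⟩)
  rw [excess, (v i).upper_eq_zero t hr, zero_sub, max_eq_left (neg_nonpos.2 (hpaid i))]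

/-- Only finitely many levels matter: below `lo` nothing is eligible, and above `hi` the unserved
requests no longer change. So the trigger times form a closed set, bounded below by the first
release. -/
theorem exists_isLeast_triggered (hpaid : ∀ i, 0 ≤ S.paid i) (h : ∃ t, Triggered k v S t) :
    ∃ T, IsLeast {t | Triggered k v S t} T ∧
      ∃ lo : ℤ, ∀ j, 2 ^ j ≤ ∑ i ∈ eligible k v S T j, excess v S T i → lo ≤ j := by
  obtain ⟨lo, hlo⟩ : ∃ lo : ℤ, ∀ i < k, ∀ j, 0 < S.reach v i → S.reach v i ≤ 2 ^ j → lo ≤ j := by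
    obtain ⟨lo, hlo⟩ := ((Finset.range k).image fun i => Int.log 2 (S.reach v i)).bddBelow
    refine ⟨lo, fun i hi j hpos hj => ?_⟩
    refine (hlo (Finset.mem_image_of_mem _ (Finset.mem_range.2 hi))).trans ?_
    have := (Int.zpow_log_le_self (R := ℝ) (b := 2) (by norm_num) hpos).trans hj
    exact (zpow_le_zpow_iff_right₀ (a := (2 : ℝ)) (by norm_num)).1 (by exact_mod_cast this)
  obtain ⟨hi, hhi⟩ : ∃ hi : ℤ, ∀ i < k, S.reach v i ≤ 2 ^ hi := by
    obtain ⟨hi, hhi⟩ := ((Finset.range k).image fun i => Int.log 2 (S.reach v i) + 1).exists_le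
    refine ⟨hi, fun i hik => ?_⟩
    have h1 := hhi _ (Finset.mem_image_of_mem _ (Finset.mem_range.2 hik))
    have h2 := (Int.lt_zpow_succ_log_self (R := ℝ) (b := 2) (by norm_num) (S.reach v i)).le
    exact h2.trans (by exact_mod_cast zpow_le_zpow_right₀ (a := (2 : ℝ)) (by norm_num) h1)
  have hlo' : ∀ t j, 2 ^ j ≤ ∑ i ∈ eligible k v S t j, excess v S t i → lo ≤ j := by
    intro t j hj
    by_contra hcon
    have he : eligible k v S t j = ∅ := by
      refine Finset.eq_empty_of_forall_notMem fun i hi => ?_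
      have h := mem_eligible.1 hi
      exact hcon (hlo i h.1 j h.2.2.2.1 h.2.2.2.2)
    rw [he, Finset.sum_empty] at hj
    exact absurd hj (not_le.2 (by positivity))
  have hset : {t | Triggered k v S t} = {t : ℝ | S.time ≤ t} ∩
      ⋃ j ∈ Finset.Icc lo (max lo hi), {t | 2 ^ j ≤ ∑ i ∈ unserved k v S j, excess v S t i} := by
    ext t
    simp only [Triggered, mem_ofPred_eq, mem_inter_iff, mem_iUnion, exists_prop]
    refine and_congr Iff.rfl ⟨?_, ?_⟩
    · rintro ⟨j, hj⟩
      have hloj := hlo' t j hj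
      rw [sum_eligible_eq_sum_unserved hpaid] at hj
      rcases le_total j (max lo hi) with h1 | h1
      · exact ⟨j, Finset.mem_Icc.2 ⟨hloj, h1⟩, hj⟩
      · refine ⟨max lo hi, Finset.mem_Icc.2 ⟨le_max_left _ _, le_rfl⟩, ?_⟩
        have e : unserved k v S (max lo hi) = unserved k v S j := by
          ext i
          simp only [mem_unserved]
          refine and_congr_right fun hik => and_congr_right fun _ => and_congr_right fun _ => ?_
          have h2 := (hhi i hik).trans
            (zpow_le_zpow_right₀ (a := (2 : ℝ)) (by norm_num) (le_max_right lo hi))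
          exact ⟨fun _ => h2.trans (zpow_le_zpow_right₀ (by norm_num) h1), fun _ => h2⟩
        rw [e]
        exact (zpow_le_zpow_right₀ (by norm_num) h1).trans hj
    · rintro ⟨j, -, hj⟩
      exact ⟨j, by rwa [sum_eligible_eq_sum_unserved hpaid]⟩
  have hclosed : IsClosed {t | Triggered k v S t} := by
    rw [hset]
    refine (isClosed_setOf_le_coe _).inter (isClosed_biUnion_finset fun j _ => ?_)
    exact (upperSemicontinuous_sum fun i _ =>
      upperSemicontinuous_excess i).isClosed_preimage _
  have hbdd : BddBelow {t | Triggered k v S t} := by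
    obtain ⟨b, hb⟩ := ((Finset.range k).image fun i => (v i).release).bddBelow
    refine ⟨b, fun t ht => ?_⟩
    obtain ⟨-, j, hj⟩ := ht
    have hne : (eligible k v S t j).Nonempty := by
      rw [Finset.nonempty_iff_ne_empty]
      intro he
      rw [he, Finset.sum_empty] at hj
      exact absurd hj (not_le.2 (by positivity))
    obtain ⟨i, hi⟩ := hne
    have h1 := mem_eligible.1 hi
    exact (hb (Finset.mem_image_of_mem _ (Finset.mem_range.2 h1.1))).trans h1.2.1
  exact ⟨sInf _, ⟨hclosed.csInf_mem h hbdd, fun t ht => csInf_le hbdd ht⟩, lo, hlo' _⟩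

/-- The horizon is the first time from which every repetition-free tour uses up `B`. Before it some
tour is below `B`; there are finitely many tours, so by lower semicontinuity one of them is still
within `B` at the horizon. -/
theorem exists_plan [Finite X] (a : X) (T B : ℝ) (hB : 0 ≤ B)
    (miss : List X → Finset ℕ) :
    ∃ (l : List X) (τ : ℝ), T ≤ τ ∧
      tour a l + ∑ i ∈ miss l, ((v i).lower τ - (v i).lower T) ≤ B ∧
      (miss l = ∅ ∨ ∀ l : List X, l.Nodup → B ≤ tour a l +
        ∑ i ∈ miss l, ((v i).upper τ - (v i).lower T)) := by
  by_cases hfull : ∃ l : List X, l.Nodup ∧ miss l = ∅ ∧ tour a l ≤ B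
  · obtain ⟨l, -, h1, h2⟩ := hfull
    exact ⟨l, T, le_rfl, by rw [h1, Finset.sum_empty, add_zero]; exact h2, Or.inl h1⟩
  have hfin : {l : List X | l.Nodup}.Finite := by
    have := Fintype.ofFinite X
    exact (List.finite_length_le X (Fintype.card X)).subset fun l hl => List.Nodup.length_le_card hl
  set A : Set ℝ := {t | T ≤ t ∧ ∀ l : List X, l.Nodup → B ≤ tour a l +
    ∑ i ∈ miss l, ((v i).upper t - (v i).lower T)} with hA
  have hterm : ∀ t, T ≤ t → ∀ i, 0 ≤ (v i).upper t - (v i).lower T := fun t ht i =>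
    sub_nonneg.2 (((v i).lower_mono ht).trans ((v i).lower_le_upper t))
  have hne : A.Nonempty := by
    have hl : ∀ l : List X, l.Nodup → ∃ t, T ≤ t ∧ ∀ u, t ≤ u → B ≤ tour a l +
        ∑ i ∈ miss l, ((v i).upper u - (v i).lower T) := by
      intro l hl
      by_cases hcase : tour a l ≤ B
      · have hne : (miss l).Nonempty := by
          rw [Finset.nonempty_iff_ne_empty]
          exact fun he => hfull ⟨l, hl, he, hcase⟩
        obtain ⟨i, hi⟩ := hne
        obtain ⟨t, ht⟩ := (v i).upper_unbounded (B + (v i).lower T)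
        refine ⟨max T t, le_max_left _ _, fun u hu => ?_⟩
        have h1 := (v i).upper_mono ((le_max_right T t).trans hu)
        have h2 := Finset.single_le_sum
          (fun j _ => hterm u ((le_max_left T t).trans hu) j) hi
        linarith [tour_nonneg a l]
      · refine ⟨T, le_rfl, fun u hu => ?_⟩
        have h2 := Finset.sum_nonneg fun j (_ : j ∈ miss l) => hterm u hu j
        linarith
    choose! f hf1 hf2 using hl
    obtain ⟨b, hb⟩ := (hfin.image f).bddAbove
    refine ⟨max T b, le_max_left _ _, fun l hl => hf2 l hl _ ?_⟩
    exact (hb (mem_image_of_mem f hl)).trans (le_max_right _ _)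
  have hclosed : IsClosed A := by
    have : A = Ici T ∩ ⋂ l ∈ {l : List X | l.Nodup},
        {t | B - tour a l + ∑ i ∈ miss l, (v i).lower T ≤ ∑ i ∈ miss l, (v i).upper t} := by
      ext t
      simp only [hA, mem_ofPred_eq, mem_inter_iff, mem_Ici, mem_iInter, Finset.sum_sub_distrib]
      refine and_congr Iff.rfl (forall_congr' fun l => imp_congr Iff.rfl ?_)
      constructor <;> intro h <;> linarith
    rw [this]
    refine isClosed_Ici.inter (isClosed_biInter fun l _ => ?_)
    exact (upperSemicontinuous_sum fun i _ => (v i).upper_usc).isClosed_preimage _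
  have hbdd : BddBelow A := ⟨T, fun t ht => ht.1⟩
  set τ := sInf A with hτ
  have hmem : τ ∈ A := hclosed.csInf_mem hne hbdd
  rcases hmem.1.eq_or_lt with heq | hlt
  -- If the horizon is `T` itself, no delay is prepaid and staying in place is a plan.
  · refine ⟨[], τ, hmem.1, ?_, Or.inr hmem.2⟩
    rw [tour_nil, ← heq]
    simpa using hB
  · set C : Set ℝ := ⋃ l ∈ {l : List X | l.Nodup},
      {t | ∑ i ∈ miss l, (v i).lower t ≤ B - tour a l + ∑ i ∈ miss l, (v i).lower T} with hC
    have hCclosed : IsClosed C := hfin.isClosed_biUnion fun l _ =>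
      (lowerSemicontinuous_sum fun i _ => (v i).lower_lsc).isClosed_preimage _
    have hsub : Ico T τ ⊆ C := by
      intro t ht
      have hnt : t ∉ A := fun h => absurd (csInf_le hbdd h) (not_le.2 ht.2)
      simp only [hA, mem_ofPred_eq, not_and, not_forall, not_le] at hnt
      obtain ⟨l, hl, hlt⟩ := hnt ht.1
      refine mem_biUnion hl ?_
      have h1 : ∑ i ∈ miss l, (v i).lower t ≤ ∑ i ∈ miss l, (v i).upper t :=
        Finset.sum_le_sum fun i _ => (v i).lower_le_upper t
      rw [Finset.sum_sub_distrib] at hlt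
      simp only [mem_ofPred_eq]
      linarith
    have hτC : τ ∈ C := by
      refine closure_minimal hsub hCclosed ?_
      rw [closure_Ico hlt.ne]
      exact right_mem_Icc.2 hlt.le
    obtain ⟨l, hl, hle⟩ := mem_iUnion₂.1 hτC
    refine ⟨l, τ, hmem.1, ?_, Or.inr hmem.2⟩
    rw [Finset.sum_sub_distrib]
    simp only [mem_ofPred_eq] at hle
    linarith

theorem exists_isService [Finite X] (hpaid : ∀ i, 0 ≤ S.paid i)
    (h : ∃ t, Triggered k v S t) : ∃ d, IsService k v S d := by
  obtain ⟨T, hT, lo, hlo⟩ := exists_isLeast_triggered hpaid h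
  obtain ⟨ℓ, hℓ, hmin⟩ := Int.exists_least_of_bdd ⟨lo, hlo⟩ hT.1.2
  obtain ⟨l, τ, h1, h2, h3⟩ := exists_plan (v := v) S.pos T (8 * 2 ^ ℓ)
    (by positivity) (missed k v S T ℓ)
  obtain ⟨p, hp⟩ : ∃ p, IsHeavy k v S T ℓ p ∨ p = S.pos ∧ ∀ p, ¬ IsHeavy k v S T ℓ p := by
    by_cases hex : ∃ p, IsHeavy k v S T ℓ p
    · exact ⟨hex.choose, Or.inl hex.choose_spec⟩
    · exact ⟨S.pos, Or.inr ⟨rfl, fun p hp => hex ⟨p, hp⟩⟩⟩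
  exact ⟨⟨T, ℓ, l, τ, p⟩, hT, hℓ, fun j hj => not_le.1 fun hle => absurd (hmin j hle) (not_le.2 hj),
    h1, h2, h3, hp⟩

end Existence

/-! ### The effect and the cost of one service. -/

section Steps

variable {X : Type*} [MetricSpace X] {k : ℕ} {v : ℕ → GeneralRequest X} {S : ServerState X}
  {d : Service X}

theorem mem_outer {t : ℝ} {i : ℕ} {j : ℤ} :
    i ∈ outer k v S t j ↔ i ∈ eligible k v S t j ∧ 2 ^ (j - 1) < S.reach v i := by
  simp [outer]

theorem dist_le_reach (i : ℕ) : dist S.pos (v i).location ≤ S.reach v i := le_max_right _ _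

theorem radius_le_reach (i : ℕ) : S.radius i ≤ S.reach v i := le_max_left _ _

theorem reach_nonneg (i : ℕ) : 0 ≤ S.reach v i := dist_nonneg.trans (dist_le_reach i)

/-- As the level is minimal, the requests of lower level carry less than half of the threshold. -/
theorem IsService.le_sum_outer (h : IsService k v S d) :
    2 ^ (d.level - 1) ≤ ∑ i ∈ outer k v S d.time d.level, excess v S d.time i := by
  have h1 := h.threshold
  have h2 := h.below (d.level - 1) (by omega)
  have h3 : ∑ i ∈ eligible k v S d.time d.level, excess v S d.time i ≤
      ∑ i ∈ outer k v S d.time d.level, excess v S d.time i +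
        ∑ i ∈ eligible k v S d.time (d.level - 1), excess v S d.time i := by
    classical
    have hnn : 0 ≤ ∑ i ∈ outer k v S d.time d.level ∩ eligible k v S d.time (d.level - 1),
        excess v S d.time i := Finset.sum_nonneg fun i _ => excess_nonneg _ i
    rw [← Finset.sum_union_inter]
    refine le_trans ?_ (le_add_of_nonneg_right hnn)
    refine Finset.sum_le_sum_of_subset_of_nonneg (fun i hi => ?_) fun i _ _ => excess_nonneg _ i
    rw [Finset.mem_union, mem_outer, mem_eligible (j := d.level - 1)]
    by_cases hr : 2 ^ (d.level - 1) < S.reach v i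
    · exact Or.inl ⟨hi, hr⟩
    · have := mem_eligible.1 hi
      exact Or.inr ⟨this.1, this.2.1, this.2.2.1, this.2.2.2.1, not_lt.1 hr⟩
  have e : (2 : ℝ) ^ d.level = 2 ^ (d.level - 1) + 2 ^ (d.level - 1) := by
    have := zpow_add_one₀ (two_ne_zero (α := ℝ)) (d.level - 1)
    rw [sub_add_cancel] at this
    rw [this]; ring
  linarith

/-- A heavy target has some request of positive excess within `2 ^ d.level / 32`, and that request
is within reach of the server. -/
theorem IsService.dist_target_le (h : IsService k v S d) :
    dist S.pos d.target ≤ 2 * 2 ^ d.level := by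
  have hpos : (0 : ℝ) < 2 ^ d.level := by positivity
  rcases h.target_spec with h1 | h1
  · have h2 := h.le_sum_outer
    have h3 : (0 : ℝ) < 2 ^ (d.level - 1) := by positivity
    unfold IsHeavy at h1
    have h4 : ((outer k v S d.time d.level).filter
        fun i => dist d.target (v i).location ≤ 2 ^ d.level / 32).Nonempty := by
      rw [Finset.nonempty_iff_ne_empty]
      intro he
      rw [he, Finset.sum_empty] at h1
      linarith
    obtain ⟨i, hi⟩ := h4
    obtain ⟨hi, hi'⟩ := Finset.mem_filter.1 hi
    have h5 := (mem_eligible.1 (mem_outer.1 hi).1).2.2.2.2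
    have h6 := dist_le_reach (S := S) (v := v) i
    linarith [dist_triangle_right S.pos d.target (v i).location]
  · rw [h1.1, dist_self]; positivity

theorem pathLength_moves_le (h : IsService k v S d) :
    pathLength S.pos ((d.moves S.pos).map Prod.snd) ≤ 10 * 2 ^ d.level := by
  have e : (d.moves S.pos).map Prod.snd = (d.route ++ [S.pos]) ++ [d.target] := by
    simp [Service.moves]
  rw [e, pathLength_append]
  have h1 := h.budget
  have h2 := h.dist_target_le
  have h3 : 0 ≤ ∑ i ∈ missed k v S d.time d.level d.route,
      ((v i).lower d.horizon - (v i).lower d.time) := Finset.sum_nonneg fun i _ =>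
    sub_nonneg.2 ((v i).lower_mono h.time_le_horizon)
  simp only [pathLength, List.getLastD_concat]
  change tour S.pos d.route + _ ≤ _
  linarith

theorem advance_radius_of_mem {i : ℕ} (hi : i ∈ eligible k v S d.time d.level) :
    (S.advance k v d).radius i = 2 ^ (d.level + 1) := by
  simp [ServerState.advance, hi]

theorem advance_radius_of_released {i : ℕ} (hi : i ∉ eligible k v S d.time d.level)
    (hk : i < k) (hr : (v i).release ≤ d.time) :
    (S.advance k v d).radius i = S.reach v i := by
  simp [ServerState.advance, hi, hk, hr]

theorem advance_radius_of_not_released {i : ℕ} (hr : ¬ (i < k ∧ (v i).release ≤ d.time)) :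
    (S.advance k v d).radius i = S.radius i := by
  have hi : i ∉ eligible k v S d.time d.level := fun h =>
    hr ⟨(mem_eligible.1 h).1, (mem_eligible.1 h).2.1⟩
  simp only [ServerState.advance, if_neg hi, if_neg hr]

theorem advance_paid_of_notMem {i : ℕ} (hi : i ∉ eligible k v S d.time d.level) :
    (S.advance k v d).paid i = S.paid i := by
  simp [ServerState.advance, hi]

open Classical in
theorem advance_paid_of_mem {i : ℕ} (hi : i ∈ eligible k v S d.time d.level) :
    (S.advance k v d).paid i = max (S.paid i)
      ((v i).lower (if (v i).location ∈ d.route then d.time else d.horizon)) := by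
  simp [ServerState.advance, hi]

theorem mem_advance_served {i : ℕ} : i ∈ (S.advance k v d).served ↔ i ∈ S.served ∨
    (i < k ∧ (v i).release ≤ d.time ∧ S.reach v i = 0) ∨
    (i ∈ eligible k v S d.time d.level ∧ (v i).location ∈ d.route) := Iff.rfl

theorem radius_le_advance (i : ℕ) : S.radius i ≤ (S.advance k v d).radius i := by
  by_cases hi : i ∈ eligible k v S d.time d.level
  · rw [advance_radius_of_mem hi]
    refine (radius_le_reach (v := v) i).trans ((mem_eligible.1 hi).2.2.2.2.trans ?_)
    exact zpow_le_zpow_right₀ (by norm_num) (by omega)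
  · by_cases hr : i < k ∧ (v i).release ≤ d.time
    · rw [advance_radius_of_released hi hr.1 hr.2]
      exact radius_le_reach i
    · rw [advance_radius_of_not_released hr]

theorem paid_le_advance (i : ℕ) : S.paid i ≤ (S.advance k v d).paid i := by
  by_cases hi : i ∈ eligible k v S d.time d.level
  · rw [advance_paid_of_mem hi]; exact le_max_left _ _
  · rw [advance_paid_of_notMem hi]

theorem lower_le_advance_paid (hτ : d.time ≤ d.horizon) {i : ℕ}
    (hi : i ∈ eligible k v S d.time d.level) :
    (v i).lower d.time ≤ (S.advance k v d).paid i := by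
  rw [advance_paid_of_mem hi]
  refine le_trans ((v i).lower_mono ?_) (le_max_right _ _)
  split_ifs
  · exact le_rfl
  · exact hτ

/-- Eligible requests left behind are raised to `2 ^ (d.level + 1)`; the other pending ones had a
larger reach already, which is now frozen as radius. This separates services of equal level. -/
theorem lt_advance_radius {i : ℕ} (hk : i < k) (hr : (v i).release ≤ d.time)
    (hs : i ∉ (S.advance k v d).served) : 2 ^ d.level < (S.advance k v d).radius i := by
  by_cases hi : i ∈ eligible k v S d.time d.level
  · rw [advance_radius_of_mem hi]
    exact zpow_lt_zpow_right₀ (by norm_num) (by omega)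
  · rw [advance_radius_of_released hi hk hr]
    rw [mem_advance_served, not_or, not_or] at hs
    by_contra hcon
    refine hi (mem_eligible.2 ⟨hk, hr, hs.1, (reach_nonneg i).lt_of_ne fun h => ?_,
      not_lt.1 hcon⟩)
    exact hs.2.1 ⟨hk, hr, h.symm⟩

open Classical in
/-- The delay cost which is paid for in a service. -/
theorem advance_paid_le (hτ : d.time ≤ d.horizon) {i : ℕ}
    (hi : i ∈ eligible k v S d.time d.level) :
    (S.advance k v d).paid i ≤ S.paid i + max 0 ((v i).lower d.time - S.paid i) +
      if (v i).location ∈ d.route then 0 else ((v i).lower d.horizon - (v i).lower d.time) := by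
  have h1 := (v i).lower_mono hτ
  have h2 := le_max_left 0 ((v i).lower d.time - S.paid i)
  have h3 := le_max_right 0 ((v i).lower d.time - S.paid i)
  rw [advance_paid_of_mem hi]
  split_ifs <;> refine max_le ?_ ?_ <;> linarith

/-- The delay costs which have accrued up to the time of the service are covered by the level. -/
def IsCovered (k : ℕ) (v : ℕ → GeneralRequest X) (S : ServerState X) (t : ℝ) : Prop :=
  ∀ j : ℤ, ∑ i ∈ eligible k v S t j, max 0 ((v i).lower t - S.paid i) ≤ 2 ^ j

open Classical in
theorem IsService.sum_missed_eq (l : List X) (f : ℕ → ℝ) :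
    ∑ i ∈ missed k v S d.time d.level l, f i =
      ∑ i ∈ eligible k v S d.time d.level, if (v i).location ∈ l then 0 else f i := by
  classical
  rw [missed, Finset.sum_filter]
  refine Finset.sum_congr rfl fun i _ => ?_
  by_cases h : (v i).location ∈ l <;> simp [h]

theorem IsService.sum_missed_lower_le (h : IsService k v S d) :
    ∑ i ∈ missed k v S d.time d.level d.route,
      ((v i).lower d.horizon - (v i).lower d.time) ≤ 8 * 2 ^ d.level := by
  linarith [h.budget, tour_nonneg S.pos d.route]

open Classical in
-- One `2 ^ d.level` covers the delay accrued so far, by `IsCovered`, and eight the delay of the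
-- missed requests, by the budget.
theorem IsService.sum_advance_paid_le (h : IsService k v S d) (hc : IsCovered k v S d.time) :
    ∑ i ∈ Finset.range k, (S.advance k v d).paid i ≤
      ∑ i ∈ Finset.range k, S.paid i + 9 * 2 ^ d.level := by
  have h1 : ∑ i ∈ Finset.range k, ((S.advance k v d).paid i - S.paid i) =
      ∑ i ∈ eligible k v S d.time d.level, ((S.advance k v d).paid i - S.paid i) := by
    refine (Finset.sum_subset (fun i hi => Finset.mem_range.2 (mem_eligible.1 hi).1)
      fun i _ hi => ?_).symm
    rw [advance_paid_of_notMem hi, sub_self]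
  have h2 : ∑ i ∈ eligible k v S d.time d.level, ((S.advance k v d).paid i - S.paid i) ≤
      ∑ i ∈ eligible k v S d.time d.level, (max 0 ((v i).lower d.time - S.paid i) +
        if (v i).location ∈ d.route then 0 else ((v i).lower d.horizon - (v i).lower d.time)) :=
    Finset.sum_le_sum fun i hi => by linarith [advance_paid_le h.time_le_horizon hi]
  rw [Finset.sum_add_distrib, ← IsService.sum_missed_eq] at h2
  rw [Finset.sum_sub_distrib] at h1
  linarith [hc d.level, h.sum_missed_lower_le]

open Classical in
theorem IsService.advance_paid_le_add (h : IsService k v S d) (hc : IsCovered k v S d.time)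
    {i : ℕ} (hi : i ∈ eligible k v S d.time d.level) :
    (S.advance k v d).paid i ≤ S.paid i + 9 * 2 ^ d.level := by
  have h1 := advance_paid_le h.time_le_horizon hi
  have h2 := Finset.single_le_sum (f := fun i => max 0 ((v i).lower d.time - S.paid i))
    (fun i _ => le_max_left _ _) hi
  have h3 := Finset.single_le_sum (f := fun i => if (v i).location ∈ d.route then 0 else
    ((v i).lower d.horizon - (v i).lower d.time)) (fun i _ => by
      split_ifs
      · exact le_rfl
      · exact sub_nonneg.2 ((v i).lower_mono h.time_le_horizon)) hi
  rw [← IsService.sum_missed_eq] at h3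
  linarith [hc d.level, h.sum_missed_lower_le]

/-- Requests touched by the service are paid up to its time. The others have kept their `paid` and
can only have become of higher level. -/
theorem IsService.isCovered_advance (h : IsService k v S d) (hc : IsCovered k v S d.time) :
    IsCovered k v (S.advance k v d) d.time := by
  intro j
  have key : ∀ i ∈ eligible k v (S.advance k v d) d.time j,
      max 0 ((v i).lower d.time - (S.advance k v d).paid i) ≠ 0 →
      d.level < j ∧ i ∉ eligible k v S d.time d.level ∧ i ∈ eligible k v S d.time j := by
    intro i hi hne
    obtain ⟨h1, h2, h3, h4, h5⟩ := mem_eligible.1 hi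
    have hlt := lt_advance_radius h1 h2 h3
    have hni : i ∉ eligible k v S d.time d.level := by
      intro hmem
      refine hne (max_eq_left (sub_nonpos.2 ?_))
      exact lower_le_advance_paid h.time_le_horizon hmem
    have hlt' := hlt.trans_le ((radius_le_reach i).trans h5)
    refine ⟨(zpow_lt_zpow_iff_right₀ (by norm_num : (1 : ℝ) < 2)).1 hlt', hni, ?_⟩
    have e := advance_radius_of_released hni h1 h2
    rw [mem_advance_served, not_or] at h3
    refine mem_eligible.2 ⟨h1, h2, h3.1, ?_, ?_⟩
    · rw [← e]; exact lt_trans (by positivity) hlt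
    · rw [← e]; exact (radius_le_reach i).trans h5
  rw [← Finset.sum_filter_ne_zero]
  refine le_trans ?_ (hc j)
  refine (Finset.sum_congr rfl fun i hi => ?_).trans_le
    (Finset.sum_le_sum_of_subset_of_nonneg (fun i hi => ?_) fun i _ _ => le_max_left _ _)
  · obtain ⟨hi, hne⟩ := Finset.mem_filter.1 hi
    rw [advance_paid_of_notMem (key i hi hne).2.1]
  · obtain ⟨hi, hne⟩ := Finset.mem_filter.1 hi
    exact (key i hi hne).2.2

/-- Just before `d.time` nothing was triggered, so the bound holds there, even for `upper`; lower
semicontinuity carries it to `d.time`. Only a service at the time of the previous one needs `hc`. -/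
theorem IsService.isCovered (h : IsService k v S d) (hpaid : ∀ i, 0 ≤ S.paid i)
    (hc : ∀ t : ℝ, S.time = t → IsCovered k v S t) : IsCovered k v S d.time := by
  rcases h.time_le.eq_or_lt with heq | hlt
  · exact hc _ heq
  intro j
  obtain ⟨a, ha, haT⟩ : ∃ a : ℝ, S.time ≤ a ∧ a < d.time := by
    rcases hS : S.time with _ | a
    · exact ⟨d.time - 1, bot_le, by linarith⟩
    · rw [hS] at hlt
      exact ⟨a, le_rfl, WithBot.coe_lt_coe.1 hlt⟩
  have hC : IsClosed {t | ∑ i ∈ unserved k v S j, max 0 ((v i).lower t - S.paid i) ≤ 2 ^ j} := by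
    have hlsc : ∀ i, LowerSemicontinuous fun t => max 0 ((v i).lower t - S.paid i) := fun i => by
      have hcont : Continuous fun x : ℝ => max 0 (x - S.paid i) := by fun_prop
      exact hcont.comp_lowerSemicontinuous (v i).lower_lsc fun _ _ h =>
        max_le_max le_rfl (sub_le_sub_right h _)
    exact (lowerSemicontinuous_sum fun i _ => hlsc i).isClosed_preimage _
  have hsub : Ico a d.time ⊆
      {t | ∑ i ∈ unserved k v S j, max 0 ((v i).lower t - S.paid i) ≤ 2 ^ j} := by
    intro t ht
    have hnt : ¬ Triggered k v S t := fun hT => absurd (h.least.2 hT) (not_le.2 ht.2)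
    have h1 : ∑ i ∈ eligible k v S t j, excess v S t i < 2 ^ j := by
      by_contra hcon
      exact hnt ⟨ha.trans (WithBot.coe_le_coe.2 ht.1), j, not_lt.1 hcon⟩
    rw [sum_eligible_eq_sum_unserved hpaid] at h1
    refine le_trans (Finset.sum_le_sum fun i _ => ?_) h1.le
    exact max_le_max le_rfl (sub_le_sub_right ((v i).lower_le_upper t) _)
  have hmem := closure_minimal hsub hC
    (by rw [closure_Ico haT.ne]; exact right_mem_Icc.2 haT.le)
  exact (Finset.sum_le_sum_of_subset_of_nonneg (eligible_subset_unserved _ j)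
    fun i _ _ => le_max_left _ _).trans hmem

end Steps

/-! ### Executions: monotonicity, bounds and service of the requests. -/

/-- The first `m` services of the algorithm on an input of `k` requests: the states `S`, the
services `d`, and the movements `M` before each of them. -/
structure IsExecution {X : Type*} [MetricSpace X] (k : ℕ) (v : ℕ → GeneralRequest X) (s : X)
    (S : ℕ → ServerState X) (d : ℕ → Service X) (M : ℕ → List (ℝ × X)) (m : ℕ) : Prop where
  state_zero : S 0 = ServerState.init s
  moves_zero : M 0 = []
  isService : ∀ i < m, IsService k v (S i) (d i)
  state_succ : ∀ i < m, S (i + 1) = (S i).advance k v (d i)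
  moves_succ : ∀ i < m, M (i + 1) = M i ++ (d i).moves (S i).pos

namespace IsExecution

variable {X : Type*} [MetricSpace X] {k : ℕ} {v : ℕ → GeneralRequest X} {s : X}
  {S : ℕ → ServerState X} {d : ℕ → Service X} {M : ℕ → List (ℝ × X)} {m : ℕ}

theorem time_succ (h : IsExecution k v s S d M m) {i : ℕ} (hi : i < m) :
    (S (i + 1)).time = (d i).time := by
  rw [h.state_succ i hi]; rfl

theorem pos_succ (h : IsExecution k v s S d M m) {i : ℕ} (hi : i < m) :
    (S (i + 1)).pos = (d i).target := by
  rw [h.state_succ i hi]; rfl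

theorem of_succ_le (h : IsExecution k v s S d M m) {i : ℕ}
    {p : ServerState X → ServerState X → Prop}
    (hrefl : ∀ a, p a a) (htrans : ∀ a b c, p a b → p b c → p a c)
    (hstep : ∀ i < m, p (S i) ((S i).advance k v (d i))) {j : ℕ} (hij : i ≤ j) (hj : j ≤ m) :
    p (S i) (S j) := by
  induction j, hij using Nat.le_induction with
  | base => exact hrefl _
  | succ j hij ih =>
    refine htrans _ _ _ (ih (by omega)) ?_
    rw [h.state_succ j hj]
    exact hstep j hj

theorem time_mono (h : IsExecution k v s S d M m) {i j : ℕ} (hij : i ≤ j) (hj : j ≤ m) :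
    (S i).time ≤ (S j).time :=
  h.of_succ_le (p := fun a b => a.time ≤ b.time) (fun _ => le_rfl) (fun _ _ _ => le_trans)
    (fun i hi => (h.isService i hi).time_le) hij hj

theorem radius_mono (h : IsExecution k v s S d M m) {i j : ℕ} (hij : i ≤ j) (hj : j ≤ m)
    (q : ℕ) : (S i).radius q ≤ (S j).radius q :=
  h.of_succ_le (p := fun a b => a.radius q ≤ b.radius q) (fun _ => le_rfl)
    (fun _ _ _ => le_trans) (fun _ _ => radius_le_advance q) hij hj

theorem paid_mono (h : IsExecution k v s S d M m) {i j : ℕ} (hij : i ≤ j) (hj : j ≤ m)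
    (q : ℕ) : (S i).paid q ≤ (S j).paid q :=
  h.of_succ_le (p := fun a b => a.paid q ≤ b.paid q) (fun _ => le_rfl)
    (fun _ _ _ => le_trans) (fun _ _ => paid_le_advance q) hij hj

theorem served_mono (h : IsExecution k v s S d M m) {i j : ℕ} (hij : i ≤ j) (hj : j ≤ m) :
    ∀ q ∈ (S i).served, q ∈ (S j).served :=
  h.of_succ_le (p := fun a b => ∀ q ∈ a.served, q ∈ b.served) (fun _ _ => id)
    (fun _ _ _ h1 h2 q hq => h2 q (h1 q hq)) (fun _ _ _ hq => Or.inl hq) hij hj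

theorem time_service_lt (h : IsExecution k v s S d M m) {i j : ℕ} (hij : i < j) (hj : j ≤ m) :
    ((d i).time : WithBot ℝ) ≤ (S j).time := by
  rw [← h.time_succ (hij.trans_le hj)]
  exact h.time_mono hij hj

theorem time_service_mono (h : IsExecution k v s S d M m) {i j : ℕ} (hij : i ≤ j) (hj : j < m) :
    (d i).time ≤ (d j).time := by
  rcases hij.eq_or_lt with rfl | hij
  · exact le_rfl
  · exact WithBot.coe_le_coe.1 ((h.time_service_lt hij hj.le).trans (h.isService j hj).time_le)

theorem unseen (h : IsExecution k v s S d M m) {i : ℕ} (hi : i ≤ m) {q : ℕ}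
    (hq : (S i).time < (v q).release) :
    q ∉ (S i).served ∧ (S i).radius q = 0 ∧ (S i).paid q = 0 := by
  induction i with
  | zero => rw [h.state_zero]; exact ⟨id, rfl, rfl⟩
  | succ i ih =>
    have hi' : i < m := hi
    have hlt : ¬ (v q).release ≤ (d i).time := by
      rw [h.time_succ hi'] at hq
      exact not_le.2 (WithBot.coe_lt_coe.1 hq)
    obtain ⟨h1, h2, h3⟩ := ih hi'.le ((h.time_mono (Nat.le_succ i) hi).trans_lt hq)
    have hne : q ∉ eligible k v (S i) (d i).time (d i).level := fun hm =>
      hlt (mem_eligible.1 hm).2.1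
    rw [h.state_succ i hi', mem_advance_served, advance_radius_of_not_released fun h => hlt h.2,
      advance_paid_of_notMem hne]
    exact ⟨fun hs => hs.elim h1 fun hs => hs.elim (fun h => hlt h.2.1) fun h => hne h.1, h2, h3⟩

theorem paid_nonneg (h : IsExecution k v s S d M m) {i : ℕ} (hi : i ≤ m) (q : ℕ) :
    0 ≤ (S i).paid q := by
  have h1 := h.paid_mono (Nat.zero_le i) hi q
  rwa [h.state_zero] at h1

theorem lt_radius (h : IsExecution k v s S d M m) {i j : ℕ} (hij : i < j) (hj : j ≤ m) {q : ℕ}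
    (hq : q < k) (hr : (v q).release ≤ (d i).time) (hs : q ∉ (S j).served) :
    2 ^ (d i).level < (S j).radius q := by
  have hi : i < m := hij.trans_le hj
  refine lt_of_lt_of_le ?_ (h.radius_mono (Nat.succ_le_of_lt hij) hj q)
  rw [Nat.succ_eq_add_one, h.state_succ i hi]
  refine lt_advance_radius hq hr fun hs' => hs (h.served_mono (Nat.succ_le_of_lt hij) hj q ?_)
  rw [Nat.succ_eq_add_one, h.state_succ i hi]
  exact hs'

/-- A pending request was released after every earlier service of at least its level. -/
theorem lt_release (h : IsExecution k v s S d M m) {i j : ℕ} {ℓ : ℤ} (hij : i < j) (hj : j < m)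
    {q : ℕ} (hq : q ∈ eligible k v (S j) (d j).time ℓ) (hℓ : ℓ ≤ (d i).level) :
    (d i).time < (v q).release := by
  by_contra hcon
  have h1 := mem_eligible.1 hq
  have h2 := h.lt_radius hij hj.le h1.1 (not_lt.1 hcon) h1.2.2.1
  have h3 : (2 : ℝ) ^ ℓ ≤ 2 ^ (d i).level := zpow_le_zpow_right₀ (by norm_num) hℓ
  linarith [radius_le_reach (S := S j) (v := v) q, h1.2.2.2.2]

theorem isCovered (h : IsExecution k v s S d M m) {i : ℕ} (hi : i ≤ m) :
    ∀ t : ℝ, (S i).time = t → IsCovered k v (S i) t := by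
  induction i with
  | zero =>
    intro t ht
    rw [h.state_zero] at ht
    exact absurd ht.symm (WithBot.coe_ne_bot)
  | succ i ih =>
    intro t ht
    rw [h.time_succ hi] at ht
    rw [← WithBot.coe_inj.1 ht, h.state_succ i hi]
    have hs := h.isService i hi
    exact hs.isCovered_advance (hs.isCovered (h.paid_nonneg (Nat.le_of_succ_le hi))
      (ih (Nat.le_of_succ_le hi)))

theorem isCovered_service (h : IsExecution k v s S d M m) {i : ℕ} (hi : i < m) :
    IsCovered k v (S i) (d i).time :=
  (h.isService i hi).isCovered (h.paid_nonneg hi.le) (h.isCovered hi.le)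

theorem sum_paid_le (h : IsExecution k v s S d M m) {i : ℕ} (hi : i ≤ m) :
    ∑ q ∈ Finset.range k, (S i).paid q ≤ 9 * ∑ j ∈ Finset.range i, (2 : ℝ) ^ (d j).level := by
  induction i with
  | zero => rw [h.state_zero]; simp [ServerState.init]
  | succ i ih =>
    have h1 := (h.isService i hi).sum_advance_paid_le (h.isCovered_service hi)
    rw [h.state_succ i hi, Finset.sum_range_succ]
    linarith [ih (Nat.le_of_succ_le hi)]

/-- A service of level `ℓ` adds at most `9 * 2 ^ ℓ` to what is paid, while the radius rises from at
most `2 ^ ℓ` to `2 * 2 ^ ℓ`. -/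
theorem paid_le_radius (h : IsExecution k v s S d M m) {i : ℕ} (hi : i ≤ m) (q : ℕ) :
    (S i).paid q ≤ 9 * (S i).radius q := by
  induction i with
  | zero => rw [h.state_zero]; simp [ServerState.init]
  | succ i ih =>
    have ih := ih (Nat.le_of_succ_le hi)
    rw [h.state_succ i hi]
    by_cases hq : q ∈ eligible k v (S i) (d i).time (d i).level
    · have h1 := (h.isService i hi).advance_paid_le_add (h.isCovered_service hi) hq
      have h2 := (radius_le_reach (v := v) q).trans (mem_eligible.1 hq).2.2.2.2
      rw [advance_radius_of_mem hq, zpow_add_one₀ two_ne_zero]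
      linarith
    · rw [advance_paid_of_notMem hq]
      linarith [radius_le_advance (k := k) (v := v) (S := S i) (d := d i) q]

/-- If a service leaves a request behind, maximality applies to the tour through all of `X`, which
misses nothing; so its length is at least the whole budget. -/
theorem radius_le (h : IsExecution k v s S d M m) {Γ : ℝ} (hΓ : ∀ x y : X, dist x y ≤ Γ)
    (hL : ∃ l : List X, l.Nodup ∧ (∀ x, x ∈ l) ∧ ∀ a, tour a l ≤ Γ) {i : ℕ} (hi : i ≤ m)
    {q : ℕ} (hq : q ∉ (S i).served) : (S i).radius q ≤ Γ := by
  obtain ⟨l, hl1, hl2, hl3⟩ := hL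
  have hΓ0 : 0 ≤ Γ := (tour_nonneg s l).trans (hl3 s)
  induction i with
  | zero => rw [h.state_zero]; exact hΓ0
  | succ i ih =>
    have hs := h.isService i hi
    have hq' : q ∉ (S i).served := fun hm => hq (h.served_mono (Nat.le_succ i) hi q hm)
    have ih := ih (Nat.le_of_succ_le hi) hq'
    rw [h.state_succ i hi] at hq ⊢
    by_cases hqe : q ∈ eligible k v (S i) (d i).time (d i).level
    · rw [advance_radius_of_mem hqe, zpow_add_one₀ two_ne_zero]
      rw [mem_advance_served, not_or, not_or] at hq
      have hmiss : q ∈ missed k v (S i) (d i).time (d i).level (d i).route :=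
        mem_missed.2 ⟨hqe, fun hm => hq.2.2 ⟨hqe, hm⟩⟩
      have h1 := hs.maximal.resolve_left (Finset.ne_empty_of_mem hmiss) l hl1
      have h2 : missed k v (S i) (d i).time (d i).level l = ∅ :=
        Finset.eq_empty_of_forall_notMem fun i hi => (mem_missed.1 hi).2 (hl2 _)
      rw [h2, Finset.sum_empty] at h1
      have h3 : (0 : ℝ) < 2 ^ (d i).level := by positivity
      linarith [hl3 (S i).pos]
    · by_cases hr : q < k ∧ (v q).release ≤ (d i).time
      · rw [advance_radius_of_released hqe hr.1 hr.2]
        exact max_le ih (hΓ _ _)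
      · rw [advance_radius_of_not_released hr]
        exact ih

theorem two_zpow_level_le (h : IsExecution k v s S d M m) {Γ : ℝ} (hΓ : ∀ x y : X, dist x y ≤ Γ)
    (hL : ∃ l : List X, l.Nodup ∧ (∀ x, x ∈ l) ∧ ∀ a, tour a l ≤ Γ) {i : ℕ} (hi : i < m) :
    2 ^ (d i).level ≤ 2 * Γ := by
  have h1 := (h.isService i hi).le_sum_outer
  obtain ⟨q, hq⟩ : (outer k v (S i) (d i).time (d i).level).Nonempty := by
    rw [Finset.nonempty_iff_ne_empty]
    intro he
    rw [he, Finset.sum_empty] at h1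
    exact absurd h1 (not_le.2 (by positivity))
  obtain ⟨h2, h3⟩ := mem_outer.1 hq
  have h4 : (S i).reach v q ≤ Γ :=
    max_le (h.radius_le hΓ hL hi.le (mem_eligible.1 h2).2.2.1) (hΓ _ _)
  rw [zpow_sub_one₀ two_ne_zero] at h3
  linarith

/-- The bound depends only on the space. It determines the height of the jump at a deadline. -/
theorem paid_le (h : IsExecution k v s S d M m) {Γ : ℝ} (hΓ : ∀ x y : X, dist x y ≤ Γ)
    (hL : ∃ l : List X, l.Nodup ∧ (∀ x, x ∈ l) ∧ ∀ a, tour a l ≤ Γ) {i : ℕ} (hi : i ≤ m)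
    (q : ℕ) : (S i).paid q ≤ 36 * Γ := by
  have hΓ0 : 0 ≤ Γ := by simpa using hΓ s s
  induction i with
  | zero => rw [h.state_zero]; simpa [ServerState.init] using hΓ0
  | succ i ih =>
    have hp := h.paid_le_radius hi q
    rw [h.state_succ i hi] at hp ⊢
    by_cases hqe : q ∈ eligible k v (S i) (d i).time (d i).level
    · rw [advance_radius_of_mem hqe, zpow_add_one₀ two_ne_zero] at hp
      linarith [h.two_zpow_level_le hΓ hL hi]
    · rw [advance_paid_of_notMem hqe]
      exact ih (Nat.le_of_succ_le hi)

theorem exists_moves_eq (h : IsExecution k v s S d M m) {i j : ℕ} (hij : i ≤ j) (hj : j ≤ m) :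
    ∃ l, M j = M i ++ l ∧ ∀ x ∈ l, (d i).time ≤ x.1 ∧ i < m := by
  induction j, hij using Nat.le_induction with
  | base => exact ⟨[], by simp, by simp⟩
  | succ j hij ih =>
    obtain ⟨l, hl, hl'⟩ := ih (Nat.le_of_succ_le hj)
    refine ⟨l ++ (d j).moves (S j).pos, by rw [h.moves_succ j hj, hl, List.append_assoc],
      fun x hx => ?_⟩
    rcases List.mem_append.1 hx with hx | hx
    · exact hl' x hx
    · rw [time_eq_of_mem_moves hx]
      exact ⟨h.time_service_mono hij hj, hij.trans_lt hj⟩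

theorem moves_time_le (h : IsExecution k v s S d M m) {i : ℕ} (hi : i ≤ m) :
    ∀ x ∈ M i, (x.1 : WithBot ℝ) ≤ (S i).time := by
  induction i with
  | zero => rw [h.moves_zero]; simp
  | succ i ih =>
    intro x hx
    rw [h.moves_succ i hi] at hx
    rcases List.mem_append.1 hx with hx | hx
    · exact (ih (Nat.le_of_succ_le hi) x hx).trans (h.time_mono (Nat.le_succ i) hi)
    · rw [time_eq_of_mem_moves hx, h.time_succ hi]

theorem getLastD_moves (h : IsExecution k v s S d M m) {i : ℕ} (hi : i ≤ m) :
    ((M i).map Prod.snd).getLastD s = (S i).pos := by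
  induction i with
  | zero => rw [h.moves_zero, h.state_zero]; rfl
  | succ i ih =>
    rw [h.moves_succ i hi, h.pos_succ hi]
    have e : (M i ++ (d i).moves (S i).pos).map Prod.snd =
        ((M i).map Prod.snd ++ (d i).route ++ [(S i).pos]) ++ [(d i).target] := by
      simp [Service.moves]
    rw [e, List.getLastD_concat]

theorem pathLength_moves_le (h : IsExecution k v s S d M m) {i : ℕ} (hi : i ≤ m) :
    pathLength s ((M i).map Prod.snd) ≤ 10 * ∑ j ∈ Finset.range i, (2 : ℝ) ^ (d j).level := by
  induction i with
  | zero => rw [h.moves_zero]; simp [pathLength]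
  | succ i ih =>
    rw [h.moves_succ i hi, List.map_append, pathLength_append,
      h.getLastD_moves (Nat.le_of_succ_le hi), Finset.sum_range_succ]
    linarith [ih (Nat.le_of_succ_le hi), OnlineService.pathLength_moves_le (h.isService i hi)]

/-- A request which is released at the location of the server is served at once. -/
theorem visitsAt_release (h : IsExecution k v s S d M m) {σ : Schedule X} (hσ : σ.moves = M m)
    {i : ℕ} (hi : i ≤ m) {q : ℕ} (hloc : (S i).pos = (v q).location)
    (h1 : (S i).time < (v q).release) (h2 : i < m → (v q).release ≤ (d i).time) :
    σ.VisitsAt s (v q).location (v q).release := by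
  left
  obtain ⟨l, hl, hl'⟩ := h.exists_moves_eq hi le_rfl
  rw [Schedule.positionBefore, hσ, hl, List.filter_append, List.filter_eq_self.2,
    List.filter_eq_nil_iff.2, List.append_nil, h.getLastD_moves hi, hloc]
  · intro x hx
    have := (h2 (hl' x hx).2).trans (hl' x hx).1
    simpa using this
  · intro x hx
    have := (h.moves_time_le hi x hx).trans_lt h1
    simpa using WithBot.coe_lt_coe.1 this

/-- A pending request that was already released at a service has positive radius afterwards. -/
theorem release_lt_of_reach_eq_zero (h : IsExecution k v s S d M m) {i : ℕ} (hi : i ≤ m) {q : ℕ}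
    (hq : q < k) (hs : q ∉ (S i).served) (h0 : (S i).reach v q = 0) :
    (S i).time < (v q).release := by
  cases i with
  | zero => rw [h.state_zero]; exact WithBot.bot_lt_coe _
  | succ i =>
    by_contra hcon
    rw [h.time_succ hi, not_lt] at hcon
    have h1 := h.lt_radius (Nat.lt_succ_self i) hi hq (WithBot.coe_le_coe.1 hcon) hs
    have h2 : (0 : ℝ) < 2 ^ (d i).level := by positivity
    linarith [radius_le_reach (S := S (i + 1)) (v := v) q]

theorem pos_eq_of_reach_eq_zero {i : ℕ} {q : ℕ} (h0 : (S i).reach v q = 0) :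
    (S i).pos = (v q).location :=
  dist_le_zero.1 (h0 ▸ dist_le_reach q)

theorem exists_visit_of_served (h : IsExecution k v s S d M m) {σ : Schedule X}
    (hσ : σ.moves = M m) {i : ℕ} (hi : i ≤ m) {q : ℕ} (hs : q ∈ (S i).served) :
    ∃ t, (v q).release ≤ t ∧ σ.VisitsAt s (v q).location t ∧ (v q).lower t ≤ (S i).paid q := by
  induction i with
  | zero =>
    rw [h.state_zero] at hs
    exact absurd hs id
  | succ i ih =>
    have hpaid := h.paid_mono (Nat.le_succ i) hi q
    by_cases hs' : q ∈ (S i).served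
    · obtain ⟨t, h1, h2, h3⟩ := ih (Nat.le_of_succ_le hi) hs'
      exact ⟨t, h1, h2, h3.trans hpaid⟩
    rw [h.state_succ i hi, mem_advance_served] at hs
    rcases hs.resolve_left hs' with ⟨h1, h2, h3⟩ | ⟨h1, h2⟩
    · refine ⟨(v q).release, le_rfl, h.visitsAt_release hσ (Nat.le_of_succ_le hi)
        (pos_eq_of_reach_eq_zero h3)
        (h.release_lt_of_reach_eq_zero (Nat.le_of_succ_le hi) h1 hs' h3) (fun _ => h2), ?_⟩
      rw [(v q).lower_eq_zero _ le_rfl]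
      exact h.paid_nonneg hi q
    · refine ⟨(d i).time, (mem_eligible.1 h1).2.1, Or.inr ?_, ?_⟩
      · obtain ⟨l, hl, -⟩ := h.exists_moves_eq hi le_rfl
        rw [hσ, hl, h.moves_succ i hi]
        refine List.mem_append_left _ (List.mem_append_right _ ?_)
        exact List.mem_map.2 ⟨_, List.mem_append_left _ h2, rfl⟩
      · rw [h.state_succ i hi]
        exact lower_le_advance_paid (h.isService i hi).time_le_horizon h1

/-- If nothing triggers a further service, then all requests are served, at the delay costs
which have been paid for. -/
theorem exists_visit (h : IsExecution k v s S d M m) (hm : ¬ ∃ t, Triggered k v (S m) t)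
    {σ : Schedule X} (hσ : σ.moves = M m) {q : ℕ} (hq : q < k) :
    ∃ t, (v q).release ≤ t ∧ σ.VisitsAt s (v q).location t ∧ (v q).lower t ≤ (S m).paid q := by
  by_cases hs : q ∈ (S m).served
  · exact h.exists_visit_of_served hσ le_rfl hs
  rcases (reach_nonneg (S := S m) (v := v) q).eq_or_lt with h0 | hpos
  · refine ⟨(v q).release, le_rfl, h.visitsAt_release hσ le_rfl
      (pos_eq_of_reach_eq_zero h0.symm) (h.release_lt_of_reach_eq_zero le_rfl hq hs h0.symm)
      (fun hlt => absurd hlt (lt_irrefl _)), ?_⟩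
    rw [(v q).lower_eq_zero _ le_rfl]
    exact h.paid_nonneg le_rfl q
  -- An unserved request of positive reach would trigger a service eventually, as `upper` is
  -- unbounded.
  · exfalso
    set j : ℤ := Int.log 2 ((S m).reach v q) + 1 with hj
    have hj' : (S m).reach v q ≤ 2 ^ j := by
      have := Int.lt_zpow_succ_log_self (R := ℝ) (b := 2) (by norm_num) ((S m).reach v q)
      exact le_of_lt (by exact_mod_cast this)
    obtain ⟨t₀, ht₀⟩ := (v q).upper_unbounded (2 ^ j + (S m).paid q)
    obtain ⟨b, hb⟩ : ∃ b : ℝ, (S m).time ≤ b := by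
      rcases (S m).time with _ | b
      · exact ⟨0, bot_le⟩
      · exact ⟨b, le_rfl⟩
    set t := max t₀ (max b (v q).release) with ht
    refine hm ⟨t, hb.trans (WithBot.coe_le_coe.2 ((le_max_left _ _).trans (le_max_right _ _))),
      j, ?_⟩
    have hmem : q ∈ eligible k v (S m) t j :=
      mem_eligible.2 ⟨hq, (le_max_right _ _).trans (le_max_right _ _), hs, hpos, hj'⟩
    refine le_trans ?_ (Finset.single_le_sum (fun i _ => excess_nonneg t i) hmem)
    refine le_trans ?_ (le_max_right _ _)
    have := (v q).upper_mono (le_max_left t₀ (max b (v q).release))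
    rw [← ht] at this
    linarith

end IsExecution

/-! ### The algorithm stops. -/

section Termination

variable {X : Type*} [MetricSpace X] (k : ℕ) (v : ℕ → GeneralRequest X) (s : X)

theorem exists_isExecution (n : ℕ)
    (h : ∀ i < n, nextService k v (stateAt k v s i) ≠ none) :
    ∃ d : ℕ → Service X, IsExecution k v s (stateAt k v s) d (movesAt k v s) n := by
  have h1 : ∀ i, i < n → ∃ d, nextService k v (stateAt k v s i) = some d := fun i hi =>
    Option.ne_none_iff_exists'.1 (h i hi)
  have : Nonempty (Service X) := ⟨⟨0, 0, [], 0, s⟩⟩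
  choose! d hd using h1
  exact ⟨d, rfl, rfl, fun i hi => isService_of_nextService (hd i hi),
    fun i hi => stateAt_succ_of_some (hd i hi), fun i hi => movesAt_succ_of_some (hd i hi)⟩

theorem exists_bound [Finite X] : ∃ Γ : ℝ, (∀ x y : X, dist x y ≤ Γ) ∧
    ∃ l : List X, l.Nodup ∧ (∀ x, x ∈ l) ∧ ∀ a, tour a l ≤ Γ := by
  have := Fintype.ofFinite X
  set D : ℝ := ∑ x : X, ∑ y : X, dist x y with hD
  have h1 : ∀ x y : X, dist x y ≤ D := fun x y =>
    (Finset.single_le_sum (f := fun y => dist x y) (fun _ _ => dist_nonneg)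
      (Finset.mem_univ y)).trans (Finset.single_le_sum (f := fun x => ∑ y : X, dist x y)
        (fun _ _ => Finset.sum_nonneg fun _ _ => dist_nonneg) (Finset.mem_univ x))
  have hD0 : 0 ≤ D := Finset.sum_nonneg fun _ _ => Finset.sum_nonneg fun _ _ => dist_nonneg
  set l := (Finset.univ : Finset X).toList
  refine ⟨(l.length + 1) * D, fun x y => (h1 x y).trans ?_, l, Finset.nodup_toList _,
    fun x => Finset.mem_toList.2 (Finset.mem_univ x), fun a => tour_le_card_mul h1 a l⟩
  have : (0 : ℝ) ≤ l.length * D := by positivity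
  linarith

/-- In an infinite run some request would be of the exact level of infinitely many services. Their
levels increase strictly, yet they are bounded in terms of the size of `X`. -/
theorem exists_nextService_eq_none [Finite X] :
    ∃ n, nextService k v (stateAt k v s n) = none := by
  by_contra hcon
  push Not at hcon
  have h1 : ∀ i, ∃ d, nextService k v (stateAt k v s i) = some d := fun i =>
    Option.ne_none_iff_exists'.1 (hcon i)
  choose d hd using h1
  have h : ∀ m, IsExecution k v s (stateAt k v s) d (movesAt k v s) m := fun m =>
    ⟨rfl, rfl, fun i _ => isService_of_nextService (hd i),
      fun i _ => stateAt_succ_of_some (hd i), fun i _ => movesAt_succ_of_some (hd i)⟩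
  have hout : ∀ i, ∃ q : Fin k, (q : ℕ) ∈ outer k v (stateAt k v s i) (d i).time (d i).level := by
    intro i
    have h1 := (isService_of_nextService (hd i)).le_sum_outer
    obtain ⟨q, hq⟩ : (outer k v (stateAt k v s i) (d i).time (d i).level).Nonempty := by
      rw [Finset.nonempty_iff_ne_empty]
      intro he
      rw [he, Finset.sum_empty] at h1
      exact absurd h1 (not_le.2 (by positivity))
    exact ⟨⟨q, (mem_eligible.1 (mem_outer.1 hq).1).1⟩, hq⟩
  choose f hf using hout
  obtain ⟨q, hq⟩ := Finite.exists_infinite_fiber f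
  have hinf : (f ⁻¹' {q}).Infinite := Set.infinite_coe_iff.1 hq
  have hmono : ∀ i ∈ f ⁻¹' {q}, ∀ j ∈ f ⁻¹' {q}, i < j → (d i).level < (d j).level := by
    intro i hi j hj hij
    have h1 := mem_eligible.1 (mem_outer.1 (hf i)).1
    have h2 := mem_eligible.1 (mem_outer.1 (hf j)).1
    rw [show f i = q from hi] at h1
    rw [show f j = q from hj] at h2
    have h3 := (h j).lt_radius hij le_rfl h1.1 h1.2.1 h2.2.2.1
    exact (zpow_lt_zpow_iff_right₀ (by norm_num : (1 : ℝ) < 2)).1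
      (h3.trans_le ((radius_le_reach (v := v) _).trans h2.2.2.2.2))
  obtain ⟨Γ, hΓ, hL⟩ := exists_bound (X := X)
  obtain ⟨B, hB⟩ : ∃ B : ℤ, ∀ i, (d i).level ≤ B := by
    refine ⟨Int.log 2 (2 * Γ), fun i => ?_⟩
    have h1 := (h (i + 1)).two_zpow_level_le hΓ hL (Nat.lt_succ_self i)
    have h2 : (0 : ℝ) < 2 * Γ := lt_of_lt_of_le (by positivity) h1
    exact (Int.zpow_le_iff_le_log (b := 2) (by norm_num) h2).1 (by exact_mod_cast h1)
  obtain ⟨i₀, hi₀⟩ := hinf.nonempty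
  have hmaps : Set.MapsTo (fun i => (d i).level) (f ⁻¹' {q} ∩ Ici i₀)
      (Icc (d i₀).level B) := by
    intro i hi
    refine ⟨?_, hB i⟩
    rcases (show i₀ ≤ i from hi.2).eq_or_lt with rfl | hlt
    · exact le_rfl
    · exact (hmono i₀ hi₀ i hi.1 hlt).le
  have hinj : Set.InjOn (fun i => (d i).level) (f ⁻¹' {q} ∩ Ici i₀) := by
    intro i hi j hj hij
    rcases lt_trichotomy i j with hlt | heq | hlt
    · exact absurd hij (hmono i hi.1 j hj.1 hlt).ne
    · exact heq
    · exact absurd hij (hmono j hj.1 i hi.1 hlt).ne'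
  have hfin : (f ⁻¹' {q} ∩ Ici i₀).Finite :=
    Set.Finite.of_finite_image ((finite_Icc _ _).subset hmaps.image_subset) hinj
  refine hinf ((hfin.union (finite_Iio i₀)).subset fun i hi => ?_)
  rcases le_or_gt i₀ i with h1 | h1
  · exact Or.inl ⟨hi, h1⟩
  · exact Or.inr h1

theorem not_triggered_of_nextService [Finite X] {S : ServerState X} (hp : ∀ i, 0 ≤ S.paid i)
    (h : nextService k v S = none) : ¬ ∃ t, Triggered k v S t := by
  intro hT
  unfold nextService at h
  rw [dif_pos (exists_isService hp hT)] at h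
  exact absurd h (Option.some_ne_none _)

/-- The algorithm stops, and its schedule is that of an execution after which nothing triggers
a further service. -/
theorem exists_complete_execution [Finite X] :
    ∃ (S : ℕ → ServerState X) (d : ℕ → Service X) (M : ℕ → List (ℝ × X)) (m : ℕ),
      IsExecution k v s S d M m ∧ (generalSchedule k v s).moves = M m ∧
      ¬ ∃ t, Triggered k v (S m) t := by
  classical
  have hex := exists_nextService_eq_none k v s
  have hcount : serviceCount k v s = Nat.find hex := by rw [serviceCount, dif_pos hex]
  obtain ⟨d, hd⟩ := exists_isExecution k v s (serviceCount k v s) fun i hi =>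
    Nat.find_min hex (hcount ▸ hi)
  refine ⟨_, d, _, _, hd, rfl, not_triggered_of_nextService k v (hd.paid_nonneg le_rfl) ?_⟩
  rw [hcount]
  exact Nat.find_spec hex

end Termination

/-! ### Offline schedules: positions, movements in a time interval, restriction. -/

section Offline

theorem filter_time_eq_append {X : Type*} {l : List (ℝ × X)}
    (hl : l.Pairwise (fun m m' => m.1 ≤ m'.1)) (P Q : ℝ → Bool)
    (hP : ∀ a b, a ≤ b → P b = true → P a = true) (hPQ : ∀ a, P a = true → Q a = true) :
    l.filter (fun m => Q m.1) =
      l.filter (fun m => P m.1) ++ l.filter (fun m => Q m.1 && !P m.1) := by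
  induction l with
  | nil => rfl
  | cons m l ih =>
    obtain ⟨h1, h2⟩ := List.pairwise_cons.1 hl
    rcases hm : P m.1 with _ | _
    · have hnil : l.filter (fun m => P m.1) = [] := by
        refine List.filter_eq_nil_iff.2 fun x hx hPx => ?_
        rw [hP _ _ (h1 x hx) hPx] at hm
        exact Bool.noConfusion hm
      have ih := ih h2
      rw [hnil, List.nil_append] at ih
      rw [List.filter_cons, List.filter_cons, List.filter_cons, hnil, ih]
      simp [hm]
    · rw [List.filter_cons, List.filter_cons, List.filter_cons, ih h2]
      simp [hm, hPQ _ hm]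

variable {X : Type*}

/-- The location of the server after its movements by a given time. -/
noncomputable def posAt (s : X) (l : List (ℝ × X)) (b : WithBot ℝ) : X :=
  ((l.filter fun m => decide ((m.1 : WithBot ℝ) ≤ b)).map Prod.snd).getLastD s

/-- The movements during `(b, c]`. -/
noncomputable def movesIn (l : List (ℝ × X)) (b c : WithBot ℝ) : List (ℝ × X) :=
  l.filter fun m => decide ((m.1 : WithBot ℝ) ≤ c) && !decide ((m.1 : WithBot ℝ) ≤ b)

theorem getLastD_append (l l' : List X) (s : X) :
    (l ++ l').getLastD s = l'.getLastD (l.getLastD s) := by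
  induction l generalizing s with
  | nil => rfl
  | cons x l ih => rw [List.cons_append, List.getLastD_cons, List.getLastD_cons, ih]

theorem getLastD_mem_cons (l : List X) (s : X) : l.getLastD s ∈ s :: l := by
  induction l generalizing s with
  | nil => simp
  | cons x l ih =>
    rw [List.getLastD_cons]
    exact List.mem_cons_of_mem _ (ih x)

theorem filter_le_eq_append {l : List (ℝ × X)}
    (hl : l.Pairwise (fun m m' => m.1 ≤ m'.1)) {b c : WithBot ℝ} (hbc : b ≤ c) :
    l.filter (fun m => decide ((m.1 : WithBot ℝ) ≤ c)) =
      l.filter (fun m => decide ((m.1 : WithBot ℝ) ≤ b)) ++ movesIn l b c := by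
  refine filter_time_eq_append hl (fun t => decide ((t : WithBot ℝ) ≤ b))
    (fun t => decide ((t : WithBot ℝ) ≤ c)) (fun x y hxy hy => ?_) fun x hx => ?_
  · simp only [decide_eq_true_eq] at *
    exact (WithBot.coe_le_coe.2 hxy).trans hy
  · simp only [decide_eq_true_eq] at *
    exact hx.trans hbc

theorem posAt_mem {l : List (ℝ × X)} (hl : l.Pairwise (fun m m' => m.1 ≤ m'.1)) {s : X}
    {b c : WithBot ℝ} (hbc : b ≤ c) {e : WithBot ℝ} (he : c ≤ e) :
    posAt s l c ∈ posAt s l b :: (movesIn l b e).map Prod.snd := by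
  have e1 : posAt s l c = ((movesIn l b c).map Prod.snd).getLastD (posAt s l b) := by
    rw [posAt, filter_le_eq_append hl hbc, List.map_append, getLastD_append]
    rfl
  rw [e1]
  have h1 := getLastD_mem_cons ((movesIn l b c).map Prod.snd) (posAt s l b)
  refine List.cons_subset_cons _ (fun x hx => ?_) h1
  obtain ⟨m, hm, rfl⟩ := List.mem_map.1 hx
  refine List.mem_map_of_mem ?_
  simp only [movesIn, List.mem_filter, Bool.and_eq_true, decide_eq_true_eq] at hm ⊢
  exact ⟨hm.1, hm.2.1.trans he, hm.2.2⟩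

theorem mem_of_visitsAt {s : X} {σ : Schedule X} {p : X} {t : ℝ} (h : σ.VisitsAt s p t)
    {b c : WithBot ℝ} (hb : b < t) (hc : t ≤ c) :
    p ∈ posAt s σ.moves b :: (movesIn σ.moves b c).map Prod.snd := by
  rcases h with h | h
  · have h1 := filter_time_eq_append σ.chronological (fun x => decide ((x : WithBot ℝ) ≤ b))
      (fun x => decide (x < t)) (fun x y hxy hy => by
        simp only [decide_eq_true_eq] at *
        exact (WithBot.coe_le_coe.2 hxy).trans hy) (fun x hx => by
        simp only [decide_eq_true_eq] at *
        exact WithBot.coe_lt_coe.1 (hx.trans_lt hb))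
    rw [Schedule.positionBefore, h1, List.map_append, getLastD_append] at h
    rw [← h]
    refine List.cons_subset_cons _ (fun x hx => ?_) (getLastD_mem_cons _ _)
    obtain ⟨m, hm, rfl⟩ := List.mem_map.1 hx
    refine List.mem_map_of_mem ?_
    simp only [movesIn, List.mem_filter, Bool.and_eq_true, decide_eq_true_eq] at hm ⊢
    exact ⟨hm.1, (WithBot.coe_le_coe.2 hm.2.1.le).trans hc, hm.2.2⟩
  · refine List.mem_cons_of_mem _ (List.mem_map.2 ⟨(t, p), ?_, rfl⟩)
    simp only [movesIn, List.mem_filter, Bool.and_eq_true, decide_eq_true_eq,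
      Bool.not_eq_true', decide_eq_false_iff_not, not_le]
    exact ⟨h, hc, hb⟩

/-- The schedule which skips the movements to points outside of a set. -/
noncomputable def Schedule.restrict (σ : Schedule X) (Y : Finset X) : Schedule X :=
  open Classical in
  ⟨σ.moves.filter fun m => decide (m.2 ∈ Y), σ.chronological.sublist List.filter_sublist⟩

theorem Schedule.mem_restrict_moves {σ : Schedule X} {Y : Finset X} {m : ℝ × X} :
    m ∈ (σ.restrict Y).moves ↔ m ∈ σ.moves ∧ m.2 ∈ Y := by
  classical
  simp [Schedule.restrict]

/-- The last movement before `t` ends at `p`, if there is one, and is therefore kept. -/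
theorem Schedule.VisitsAt.restrict {σ : Schedule X} {Y : Finset X} {s p : X} {t : ℝ}
    (h : σ.VisitsAt s p t) (hp : p ∈ Y) : (σ.restrict Y).VisitsAt s p t := by
  classical
  rcases h with h | h
  · left
    rw [positionBefore] at h ⊢
    have e : (σ.restrict Y).moves.filter (fun m => decide (m.1 < t)) =
        (σ.moves.filter fun m => decide (m.1 < t)).filter fun m => decide (m.2 ∈ Y) := by
      rw [List.filter_filter, Schedule.restrict]
      simp only [List.filter_filter, Bool.and_comm]
    rw [e]
    rcases List.eq_nil_or_concat (σ.moves.filter fun m => decide (m.1 < t)) with h1 | ⟨l, x, h1⟩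
    · rw [h1] at h ⊢; simpa using h
    · rw [List.concat_eq_append] at h1
      rw [h1] at h ⊢
      have hx : x.2 = p := by simpa using h
      rw [List.filter_append]
      simp [hx, hp]
  · exact Or.inr (mem_restrict_moves.2 ⟨h, hp⟩)

variable [MetricSpace X]

/-- The times and the lengths of the movements of a list. -/
noncomputable def steps : X → List (ℝ × X) → List (ℝ × ℝ)
  | _, [] => []
  | s, m :: l => (m.1, dist s m.2) :: steps m.2 l

theorem steps_append (s : X) (l l' : List (ℝ × X)) :
    steps s (l ++ l') = steps s l ++ steps ((l.map Prod.snd).getLastD s) l' := by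
  induction l generalizing s with
  | nil => rfl
  | cons m l ih => rw [List.cons_append, steps, steps, ih, List.map_cons, List.getLastD_cons]; rfl

theorem exists_mem_of_mem_steps {s : X} {l : List (ℝ × X)} {e : ℝ × ℝ} (he : e ∈ steps s l) :
    (∃ m ∈ l, m.1 = e.1) ∧ 0 ≤ e.2 := by
  induction l generalizing s with
  | nil => simp [steps] at he
  | cons m l ih =>
    rcases List.mem_cons.1 he with rfl | he
    · exact ⟨⟨m, by simp, rfl⟩, dist_nonneg⟩
    · obtain ⟨⟨m', h1, h2⟩, h3⟩ := ih he
      exact ⟨⟨m', List.mem_cons_of_mem _ h1, h2⟩, h3⟩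

theorem sum_steps (g : ℝ → ℝ) (s : X) (l : List (ℝ × X)) :
    ((steps s l).map fun e => g e.2).sum = stepSum g s (l.map Prod.snd) := by
  induction l generalizing s with
  | nil => rfl
  | cons m l ih => simp [steps, stepSum, ih]

theorem stepSum_id (s : X) (l : List X) : stepSum (fun d => d) s l = pathLength s l := by
  induction l generalizing s with
  | nil => rfl
  | cons x l ih => rw [stepSum, pathLength, ih]

theorem travel_eq_pathLength (s : X) (l : List (ℝ × X)) :
    Schedule.travel s l = pathLength s (l.map Prod.snd) := by
  induction l generalizing s with
  | nil => rfl
  | cons m l ih => rw [Schedule.travel, List.map_cons, pathLength, ih]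

/-- The sum of a function of the lengths of the movements during `(b, c]`. -/
noncomputable def movementIn (g : ℝ → ℝ) (s : X) (l : List (ℝ × X)) (b c : WithBot ℝ) : ℝ :=
  (((steps s l).filter fun e =>
    decide ((e.1 : WithBot ℝ) ≤ c) && !decide ((e.1 : WithBot ℝ) ≤ b)).map fun e => g e.2).sum

/-- The list splits into the parts before, in and after the interval, and only the middle one
survives the filter on steps. -/
theorem movementIn_eq {l : List (ℝ × X)} (hl : l.Pairwise (fun m m' => m.1 ≤ m'.1)) (g : ℝ → ℝ)
    (s : X) {b c : WithBot ℝ} (hbc : b ≤ c) :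
    movementIn g s l b c = stepSum g (posAt s l b) ((movesIn l b c).map Prod.snd) := by
  have h1 := filter_time_eq_append hl (fun t => decide ((t : WithBot ℝ) ≤ c)) (fun _ => true)
    (fun x y hxy hy => by
      simp only [decide_eq_true_eq] at *
      exact (WithBot.coe_le_coe.2 hxy).trans hy) fun _ _ => rfl
  rw [List.filter_true, filter_le_eq_append hl hbc] at h1
  simp only [Bool.true_and] at h1
  set F : ℝ × ℝ → Bool := fun e =>
    decide ((e.1 : WithBot ℝ) ≤ c) && !decide ((e.1 : WithBot ℝ) ≤ b) with hF
  have hA : ∀ x, (steps x (l.filter fun m => decide ((m.1 : WithBot ℝ) ≤ b))).filter F = [] := by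
    refine fun x => List.filter_eq_nil_iff.2 fun e he => ?_
    obtain ⟨⟨m, hm, hme⟩, -⟩ := exists_mem_of_mem_steps he
    have h2 := (List.mem_filter.1 hm).2
    simp only [decide_eq_true_eq] at h2
    simp [hF, ← hme, h2]
  have hB : ∀ x, (steps x (movesIn l b c)).filter F = steps x (movesIn l b c) := by
    refine fun x => List.filter_eq_self.2 fun e he => ?_
    obtain ⟨⟨m, hm, hme⟩, -⟩ := exists_mem_of_mem_steps he
    simp only [hF, ← hme]
    exact (List.mem_filter.1 hm).2
  have hC : ∀ x, (steps x (l.filter fun m => !decide ((m.1 : WithBot ℝ) ≤ c))).filter F = [] := by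
    refine fun x => List.filter_eq_nil_iff.2 fun e he => ?_
    obtain ⟨⟨m, hm, hme⟩, -⟩ := exists_mem_of_mem_steps he
    have h2 := (List.mem_filter.1 hm).2
    simp only [Bool.not_eq_true', decide_eq_false_iff_not] at h2
    simp [hF, ← hme, h2]
  rw [movementIn]
  conv_lhs => rw [h1]
  rw [steps_append, steps_append, List.filter_append, List.filter_append, hA, hB, hC,
    List.nil_append, List.append_nil, sum_steps]
  rfl

theorem pathLength_le_of_sublist {l l' : List X} (h : l'.Sublist l) (s : X) :
    pathLength s l' ≤ pathLength s l := by
  have key : ∀ (l : List X) (s a : X), pathLength s l ≤ dist s a + pathLength a l := by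
    intro l s a
    cases l with
    | nil => simp [pathLength]
    | cons x l =>
      simp only [pathLength]
      linarith [dist_triangle s a x]
  induction h generalizing s with
  | slnil => exact le_rfl
  | @cons l₁ l₂ a _ ih =>
    rw [pathLength]
    linarith [ih a, key l₁ s a]
  | cons_cons a _ ih =>
    rw [pathLength, pathLength]
    linarith [ih a]

theorem dist_posAt_le {l : List (ℝ × X)} (hl : l.Pairwise (fun m m' => m.1 ≤ m'.1)) (s : X)
    {b c : WithBot ℝ} (hbc : b ≤ c) :
    pathLength s ((l.filter fun m => decide ((m.1 : WithBot ℝ) ≤ b)).map Prod.snd) +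
      dist (posAt s l b) (posAt s l c) ≤
      pathLength s ((l.filter fun m => decide ((m.1 : WithBot ℝ) ≤ c)).map Prod.snd) := by
  have key : ∀ (l : List X) (s : X), dist s (l.getLastD s) ≤ pathLength s l := by
    intro l
    induction l with
    | nil => intro s; simp [pathLength]
    | cons x l ih =>
      intro s
      rw [pathLength, List.getLastD_cons]
      linarith [ih x, dist_triangle s x (l.getLastD x)]
  have h1 : posAt s l c = ((movesIn l b c).map Prod.snd).getLastD (posAt s l b) := by
    rw [posAt, filter_le_eq_append hl hbc, List.map_append, getLastD_append]
    rfl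
  rw [h1, filter_le_eq_append hl hbc, List.map_append, pathLength_append]
  exact add_le_add_right (key _ _) _

theorem sum_dist_posAt_le {l : List (ℝ × X)} (hl : l.Pairwise (fun m m' => m.1 ≤ m'.1)) (s : X)
    (b : ℕ → WithBot ℝ) (m : ℕ) (hb : ∀ i < m, b i ≤ b (i + 1)) :
    ∑ i ∈ Finset.range m, dist (posAt s l (b i)) (posAt s l (b (i + 1))) ≤
      pathLength s (l.map Prod.snd) := by
  have key : ∀ n ≤ m, ∑ i ∈ Finset.range n, dist (posAt s l (b i)) (posAt s l (b (i + 1))) ≤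
      pathLength s ((l.filter fun m => decide ((m.1 : WithBot ℝ) ≤ b n)).map Prod.snd) := by
    intro n hn
    induction n with
    | zero => simpa using pathLength_nonneg _ _
    | succ n ih =>
      rw [Finset.sum_range_succ]
      linarith [ih (Nat.le_of_succ_le hn), dist_posAt_le hl s (hb n hn)]
  exact (key m le_rfl).trans (pathLength_le_of_sublist (List.filter_sublist.map _) s)

theorem Schedule.movementCost_restrict_le (σ : Schedule X) (Y : Finset X) (s : X) :
    (σ.restrict Y).movementCost s ≤ σ.movementCost s := by
  rw [movementCost, movementCost, travel_eq_pathLength, travel_eq_pathLength]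
  exact pathLength_le_of_sublist (List.filter_sublist.map _) s

end Offline

/-! ### Charging each service to the offline schedule. -/

/-- A schedule which serves the requests at the times `ts`, and visits only points of `Y`. -/
structure IsOffline {X : Type*} (k : ℕ) (v : ℕ → GeneralRequest X) (s : X) (σ : Schedule X)
    (ts : ℕ → ℝ) (Y : Finset X) : Prop where
  release_le : ∀ q < k, (v q).release ≤ ts q
  visitsAt : ∀ q < k, σ.VisitsAt s (v q).location (ts q)
  upper_eq : ∀ q < k, ∀ t < ts q, (v q).upper t = (v q).lower t
  start_mem : s ∈ Y
  moves_mem : ∀ m ∈ σ.moves, m.2 ∈ Y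

theorem IsOffline.posAt_mem {X : Type*} {k : ℕ} {v : ℕ → GeneralRequest X} {s : X}
    {σ : Schedule X} {ts : ℕ → ℝ} {Y : Finset X} (ho : IsOffline k v s σ ts Y) (b : WithBot ℝ) :
    posAt s σ.moves b ∈ Y := by
  rcases List.mem_cons.1 (getLastD_mem_cons
    ((σ.moves.filter fun m => decide ((m.1 : WithBot ℝ) ≤ b)).map Prod.snd) s) with h | h
  · rw [posAt, h]; exact ho.start_mem
  · obtain ⟨m, hm, he⟩ := List.mem_map.1 h
    rw [posAt, ← he]
    exact ho.moves_mem m (List.mem_filter.1 hm).1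

section Charging

variable {X : Type*} [MetricSpace X] {k : ℕ} {v : ℕ → GeneralRequest X} {s : X}
  {S : ℕ → ServerState X} {d : ℕ → Service X} {M : ℕ → List (ℝ × X)} {m : ℕ}
  {σ : Schedule X} {ts : ℕ → ℝ} {Y : Finset X}

theorem IsOffline.exists_tour (ho : IsOffline k v s σ ts Y) {b c : WithBot ℝ} (hbc : b ≤ c)
    {ℓ : ℤ} (h : movementIn (trunc Y.card ℓ) s σ.moves b c < 2 ^ ℓ / 128) :
    ∃ l : List X, l.Nodup ∧ tour (posAt s σ.moves b) l ≤ 2 ^ ℓ / 32 ∧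
      posAt s σ.moves b ∈ l ∧ (∀ e, b ≤ e → e ≤ c → posAt s σ.moves e ∈ l) ∧
      ∀ q < k, b < (v q).release → ts q ≤ c → (v q).location ∈ l := by
  rw [movementIn_eq σ.chronological _ _ hbc] at h
  obtain ⟨l, h1, h2, h3, h4⟩ := exists_short_tour ℓ _ _ Y le_rfl (ho.posAt_mem b)
    (fun z hz => by
      obtain ⟨m, hm, rfl⟩ := List.mem_map.1 hz
      exact ho.moves_mem m (List.mem_filter.1 hm).1) h
  have hall : ∀ x ∈ posAt s σ.moves b :: (movesIn σ.moves b c).map Prod.snd, x ∈ l := by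
    intro x hx
    rcases List.mem_cons.1 hx with rfl | hx
    · exact h2
    · exact h3 x hx
  refine ⟨l, h1, h4, h2, fun e he hec => hall _ (OnlineService.posAt_mem σ.chronological he hec),
    fun q hq hb hts => hall _ (mem_of_visitsAt (ho.visitsAt q hq) ?_ hts)⟩
  exact hb.trans_le (WithBot.coe_le_coe.2 (ho.release_le q hq))

/-- Here `a` is one more than the index of the last service of level at least `ℓ` before `i`, or `0`
if there is none. -/
theorem IsExecution.exists_last (h : IsExecution k v s S d M m) {i : ℕ} (hi : i < m) (ℓ : ℤ) :
    ∃ a ≤ i, (∀ j, a ≤ j → j < i → (d j).level < ℓ) ∧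
      ∀ q ∈ eligible k v (S i) (d i).time ℓ, (S a).time < (v q).release := by
  classical
  by_cases hex : ∃ j < i, ℓ ≤ (d j).level
  · obtain ⟨j₀, hj₀, hl₀⟩ := hex
    set F := (Finset.range i).filter fun j => ℓ ≤ (d j).level with hF
    have hne : F.Nonempty := ⟨j₀, Finset.mem_filter.2 ⟨Finset.mem_range.2 hj₀, hl₀⟩⟩
    obtain ⟨h1, h2⟩ := Finset.mem_filter.1 (F.max'_mem hne)
    rw [Finset.mem_range] at h1
    refine ⟨F.max' hne + 1, h1, fun j hj hji => not_le.1 fun hl => ?_, fun q hq => ?_⟩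
    · have := F.le_max' j (Finset.mem_filter.2 ⟨Finset.mem_range.2 hji, hl⟩)
      omega
    · rw [h.time_succ (h1.trans hi)]
      exact WithBot.coe_lt_coe.2 (h.lt_release h1 hi hq h2)
  · refine ⟨0, Nat.zero_le i, fun j _ hji => not_le.1 fun hl => hex ⟨j, hji, hl⟩, fun q _ => ?_⟩
    rw [h.state_zero]
    exact WithBot.bot_lt_coe _

/-- The radius of a pending request is an earlier distance from the server, or it was set by an
earlier service which left the request behind. -/
theorem IsExecution.reach_origin (h : IsExecution k v s S d M m) {i : ℕ} (hi : i ≤ m) {q : ℕ}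
    (hq : q < k) (hs : q ∉ (S i).served) :
    (∃ j ≤ i, (j < i → (v q).release ≤ (d j).time) ∧
      (S i).reach v q = dist (S j).pos (v q).location) ∨
    ∃ j < i, q ∈ missed k v (S j) (d j).time (d j).level (d j).route ∧
      (S i).reach v q = 2 ^ ((d j).level + 1) ∧ (v q).lower (d j).horizon ≤ (S i).paid q := by
  induction i with
  | zero =>
    refine Or.inl ⟨0, le_rfl, fun h => absurd h (lt_irrefl _), ?_⟩
    rw [ServerState.reach, h.state_zero]
    exact max_eq_right dist_nonneg
  | succ i ih =>
    have hs' : q ∉ (S i).served := fun hm => hs (h.served_mono (Nat.le_succ i) hi q hm)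
    rcases le_total ((S (i + 1)).radius q) (dist (S (i + 1)).pos (v q).location) with hd | hd
    · exact Or.inl ⟨i + 1, le_rfl, fun h => absurd h (lt_irrefl _), max_eq_right hd⟩
    have hreach : (S (i + 1)).reach v q = (S (i + 1)).radius q := max_eq_left hd
    by_cases hqr : (v q).release ≤ (d i).time
    · by_cases hqe : q ∈ eligible k v (S i) (d i).time (d i).level
      · have hmiss : (v q).location ∉ (d i).route := by
          intro hm
          rw [h.state_succ i hi] at hs
          exact hs (mem_advance_served.2 (Or.inr (Or.inr ⟨hqe, hm⟩)))
        refine Or.inr ⟨i, Nat.lt_succ_self i, mem_missed.2 ⟨hqe, hmiss⟩, ?_, ?_⟩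
        · rw [hreach, h.state_succ i hi, advance_radius_of_mem hqe]
        · rw [h.state_succ i hi, advance_paid_of_mem hqe, if_neg hmiss]
          exact le_max_right _ _
      · rw [hreach, h.state_succ i hi, advance_radius_of_released hqe hq hqr]
        rcases ih (Nat.le_of_succ_le hi) hs' with ⟨j, h1, h2, h3⟩ | ⟨j, h1, h2, h3, h4⟩
        · refine Or.inl ⟨j, Nat.le_succ_of_le h1, fun _ => ?_, h3⟩
          rcases h1.eq_or_lt with rfl | h1
          · exact hqr
          · exact h2 h1
        · refine Or.inr ⟨j, Nat.lt_succ_of_lt h1, h2, h3, ?_⟩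
          rw [advance_paid_of_notMem hqe]
          exact h4
    · have h0 := (h.unseen hi (q := q) (by
        rw [h.time_succ hi]
        exact WithBot.coe_lt_coe.2 (not_le.1 hqr))).2.1
      rw [h0] at hd
      refine Or.inl ⟨i + 1, le_rfl, fun h => absurd h (lt_irrefl _), ?_⟩
      rw [hreach, h0]
      exact le_antisymm dist_nonneg hd

/-- The services since `a` have a level below `ℓ`. -/
def LevelsBelow (d : ℕ → Service X) (a i : ℕ) (ℓ : ℤ) : Prop :=
  ∀ j, a ≤ j → j < i → (d j).level < ℓ

/-- A service is charged to the movements of the schedule `σ` since the service `a`. -/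
def MovementCharge (s : X) (S : ℕ → ServerState X) (d : ℕ → Service X) (σ : Schedule X)
    (Y : Finset X) (a i : ℕ) : Prop :=
  2 ^ (d i).level ≤ 128 * movementIn (trunc Y.card (d i).level) s σ.moves
    (S a).time (S (i + 1)).time

/-- The eligible requests of a service `i` which are served later than `T` by a schedule. -/
noncomputable def lateRequests (k : ℕ) (v : ℕ → GeneralRequest X) (S : ℕ → ServerState X)
    (d : ℕ → Service X) (ts : ℕ → ℝ) (i : ℕ) (T : ℝ) : Finset ℕ :=
  (eligible k v (S i) (d i).time (d i).level).filter fun q => T < ts q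

/-- The service `j` is the one whose leftover requests triggered the service `i`. -/
def IsParent (d : ℕ → Service X) (j i : ℕ) : Prop :=
  j < i ∧ (d i).level = (d j).level + 1 ∧ LevelsBelow d (j + 1) i (d i).level

/-- The service `i` follows an approach of the server to the location of the server in `σ`. -/
def IsApproach (k : ℕ) (v : ℕ → GeneralRequest X) (s : X) (S : ℕ → ServerState X)
    (d : ℕ → Service X) (σ : Schedule X) (j i : ℕ) : Prop :=
  j ≤ i ∧ (∃ q ∈ eligible k v (S i) (d i).time (d i).level, (v q).release ≤ (d j).time) ∧
    2 ^ ((d i).level - 2) ≤ dist (S j).pos (posAt s σ.moves (S (j + 1)).time) ∧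
    dist (S (i + 1)).pos (posAt s σ.moves (S (i + 1)).time) ≤ 2 ^ (d i).level / 16

/-- If `σ` has moved little, its short tour was a candidate plan at the time of the parent `j`. By
maximality the requests missed by this plan accrue much delay, and `σ` serves them only after the
service `i`. -/
theorem exists_parent_charge (h : IsExecution k v s S d M m) (ho : IsOffline k v s σ ts Y)
    {i : ℕ} (hi : i < m) {q : ℕ} (hq : q ∈ outer k v (S i) (d i).time (d i).level)
    (hex : 0 < excess v (S i) (d i).time q) {j : ℕ} (hj : j < i)
    (hmiss : q ∈ missed k v (S j) (d j).time (d j).level (d j).route)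
    (hreach : (S i).reach v q = 2 ^ ((d j).level + 1))
    (hpaid : (v q).lower (d j).horizon ≤ (S i).paid q) :
    IsParent d j i ∧ ((∃ a ≤ j, LevelsBelow d a j (d j).level ∧ MovementCharge s S d σ Y a i) ∨
      2 ^ (d i).level ≤ ∑ q ∈ lateRequests k v S d ts j (d i).time,
        ((v q).lower (d i).time - (v q).lower (d j).time)) := by
  have hjm := hj.trans hi
  have hel := (mem_outer.1 hq).1
  have hlev : (d i).level = (d j).level + 1 := by
    have h1 := (mem_outer.1 hq).2
    have h2 := (mem_eligible.1 hel).2.2.2.2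
    rw [hreach] at h1 h2
    have h3 := (zpow_lt_zpow_iff_right₀ (by norm_num : (1 : ℝ) < 2)).1 h1
    have h4 := (zpow_le_zpow_iff_right₀ (by norm_num : (1 : ℝ) < 2)).1 h2
    omega
  have hbelow : LevelsBelow d (j + 1) i (d i).level := by
    intro n hn hni
    by_contra hcon
    have h1 := h.lt_release hni hi hel (not_lt.1 hcon)
    have h2 := (mem_eligible.1 (mem_missed.1 hmiss).1).2.1
    have h3 := h.time_service_mono (Nat.le_of_succ_le hn) (hni.trans hi)
    linarith
  refine ⟨⟨hj, hlev, hbelow⟩, ?_⟩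
  -- The delay of `q` is prepaid up to the horizon of `j`, so an earlier `i` would see no excess of
  -- `q`.
  have hhor : (d j).horizon ≤ (d i).time := by
    by_contra hcon
    have h1 := (v q).upper_le_lower _ _ (not_le.1 hcon)
    have h2 : excess v (S i) (d i).time q = 0 := max_eq_left (by linarith)
    exact hex.ne' h2
  obtain ⟨a, ha, hal, har⟩ := h.exists_last hjm (d j).level
  by_cases hmov : MovementCharge s S d σ Y a i
  · exact Or.inl ⟨a, ha, hal, hmov⟩
  right
  have hpos : (0 : ℝ) < 2 ^ (d j).level := by positivity
  have h2l : (2 : ℝ) ^ (d i).level = 2 * 2 ^ (d j).level := by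
    rw [hlev, zpow_add_one₀ two_ne_zero]; ring
  unfold MovementCharge at hmov
  obtain ⟨l, hl1, hl2, hl3, hl4, hl5⟩ := ho.exists_tour
    (h.time_mono (by omega : a ≤ i + 1) hi) (ℓ := (d i).level) (by linarith)
  have hmax := (h.isService j hjm).maximal.resolve_left (Finset.ne_empty_of_mem hmiss)
  have htime : (d j).time ≤ (d i).time := h.time_service_mono hj.le hi
  have hsum : ∀ l' : List X,
      (∀ q ∈ missed k v (S j) (d j).time (d j).level l', (d i).time < ts q) →
      ∑ q ∈ missed k v (S j) (d j).time (d j).level l',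
        ((v q).upper (d j).horizon - (v q).lower (d j).time) ≤
      ∑ q ∈ lateRequests k v S d ts j (d i).time,
        ((v q).lower (d i).time - (v q).lower (d j).time) := by
    intro l' hl'
    refine (Finset.sum_le_sum fun q hq => ?_).trans
      (Finset.sum_le_sum_of_subset_of_nonneg (fun q hq => ?_) fun q _ _ => ?_)
    · have hqk := (mem_eligible.1 (mem_missed.1 hq).1).1
      have h1 := ho.upper_eq q hqk _ (hl' q hq)
      linarith [(v q).upper_mono hhor]
    · exact Finset.mem_filter.2 ⟨(mem_missed.1 hq).1, hl' q hq⟩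
    · exact sub_nonneg.2 ((v q).lower_mono htime)
  have hvisit : ∀ q ∈ eligible k v (S j) (d j).time (d j).level, (v q).location ∉ l →
      (d i).time < ts q := by
    intro q hq hnl
    by_contra hcon
    refine hnl (hl5 q (mem_eligible.1 hq).1 (har q hq) ?_)
    rw [h.time_succ hi]
    exact WithBot.coe_le_coe.2 (not_lt.1 hcon)
  -- If the tour meets an eligible request, reaching it from the server and going around costs less
  -- than `3 * 2 ^ (d j).level` of the eightfold budget, leaving more than `2 ^ (d i).level`.
  -- Otherwise `σ` is late for all of them, and the empty tour serves as the candidate.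
  by_cases hnear : ∃ q ∈ eligible k v (S j) (d j).time (d j).level, (v q).location ∈ l
  · obtain ⟨q₁, hq₁, hql⟩ := hnear
    have h1 := hmax l hl1
    have h2 := hsum l fun q hq => hvisit q (mem_missed.1 hq).1 (mem_missed.1 hq).2
    have h3 := tour_le_tour_add (S j).pos (posAt s σ.moves (S a).time) l
    have h4 := (dist_le_reach (S := S j) q₁).trans (mem_eligible.1 hq₁).2.2.2.2
    have h5 := dist_le_tour (a := posAt s σ.moves (S a).time) hql hl3
    have h6 := dist_triangle (S j).pos (v q₁).location (posAt s σ.moves (S a).time)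
    linarith
  · have hnone : ∀ q ∈ eligible k v (S j) (d j).time (d j).level, (d i).time < ts q := fun q hq =>
      hvisit q hq fun hm => hnear ⟨q, hq, hm⟩
    have h1 := hmax [] List.nodup_nil
    have h2 := hsum [] fun q hq => hnone q (mem_missed.1 hq).1
    rw [tour_nil] at h1
    linarith

/-- By `hD` the relevant requests owe their reach to distances from the server after their release;
this makes the server far from the position of `σ` at some earlier service index. -/
theorem exists_primary_charge (h : IsExecution k v s S d M m) (ho : IsOffline k v s σ ts Y)
    {i : ℕ} (hi : i < m)
    (hD : ∀ q ∈ outer k v (S i) (d i).time (d i).level, 0 < excess v (S i) (d i).time q →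
      ∃ j ≤ i, (v q).release ≤ (d j).time ∧ (S i).reach v q = dist (S j).pos (v q).location) :
    (∃ a ≤ i, LevelsBelow d a i (d i).level ∧ MovementCharge s S d σ Y a i) ∨
    2 ^ (d i).level ≤ 8 * ∑ q ∈ lateRequests k v S d ts i (d i).time,
      max 0 ((v q).lower (d i).time - (S i).paid q) ∨
    ∃ j, IsApproach k v s S d σ j i := by
  classical
  obtain ⟨a, ha, hal, har⟩ := h.exists_last hi (d i).level
  by_cases hmov : MovementCharge s S d σ Y a i
  · exact Or.inl ⟨a, ha, hal, hmov⟩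
  right
  have hs := h.isService i hi
  have hpos : (0 : ℝ) < 2 ^ (d i).level := by positivity
  have hhalf : (2 : ℝ) ^ ((d i).level - 1) = 2 ^ (d i).level / 2 := zpow_sub_one₀ two_ne_zero _
  have hquarter : (2 : ℝ) ^ ((d i).level - 2) = 2 ^ (d i).level / 4 := by
    rw [zpow_sub₀ two_ne_zero]; norm_num
  unfold MovementCharge at hmov
  obtain ⟨l, hl1, hl2, hl3, hl4, hl5⟩ := ho.exists_tour
    (h.time_mono (by omega : a ≤ i + 1) hi) (ℓ := (d i).level) (by linarith)
  set O := outer k v (S i) (d i).time (d i).level with hO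
  set w := fun q => excess v (S i) (d i).time q with hw
  have hw0 : ∀ q, 0 ≤ w q := fun q => excess_nonneg _ q
  have hsumO : 2 ^ (d i).level / 2 ≤ ∑ q ∈ O, w q := hhalf ▸ hs.le_sum_outer
  have hOel : ∀ q ∈ O, q ∈ eligible k v (S i) (d i).time (d i).level := fun q hq =>
    (mem_outer.1 hq).1
  have hsplit := Finset.sum_filter_add_sum_filter_not O (fun q => (d i).time < ts q) w
  -- A late share of 1/4 of the outer weight, itself at least half of `2 ^ (d i).level`, gives the
  -- factor 8.
  by_cases hlate : ∑ q ∈ O, w q ≤ 4 * ∑ q ∈ O with (d i).time < ts q, w q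
  · left
    have h1 : ∑ q ∈ O with (d i).time < ts q, w q ≤
        ∑ q ∈ lateRequests k v S d ts i (d i).time,
          max 0 ((v q).lower (d i).time - (S i).paid q) := by
      refine (Finset.sum_congr rfl fun q hq => ?_).trans_le
        (Finset.sum_le_sum_of_subset_of_nonneg (fun q hq => ?_) fun q _ _ => le_max_left _ _)
      · obtain ⟨hq, hqt⟩ := Finset.mem_filter.1 hq
        have := ho.upper_eq q (mem_eligible.1 (hOel q hq)).1 _ hqt
        simp only [hw, excess, this]
      · obtain ⟨hq, hqt⟩ := Finset.mem_filter.1 hq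
        exact Finset.mem_filter.2 ⟨hOel q hq, hqt⟩
    linarith
  right
  set o := posAt s σ.moves (S (i + 1)).time with ho'
  have hol : o ∈ l := hl4 _ (h.time_mono (by omega : a ≤ i + 1) hi) le_rfl
  have hloc : ∀ q ∈ O.filter fun q => ¬ (d i).time < ts q, (v q).location ∈ l := by
    intro q hq
    obtain ⟨hq, hqt⟩ := Finset.mem_filter.1 hq
    refine hl5 q (mem_eligible.1 (hOel q hq)).1 (har q (hOel q hq)) ?_
    rw [h.time_succ hi]
    exact WithBot.coe_le_coe.2 (not_lt.1 hqt)
  have hnear : ∀ q ∈ O.filter fun q => ¬ (d i).time < ts q,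
      dist o (v q).location ≤ 2 ^ (d i).level / 32 := fun q hq =>
    (dist_le_tour hol (hloc q hq)).trans hl2
  have hheavy : IsHeavy k v (S i) (d i).time (d i).level o := by
    have h1 : ∑ q ∈ O with ¬ (d i).time < ts q, w q ≤
        ∑ q ∈ O with dist o (v q).location ≤ 2 ^ (d i).level / 32, w q :=
      Finset.sum_le_sum_of_subset_of_nonneg
        (fun q hq => Finset.mem_filter.2 ⟨(Finset.mem_filter.1 hq).1, hnear q hq⟩)
        fun q _ _ => hw0 q
    unfold IsHeavy
    change 3 / 4 * ∑ q ∈ O, w q ≤ ∑ q ∈ O with dist o (v q).location ≤ 2 ^ (d i).level / 32, w q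
    linarith
  have htarget : IsHeavy k v (S i) (d i).time (d i).level (d i).target :=
    hs.target_spec.resolve_right fun h => h.2 o hheavy
  -- Two sets that each carry at least 3/4 of a positive weight intersect, so some request is near
  -- both the target and `o`.
  have hclose : dist (d i).target o ≤ 2 ^ (d i).level / 16 := by
    have h1 : 3 / 4 * ∑ q ∈ O, w q ≤
        ∑ q ∈ O with dist (d i).target (v q).location ≤ 2 ^ (d i).level / 32, w q := htarget
    set A := O.filter fun q => dist (d i).target (v q).location ≤ 2 ^ (d i).level / 32 with hA
    set B := O.filter fun q => ¬ (d i).time < ts q with hB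
    have h2 : (A ∩ B).Nonempty := by
      rw [Finset.nonempty_iff_ne_empty]
      intro he
      have h3 := Finset.sum_union_inter (s₁ := A) (s₂ := B) (f := w)
      have h4 : ∑ q ∈ A ∪ B, w q ≤ ∑ q ∈ O, w q :=
        Finset.sum_le_sum_of_subset_of_nonneg
          (Finset.union_subset (Finset.filter_subset _ _) (Finset.filter_subset _ _))
          fun q _ _ => hw0 q
      rw [he, Finset.sum_empty] at h3
      linarith
    obtain ⟨q, hq⟩ := h2
    obtain ⟨hqA, hqB⟩ := Finset.mem_inter.1 hq
    have h3 := (Finset.mem_filter.1 hqA).2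
    have h4 := hnear q hqB
    linarith [dist_triangle_right (d i).target o (v q).location]
  obtain ⟨q, hqB, hqw⟩ : ∃ q ∈ O.filter fun q => ¬ (d i).time < ts q, 0 < w q := by
    by_contra hcon
    have := Finset.sum_nonpos fun q hq => not_lt.1 fun hqw => hcon ⟨q, hq, hqw⟩
    linarith
  have hqO := (Finset.mem_filter.1 hqB).1
  obtain ⟨j, hj, hjr, hjd⟩ := hD q hqO hqw
  have hjm := hj.trans_lt hi
  refine ⟨j, hj, ⟨q, hOel q hqO, hjr⟩, ?_, ?_⟩
  -- The request was more than `2 ^ (d i).level / 2` from the server, and within `2 ^ (d i).level /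
  -- 32` of `σ`.
  · have h1 : posAt s σ.moves (S (j + 1)).time ∈ l := by
      refine hl4 _ ?_ (h.time_mono (by omega) hi)
      rw [h.time_succ hjm]
      exact (har q (hOel q hqO)).le.trans (WithBot.coe_le_coe.2 hjr)
    have h2 := (dist_le_tour (a := posAt s σ.moves (S a).time) h1 (hloc q hqB)).trans hl2
    have h3 := (mem_outer.1 hqO).2
    rw [hjd, hhalf] at h3
    have h4 := dist_triangle (S j).pos (posAt s σ.moves (S (j + 1)).time) (v q).location
    linarith
  · rw [h.pos_succ hi]
    exact hclose

/-- Every service is charged to the schedule `σ` in one of five ways. -/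
theorem exists_charge (h : IsExecution k v s S d M m) (ho : IsOffline k v s σ ts Y)
    {i : ℕ} (hi : i < m) :
    (∃ a ≤ i, LevelsBelow d a i (d i).level ∧ MovementCharge s S d σ Y a i) ∨
    2 ^ (d i).level ≤ 8 * ∑ q ∈ lateRequests k v S d ts i (d i).time,
      max 0 ((v q).lower (d i).time - (S i).paid q) ∨
    (∃ j, IsApproach k v s S d σ j i) ∨
    (∃ j, IsParent d j i ∧ ∃ a ≤ j, LevelsBelow d a j (d j).level ∧
      MovementCharge s S d σ Y a i) ∨
    ∃ j, IsParent d j i ∧ 2 ^ (d i).level ≤ ∑ q ∈ lateRequests k v S d ts j (d i).time,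
      ((v q).lower (d i).time - (v q).lower (d j).time) := by
  by_cases hD : ∀ q ∈ outer k v (S i) (d i).time (d i).level,
      0 < excess v (S i) (d i).time q →
      ∃ j ≤ i, (v q).release ≤ (d j).time ∧ (S i).reach v q = dist (S j).pos (v q).location
  · rcases exists_primary_charge h ho hi hD with h1 | h1 | h1
    · exact Or.inl h1
    · exact Or.inr (Or.inl h1)
    · exact Or.inr (Or.inr (Or.inl h1))
  · push Not at hD
    obtain ⟨q, hq, hex, hno⟩ := hD
    have hel := mem_eligible.1 (mem_outer.1 hq).1
    rcases h.reach_origin hi.le hel.1 hel.2.2.1 with ⟨j, h1, h2, h3⟩ | ⟨j, h1, h2, h3, h4⟩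
    · refine absurd h3 (hno j h1 ?_)
      rcases h1.eq_or_lt with rfl | h1
      · exact hel.2.1
      · exact h2 h1
    · obtain ⟨hp, h5 | h5⟩ := exists_parent_charge h ho hi hq hex h1 h2 h3 h4
      · exact Or.inr (Or.inr (Or.inr (Or.inl ⟨j, hp, h5⟩)))
      · exact Or.inr (Or.inr (Or.inr (Or.inr ⟨j, hp, h5⟩)))

end Charging

/-! ### Summing up the charges. -/

section Summation

theorem sum_list_map_comm {α ι : Type*} (F : Finset ι) (l : List α) (f : ι → α → ℝ) :
    ∑ i ∈ F, (l.map (f i)).sum = (l.map fun e => ∑ i ∈ F, f i e).sum := by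
  induction l with
  | nil => simp
  | cons a l ih => simp [Finset.sum_add_distrib, ih]

theorem sum_filter_map {α : Type*} (l : List α) (p : α → Bool) (f : α → ℝ) :
    ((l.filter p).map f).sum = (l.map fun e => if p e then f e else 0).sum := by
  induction l with
  | nil => rfl
  | cons a l ih =>
    rw [List.filter_cons, List.map_cons, List.sum_cons]
    split_ifs <;> simp [ih]

/-- Indices which hold at the same time have different levels, so that a sum over these indices
is at most a sum over levels. -/
theorem sum_filter_le_sum_levels (F : Finset ℕ) (p : ℕ → Prop) [DecidablePred p] (ℓ : ℕ → ℤ)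
    (f : ℤ → ℝ) (hf : ∀ j, 0 ≤ f j)
    (hp : ∀ i ∈ F, ∀ j ∈ F, i < j → ℓ i = ℓ j → p i → ¬ p j) :
    ∑ i ∈ F with p i, f (ℓ i) ≤ ∑ j ∈ F.image ℓ, f j := by
  classical
  have hinj : Set.InjOn ℓ (F.filter p) := by
    intro i hi j hj hij
    obtain ⟨hi, hpi⟩ := Finset.mem_filter.1 (Finset.mem_coe.1 hi)
    obtain ⟨hj, hpj⟩ := Finset.mem_filter.1 (Finset.mem_coe.1 hj)
    rcases lt_trichotomy i j with h | h | h
    · exact absurd hpj (hp i hi j hj h hij hpi)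
    · exact h
    · exact absurd hpi (hp j hj i hi h hij.symm hpj)
  rw [← Finset.sum_image (f := f) hinj]
  exact Finset.sum_le_sum_of_subset_of_nonneg
    (Finset.image_subset_image (Finset.filter_subset _ _)) fun j _ _ => hf j

/-- For each request separately, the charged intervals of its delay cost follow one another, up to
what the schedule pays. -/
theorem sum_late_le {X : Type*} {k : ℕ} {v : ℕ → GeneralRequest X} {ts : ℕ → ℝ}
    (F : Finset ℕ) (Q : ℕ → Finset ℕ) (hQ : ∀ i, ∀ q ∈ Q i, q < k)
    (a b : ℕ → ℕ → ℝ) (ha : ∀ i ∈ F, ∀ q ∈ Q i, 0 ≤ a i q)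
    (hb : ∀ i ∈ F, ∀ q ∈ Q i, b i q ≤ (v q).lower (ts q))
    (hab : ∀ i ∈ F, ∀ j ∈ F, i < j → ∀ q ∈ Q i, q ∈ Q j → b i q ≤ a j q) :
    ∑ i ∈ F, ∑ q ∈ Q i, max 0 (b i q - a i q) ≤
      ∑ q ∈ Finset.range k, (v q).lower (ts q) := by
  classical
  rw [Finset.sum_comm' (t' := Finset.range k) (s' := fun q => F.filter fun i => q ∈ Q i)]
  · refine Finset.sum_le_sum fun q _ => ?_
    have hmem : ∀ i ∈ F.filter fun i => q ∈ Q i, i ∈ F ∧ q ∈ Q i := fun i hi =>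
      Finset.mem_filter.1 hi
    exact sum_intervals_le _ (fun i => a i q) (fun i => b i q) ((v q).lower_nonneg _)
      (fun i hi => ha i (hmem i hi).1 q (hmem i hi).2)
      (fun i hi => hb i (hmem i hi).1 q (hmem i hi).2)
      fun i hi j hj hij => hab i (hmem i hi).1 j (hmem j hj).1 hij q (hmem i hi).2 (hmem j hj).2
  · intro i q
    rw [Finset.mem_filter, Finset.mem_range]
    exact ⟨fun h => ⟨⟨h.1, h.2⟩, hQ i q h.2⟩, fun h => h.1⟩

variable {X : Type*} [MetricSpace X] {k : ℕ} {v : ℕ → GeneralRequest X} {s : X}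
  {S : ℕ → ServerState X} {d : ℕ → Service X} {M : ℕ → List (ℝ × X)} {m : ℕ}
  {σ : Schedule X} {ts : ℕ → ℝ} {Y : Finset X}

/-- By `hdisj` a step lies in at most one charged interval of each level; `sum_trunc_le` then bounds
its total share. -/
theorem sum_movementIn_le (h : IsExecution k v s S d M m) {N : ℕ} (hN : 0 < N) (l : List (ℝ × X))
    (F : Finset ℕ) (hF : ∀ i ∈ F, i < m) (a : ℕ → ℕ) (ha : ∀ i ∈ F, a i ≤ i)
    (hdisj : ∀ i ∈ F, ∀ j ∈ F, i < j → (d i).level = (d j).level → i < a j) :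
    ∑ i ∈ F, movementIn (trunc N (d i).level) s l (S (a i)).time (S (i + 1)).time ≤
      (3 + Real.logb 2 (128 * N)) * pathLength s (l.map Prod.snd) := by
  classical
  simp only [movementIn, sum_filter_map]
  rw [sum_list_map_comm, ← stepSum_id, ← sum_steps, ← List.sum_map_mul_left]
  refine List.sum_le_sum fun e he => ?_
  have he2 := (exists_mem_of_mem_steps he).2
  set p : ℕ → Prop := fun i => (e.1 : WithBot ℝ) ≤ (S (i + 1)).time ∧
    ¬ (e.1 : WithBot ℝ) ≤ (S (a i)).time with hp
  have h1 : ∑ i ∈ F, (if (decide ((e.1 : WithBot ℝ) ≤ (S (i + 1)).time) &&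
      !decide ((e.1 : WithBot ℝ) ≤ (S (a i)).time)) = true then trunc N (d i).level e.2 else 0) =
      ∑ i ∈ F with p i, trunc N (d i).level e.2 := by
    rw [Finset.sum_filter]
    refine Finset.sum_congr rfl fun i _ => ?_
    simp [hp]
  rw [h1]
  refine (sum_filter_le_sum_levels F p (fun i => (d i).level) (fun j => trunc N j e.2)
    (fun j => trunc_nonneg N j he2) fun i hi j hj hij hl hpi hpj => ?_).trans ?_
  · exact hpj.2 (hpi.1.trans (h.time_mono (hdisj i hi j hj hij hl) ((ha j hj).trans (hF j hj).le)))
  · rw [mul_comm (3 + _)]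
    exact sum_trunc_le hN _ he2

theorem mem_lateRequests {i q : ℕ} {T : ℝ} : q ∈ lateRequests k v S d ts i T ↔
    q ∈ eligible k v (S i) (d i).time (d i).level ∧ T < ts q := by
  simp [lateRequests]

theorem sum_primary_delay_le (h : IsExecution k v s S d M m) (F : Finset ℕ)
    (hF : ∀ i ∈ F, i < m)
    (hc : ∀ i ∈ F, 2 ^ (d i).level ≤ 8 * ∑ q ∈ lateRequests k v S d ts i (d i).time,
      max 0 ((v q).lower (d i).time - (S i).paid q)) :
    ∑ i ∈ F, (2 : ℝ) ^ (d i).level ≤ 8 * ∑ q ∈ Finset.range k, (v q).lower (ts q) := by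
  refine (Finset.sum_le_sum hc).trans ?_
  rw [← Finset.mul_sum]
  refine mul_le_mul_of_nonneg_left ?_ (by norm_num)
  refine sum_late_le F (fun i => lateRequests k v S d ts i (d i).time)
    (fun i q hq => (mem_eligible.1 (mem_lateRequests.1 hq).1).1)
    (fun i q => (S i).paid q) (fun i q => (v q).lower (d i).time)
    (fun i hi q _ => h.paid_nonneg (hF i hi).le q)
    (fun i _ q hq => (v q).lower_mono (mem_lateRequests.1 hq).2.le)
    fun i hi j hj hij q hq _ => ?_
  have h1 := lower_le_advance_paid (h.isService i (hF i hi)).time_le_horizon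
    (mem_lateRequests.1 hq).1
  rw [← h.state_succ i (hF i hi)] at h1
  exact h1.trans (h.paid_mono hij (hF j hj).le q)

theorem IsExecution.level_lt_of_mem (h : IsExecution k v s S d M m) {i j : ℕ} (hij : i < j)
    (hj : j < m) {q : ℕ} (hqi : q ∈ eligible k v (S i) (d i).time (d i).level)
    (hqj : q ∈ eligible k v (S j) (d j).time (d j).level) : (d i).level < (d j).level := by
  by_contra hcon
  have h1 := h.lt_release hij hj hqj (not_lt.1 hcon)
  have h2 := (mem_eligible.1 hqi).2.1
  linarith

/-- For a shared request, the intervals from parent to child do not overlap. -/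
theorem sum_parent_delay_le (h : IsExecution k v s S d M m) (F : Finset ℕ)
    (hF : ∀ i ∈ F, i < m)
    (hc : ∀ i ∈ F, ∃ j, IsParent d j i ∧ 2 ^ (d i).level ≤
      ∑ q ∈ lateRequests k v S d ts j (d i).time,
        ((v q).lower (d i).time - (v q).lower (d j).time)) :
    ∑ i ∈ F, (2 : ℝ) ^ (d i).level ≤ ∑ q ∈ Finset.range k, (v q).lower (ts q) := by
  choose! p hp hc using hc
  refine (Finset.sum_le_sum fun i hi => (hc i hi).trans
    (Finset.sum_le_sum fun q _ => le_max_right 0 _)).trans ?_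
  refine sum_late_le F (fun i => lateRequests k v S d ts (p i) (d i).time)
    (fun i q hq => (mem_eligible.1 (mem_lateRequests.1 hq).1).1)
    (fun i q => (v q).lower (d (p i)).time) (fun i q => (v q).lower (d i).time)
    (fun i _ q _ => (v q).lower_nonneg _)
    (fun i _ q hq => (v q).lower_mono (mem_lateRequests.1 hq).2.le)
    fun i hi j hj hij q hqi hqj => (v q).lower_mono ?_
  have hqi := (mem_lateRequests.1 hqi).1
  have hqj := (mem_lateRequests.1 hqj).1
  obtain ⟨hi1, hi2, hi3⟩ := hp i hi
  obtain ⟨hj1, hj2, hj3⟩ := hp j hj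
  have hpj : p j < m := hj1.trans (hF j hj)
  have hpi : p i < m := hi1.trans (hF i hi)
  refine h.time_service_mono ?_ hpj
  -- A request gains level from one service to the next that it takes part in, while between parent
  -- and child all levels are at most the parent's. So neither nesting nor crossing is possible.
  rcases lt_trichotomy (p i) (p j) with hlt | heq | hlt
  · have h1 := h.level_lt_of_mem hlt hpj hqi hqj
    by_contra hcon
    have h2 := hi3 (p j) hlt (not_le.1 hcon)
    omega
  · have h2 := hj3 i (by omega) hij
    rw [heq] at hi2
    omega
  · have h1 := h.level_lt_of_mem hlt hpi hqj hqi
    have h2 := hj3 (p i) hlt (hi1.trans hij)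
    omega

theorem sum_primary_movement_le (h : IsExecution k v s S d M m) (hY : 0 < Y.card) (F : Finset ℕ)
    (hF : ∀ i ∈ F, i < m)
    (hc : ∀ i ∈ F, ∃ a ≤ i, LevelsBelow d a i (d i).level ∧ MovementCharge s S d σ Y a i) :
    ∑ i ∈ F, (2 : ℝ) ^ (d i).level ≤
      128 * ((3 + Real.logb 2 (128 * Y.card)) * σ.movementCost s) := by
  choose! a ha hl hc using hc
  refine (Finset.sum_le_sum hc).trans ?_
  rw [← Finset.mul_sum, Schedule.movementCost, travel_eq_pathLength]
  refine mul_le_mul_of_nonneg_left ?_ (by norm_num)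
  refine sum_movementIn_le h hY _ F hF a ha fun i hi j hj hij he => ?_
  by_contra hcon
  have := hl j hj i (not_lt.1 hcon) hij
  omega

theorem sum_parent_movement_le (h : IsExecution k v s S d M m) (hY : 0 < Y.card) (F : Finset ℕ)
    (hF : ∀ i ∈ F, i < m)
    (hc : ∀ i ∈ F, ∃ j, IsParent d j i ∧ ∃ a ≤ j, LevelsBelow d a j (d j).level ∧
      MovementCharge s S d σ Y a i) :
    ∑ i ∈ F, (2 : ℝ) ^ (d i).level ≤
      128 * ((3 + Real.logb 2 (128 * Y.card)) * σ.movementCost s) := by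
  choose! p hp a ha hl hc using hc
  refine (Finset.sum_le_sum hc).trans ?_
  rw [← Finset.mul_sum, Schedule.movementCost, travel_eq_pathLength]
  refine mul_le_mul_of_nonneg_left ?_ (by norm_num)
  refine sum_movementIn_le h hY _ F hF a (fun i hi => (ha i hi).trans (hp i hi).1.le)
    fun i hi j hj hij he => ?_
  obtain ⟨h1, h2, h3⟩ := hp j hj
  by_contra hcon
  have hai : a j ≤ i := not_lt.1 hcon
  rcases lt_trichotomy i (p j) with hlt | heq | hlt
  · have := hl j hj i hai hlt
    omega
  · rw [← heq] at h2
    omega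
  · have := h3 i hlt hij
    omega

theorem sum_range_two_mul (f : ℕ → ℝ) (m : ℕ) :
    ∑ n ∈ Finset.range (2 * m), f n = ∑ j ∈ Finset.range m, (f (2 * j) + f (2 * j + 1)) := by
  induction m with
  | zero => simp
  | succ m ih =>
    rw [show 2 * (m + 1) = 2 * m + 1 + 1 by ring, Finset.sum_range_succ, Finset.sum_range_succ,
      Finset.sum_range_succ, ih]
    ring

theorem sub_le_sum_max (u : ℕ → ℝ) {a b : ℕ} (hab : a ≤ b) :
    u a - u b ≤ ∑ n ∈ Finset.Ico a b, max 0 (u n - u (n + 1)) := by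
  induction b, hab using Nat.le_induction with
  | base => simp
  | succ b hab ih =>
    rw [Finset.sum_Ico_succ_top hab]
    linarith [le_max_right 0 (u b - u (b + 1))]

/-- A sequence that ends no lower than it starts decreases in total at most as much as it increases.
-/
theorem sum_max_sub_le (u : ℕ → ℝ) (n : ℕ) (h : u 0 ≤ u n) :
    ∑ i ∈ Finset.range n, max 0 (u i - u (i + 1)) ≤
      ∑ i ∈ Finset.range n, max 0 (u (i + 1) - u i) := by
  have e : ∀ x y : ℝ, max 0 (x - y) = max 0 (y - x) + (x - y) := by
    intro x y
    rcases le_total x y with h | h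
    · rw [max_eq_left (by linarith), max_eq_right (by linarith)]; ring
    · rw [max_eq_right (by linarith), max_eq_left (by linarith)]; ring
  have h1 : ∑ i ∈ Finset.range n, (u i - u (i + 1)) = u 0 - u n := Finset.sum_range_sub' u n
  rw [Finset.sum_congr rfl fun i _ => e (u i) (u (i + 1)), Finset.sum_add_distrib, h1]
  linarith

open Classical in
-- Each approach lowers the distance of the two servers through the band of its level. The total
-- decrease is at most the total increase, which comes from `σ`, from other services, and by at most
-- `2 ^ ℓ / 16` from an approach itself; the last part is absorbed on the left.
theorem sum_approach_le (h : IsExecution k v s S d M m) (F : Finset ℕ)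
    (hF : ∀ i ∈ F, i < m) (hc : ∀ i ∈ F, ∃ j, IsApproach k v s S d σ j i) :
    ∑ i ∈ F, (2 : ℝ) ^ (d i).level ≤ 16 * σ.movementCost s +
      32 * ∑ i ∈ Finset.range m with i ∉ F, (2 : ℝ) ^ (d i).level := by
  choose! p hp using hc
  set o : ℕ → X := fun i => posAt s σ.moves (S i).time with ho
  -- Moves alternate: at even indices the next to move is `σ`, at odd ones the server.
  set u : ℕ → ℝ := fun n => dist (S (n / 2)).pos (o ((n + 1) / 2)) with hu
  have hu0 : ∀ j, u (2 * j) = dist (S j).pos (o j) := fun j => by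
    simp only [hu]; congr 3 <;> omega
  have hu1 : ∀ j, u (2 * j + 1) = dist (S j).pos (o (j + 1)) := fun j => by
    simp only [hu]; congr 3 <;> omega
  have hu2 : ∀ j, u (2 * j + 1 + 1) = dist (S (j + 1)).pos (o (j + 1)) := fun j => hu0 (j + 1)
  set Λ := F.image fun i => (d i).level with hΛ
  have hstart : u 0 = 0 := by
    have h1 := hu0 0
    rw [mul_zero] at h1
    have hp0 : (S 0).pos = s := by rw [h.state_zero]; rfl
    have ht0 : (S 0).time = ⊥ := by rw [h.state_zero]; rfl
    have hnil : (σ.moves.filter fun m => decide ((m.1 : WithBot ℝ) ≤ (⊥ : WithBot ℝ))) = [] := by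
      simp
    have ho0 : o 0 = s := by simp only [ho, ht0, posAt, hnil]; rfl
    rw [h1, hp0, ho0, dist_self]
  have hdown : ∀ i ∈ F, (2 : ℝ) ^ (d i).level / 8 ≤
      ∑ n ∈ Finset.Ico (2 * p i + 1) (2 * i + 2),
        max 0 (band (d i).level (u n) - band (d i).level (u (n + 1))) := by
    intro i hi
    obtain ⟨h1, -, h3, h4⟩ := hp i hi
    have hpos : (0 : ℝ) < 2 ^ (d i).level := by positivity
    have e3 : (2 : ℝ) ^ ((d i).level - 3) = 2 ^ (d i).level / 8 := by
      rw [zpow_sub₀ two_ne_zero]; norm_num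
    have e2 : (2 : ℝ) ^ ((d i).level - 2) = 2 ^ (d i).level / 4 := by
      rw [zpow_sub₀ two_ne_zero]; norm_num
    have h5 : band (d i).level (u (2 * p i + 1)) = 2 ^ (d i).level / 4 := by
      rw [hu1, band, min_eq_right h3, e3, e2, max_eq_right (by linarith)]
    have h6 : band (d i).level (u (2 * i + 2)) = 2 ^ (d i).level / 8 := by
      have h4' : u (2 * i + 2) ≤ 2 ^ (d i).level / 16 := (hu2 i).trans_le h4
      rw [band, e3, e2]
      exact max_eq_left ((min_le_left _ _).trans (by linarith))
    have h7 := sub_le_sum_max (fun n => band (d i).level (u n))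
      (show 2 * p i + 1 ≤ 2 * i + 2 by omega)
    simp only [h5, h6] at h7
    linarith
  have hswap : ∑ i ∈ F, ∑ n ∈ Finset.Ico (2 * p i + 1) (2 * i + 2),
        max 0 (band (d i).level (u n) - band (d i).level (u (n + 1))) ≤
      ∑ n ∈ Finset.range (2 * m), ∑ ℓ ∈ Λ, max 0 (band ℓ (u n) - band ℓ (u (n + 1))) := by
    rw [Finset.sum_comm' (t' := Finset.range (2 * m))
      (s' := fun n => F.filter fun i => n ∈ Finset.Ico (2 * p i + 1) (2 * i + 2))]
    · refine Finset.sum_le_sum fun n _ => ?_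
      refine sum_filter_le_sum_levels F _ (fun i => (d i).level)
        (fun ℓ => max 0 (band ℓ (u n) - band ℓ (u (n + 1)))) (fun ℓ => le_max_left _ _)
        fun i hi j hj hij he hni hnj => ?_
      rw [Finset.mem_Ico] at hni hnj
      obtain ⟨h1, ⟨q, hq, hqr⟩, -⟩ := hp j hj
      have h2 := (h.lt_release hij (hF j hj) hq he.ge).trans_le hqr
      -- The request that witnesses the approach `j` was released after the equal-level service `i`
      -- and by the time of `p j`.
      have h3 : i < p j := by
        by_contra hcon
        exact absurd (h.time_service_mono (not_lt.1 hcon) (hF i hi)) (not_le.2 h2)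
      omega
    · intro i n
      rw [Finset.mem_filter, Finset.mem_range]
      refine ⟨fun hin => ⟨hin, ?_⟩, fun hin => hin.1⟩
      have h1 := hF i hin.1
      have h2 := Finset.mem_Ico.1 hin.2
      omega
  have hup : ∑ n ∈ Finset.range (2 * m), ∑ ℓ ∈ Λ, max 0 (band ℓ (u n) - band ℓ (u (n + 1))) ≤
      ∑ n ∈ Finset.range (2 * m), max 0 (u (n + 1) - u n) := by
    rw [Finset.sum_comm]
    refine (Finset.sum_le_sum fun ℓ _ => sum_max_sub_le (fun n => band ℓ (u n)) (2 * m)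
      (band_mono ℓ (hstart ▸ dist_nonneg))).trans ?_
    rw [Finset.sum_comm]
    exact Finset.sum_le_sum fun n _ => sum_band_max_le Λ _ _
  have hmove : ∑ n ∈ Finset.range (2 * m), max 0 (u (n + 1) - u n) ≤
      ∑ j ∈ Finset.range m, (dist (o j) (o (j + 1)) +
        if j ∈ F then 2 ^ (d j).level / 16 else 2 * 2 ^ (d j).level) := by
    rw [sum_range_two_mul]
    refine Finset.sum_le_sum fun j hj => add_le_add ?_ ?_
    · rw [hu0, hu1]
      refine max_le dist_nonneg ?_
      linarith [dist_triangle (S j).pos (o j) (o (j + 1))]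
    · rw [hu1, hu2]
      have hjm := Finset.mem_range.1 hj
      split_ifs with hjF
      · refine max_le (by positivity) ?_
        linarith [(hp j hjF).2.2.2, dist_nonneg (x := (S j).pos) (y := o (j + 1))]
      · refine max_le (by positivity) ?_
        have h1 := (h.isService j hjm).dist_target_le
        rw [← h.pos_succ hjm] at h1
        linarith [dist_triangle_left (S (j + 1)).pos (o (j + 1)) (S j).pos]
  have hopt : ∑ j ∈ Finset.range m, dist (o j) (o (j + 1)) ≤ σ.movementCost s := by
    rw [Schedule.movementCost, travel_eq_pathLength]
    exact sum_dist_posAt_le σ.chronological s (fun i => (S i).time) m fun i hi =>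
      h.time_mono (Nat.le_succ i) hi
  have hsplit : ∑ j ∈ Finset.range m,
      (if j ∈ F then (2 : ℝ) ^ (d j).level / 16 else 2 * 2 ^ (d j).level) =
      (∑ j ∈ F, (2 : ℝ) ^ (d j).level) / 16 +
        2 * ∑ i ∈ Finset.range m with i ∉ F, (2 : ℝ) ^ (d i).level := by
    rw [Finset.sum_ite, Finset.sum_div, Finset.mul_sum]
    congr 2
    ext j
    simp only [Finset.mem_filter, Finset.mem_range]
    exact ⟨fun hj => hj.2, fun hj => ⟨hF j hj, hj⟩⟩
  have h1 := (Finset.sum_le_sum hdown).trans (hswap.trans (hup.trans hmove))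
  rw [Finset.sum_add_distrib, hsplit, ← Finset.sum_div] at h1
  linarith

open Classical in
-- Taking `F` in `h₃` to be all of case 3, everything else falls under the other four cases; `33 = 1
-- + 32`.
theorem sum_le_of_cases {R : Finset ℕ} {w : ℕ → ℝ} (hw : ∀ i, 0 ≤ w i)
    {P₁ P₂ P₃ P₄ P₅ : ℕ → Prop} (hP : ∀ i ∈ R, P₁ i ∨ P₂ i ∨ P₃ i ∨ P₄ i ∨ P₅ i)
    {b₁ b₂ b₃ b₄ b₅ : ℝ}
    (h₁ : ∀ F ⊆ R, (∀ i ∈ F, P₁ i) → ∑ i ∈ F, w i ≤ b₁)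
    (h₂ : ∀ F ⊆ R, (∀ i ∈ F, P₂ i) → ∑ i ∈ F, w i ≤ b₂)
    (h₃ : ∀ F ⊆ R, (∀ i ∈ F, P₃ i) → ∑ i ∈ F, w i ≤ b₃ + 32 * ∑ i ∈ R with i ∉ F, w i)
    (h₄ : ∀ F ⊆ R, (∀ i ∈ F, P₄ i) → ∑ i ∈ F, w i ≤ b₄)
    (h₅ : ∀ F ⊆ R, (∀ i ∈ F, P₅ i) → ∑ i ∈ F, w i ≤ b₅) :
    ∑ i ∈ R, w i ≤ b₃ + 33 * (b₁ + b₂ + b₄ + b₅) := by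
  have hm : ∀ P : ℕ → Prop, ∀ i ∈ R.filter P, P i := fun P i hi => (Finset.mem_filter.1 hi).2
  have s₁ := h₁ _ (Finset.filter_subset P₁ R) (hm P₁)
  have s₂ := h₂ _ (Finset.filter_subset P₂ R) (hm P₂)
  have s₃ := h₃ _ (Finset.filter_subset P₃ R) (hm P₃)
  have s₄ := h₄ _ (Finset.filter_subset P₄ R) (hm P₄)
  have s₅ := h₅ _ (Finset.filter_subset P₅ R) (hm P₅)
  have hnot : ∑ i ∈ R with i ∉ R.filter P₃, w i = ∑ i ∈ R with ¬ P₃ i, w i := by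
    congr 1
    ext i
    simp only [Finset.mem_filter]
    tauto
  rw [hnot] at s₃
  have hrest : ∑ i ∈ R with ¬ P₃ i, w i ≤ ∑ i ∈ R with P₁ i, w i + ∑ i ∈ R with P₂ i, w i +
      ∑ i ∈ R with P₄ i, w i + ∑ i ∈ R with P₅ i, w i := by
    simp only [Finset.sum_filter, ← Finset.sum_add_distrib]
    refine Finset.sum_le_sum fun i hi => ?_
    have hnn : ∀ (P : Prop), (0 : ℝ) ≤ if P then w i else 0 := fun P => by
      split_ifs
      exacts [hw i, le_rfl]
    have e1 := hnn (P₁ i)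
    have e2 := hnn (P₂ i)
    have e4 := hnn (P₄ i)
    have e5 := hnn (P₅ i)
    by_cases hi3 : P₃ i
    · rw [if_neg (not_not.2 hi3)]; linarith
    · rw [if_pos hi3]
      rcases hP i hi with c | c | c | c | c
      · rw [if_pos c]; linarith
      · rw [if_pos c]; linarith
      · exact absurd c hi3
      · rw [if_pos c]; linarith
      · rw [if_pos c]; linarith
  rw [← Finset.sum_filter_add_sum_filter_not R P₃]
  linarith

theorem sum_two_zpow_level_le (h : IsExecution k v s S d M m) (ho : IsOffline k v s σ ts Y) :
    ∑ i ∈ Finset.range m, (2 : ℝ) ^ (d i).level ≤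
      8464 * (3 + Real.logb 2 (128 * Y.card)) *
        (σ.movementCost s + ∑ q ∈ Finset.range k, (v q).lower (ts q)) := by
  have hY : 0 < Y.card := Finset.card_pos.2 ⟨s, ho.start_mem⟩
  have hRm : ∀ F ⊆ Finset.range m, ∀ i ∈ F, i < m := fun F hF i hi => Finset.mem_range.1 (hF hi)
  have h1 := sum_le_of_cases (R := Finset.range m) (w := fun i => (2 : ℝ) ^ (d i).level)
    (fun i => by positivity) (fun i hi => exists_charge h ho (Finset.mem_range.1 hi))
    (fun F hF hc => sum_primary_movement_le h hY F (hRm F hF) hc)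
    (fun F hF hc => sum_primary_delay_le h F (hRm F hF) hc)
    (fun F hF hc => sum_approach_le h F (hRm F hF) hc)
    (fun F hF hc => sum_parent_movement_le h hY F (hRm F hF) hc)
    (fun F hF hc => sum_parent_delay_le h F (hRm F hF) hc)
  refine h1.trans ?_
  have hmov : 0 ≤ σ.movementCost s := by
    rw [Schedule.movementCost, travel_eq_pathLength]
    exact pathLength_nonneg _ _
  have hD : 0 ≤ ∑ q ∈ Finset.range k, (v q).lower (ts q) :=
    Finset.sum_nonneg fun q _ => (v q).lower_nonneg _
  have hK : 1 ≤ 3 + Real.logb 2 (128 * Y.card) := by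
    have : 0 ≤ Real.logb 2 (128 * Y.card) := by
      refine Real.logb_nonneg (by norm_num) ?_
      have : (1 : ℝ) ≤ Y.card := by exact_mod_cast hY
      linarith
    linarith
  generalize ∑ q ∈ Finset.range k, (v q).lower (ts q) = D at hD ⊢
  generalize σ.movementCost s = c at hmov ⊢
  generalize 3 + Real.logb 2 (128 * (Y.card : ℝ)) = K at hK ⊢
  -- Here `8464 = 33 * (128 + 128) + 16`; the coefficient `33 * (8 + 1)` of the delay is smaller.
  nlinarith [le_mul_of_one_le_left hmov hK, le_mul_of_one_le_left hD hK]

end Summation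

/-! ### The algorithm on lists of requests, and its competitive ratio. -/

section General

/-- A request which nobody makes, to fill up a list of requests to a sequence. -/
def fillRequest {X : Type*} (s : X) : GeneralRequest X where
  location := s
  release := 0
  lower t := max t 0
  upper t := max t 0
  lower_mono := monotone_id.max monotone_const
  upper_mono := monotone_id.max monotone_const
  lower_le_upper _ := le_rfl
  upper_le_lower _ _ h := max_le_max_right 0 h.le
  lower_eq_zero _ h := max_eq_right h
  upper_eq_zero _ h := max_eq_right h.le
  lower_lsc := (continuous_id.max continuous_const).lowerSemicontinuous
  upper_usc := (continuous_id.max continuous_const).upperSemicontinuous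
  upper_unbounded c := ⟨c, le_max_left _ _⟩

variable {X Q : Type*} {rel : Q → ℝ}

/-- The requests of a list as a sequence. -/
def requestSeq (f : Q → GeneralRequest X) (s : X) (l : List Q) (i : ℕ) : GeneralRequest X :=
  (l[i]?.map f).getD (fillRequest s)

theorem requestSeq_of_lt (f : Q → GeneralRequest X) (s : X) {l : List Q} {i : ℕ}
    (hi : i < l.length) : requestSeq f s l i = f l[i] := by
  simp [requestSeq, hi]

theorem getElem?_filter_of_pairwise {l : List Q} (hl : l.Pairwise fun q q' => rel q ≤ rel q')
    (t : ℝ) (i : ℕ) : (l.filter fun q => decide (rel q ≤ t))[i]? =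
      l[i]?.filter fun q => decide (rel q ≤ t) := by
  induction l generalizing i with
  | nil => simp
  | cons a l ih =>
    obtain ⟨ha, hl⟩ := List.pairwise_cons.1 hl
    by_cases h : rel a ≤ t
    · rw [List.filter_cons_of_pos (by simpa using h)]
      cases i with
      | zero => simp [Option.filter, h]
      | succ i => simpa using ih hl i
    · have hno : ∀ b ∈ a :: l, ¬ rel b ≤ t := by
        intro b hb hbt
        rcases List.mem_cons.1 hb with rfl | hb
        · exact h hbt
        · exact h ((ha b hb).trans hbt)
      rw [List.filter_eq_nil_iff.2 fun b hb => by simpa using hno b hb]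
      cases hi : (a :: l)[i]? with
      | none => simp
      | some b =>
        have := hno b (List.mem_of_getElem? hi)
        simp [Option.filter, this]

theorem agree_requestSeq {f : Q → GeneralRequest X} (hf : ∀ q, (f q).release = rel q) (s : X)
    {I J : Input Q rel} {t : ℝ} (h : I.upTo t = J.upTo t) :
    Agree t I.requests.length (requestSeq f s I.requests)
      J.requests.length (requestSeq f s J.requests) := by
  have key : ∀ i : ℕ, I.requests[i]?.filter (fun q => decide (rel q ≤ t)) =
      J.requests[i]?.filter (fun q => decide (rel q ≤ t)) := by
    intro i
    rw [← getElem?_filter_of_pairwise I.sorted, ← getElem?_filter_of_pairwise J.sorted]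
    exact congrArg (fun l : List Q => l[i]?) h
  have hmem : ∀ (I : Input Q rel) (i : ℕ), (i < I.requests.length ∧
      (requestSeq f s I.requests i).release ≤ t) ↔
      ∃ q, I.requests[i]?.filter (fun q => decide (rel q ≤ t)) = some q := by
    intro I i
    by_cases hi : i < I.requests.length
    · rw [requestSeq_of_lt f s hi, hf]
      simp [hi]
    · simp [hi]
  refine ⟨fun i => by rw [hmem, hmem, key], fun i hi hr => ?_⟩
  obtain ⟨q, hq⟩ := (hmem I i).1 ⟨hi, hr⟩
  have hI := (Option.filter_eq_some_iff.1 hq).1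
  have hJ := (Option.filter_eq_some_iff.1 ((key i).symm.trans hq)).1
  rw [requestSeq, requestSeq, hI, hJ]

/-- The online algorithm for requests which can be regarded as general requests. -/
noncomputable def generalAlgorithm [MetricSpace X] [Finite X] (f : Q → GeneralRequest X)
    (hf : ∀ q, (f q).release = rel q) (s : X) : OnlineAlgorithm X Q rel where
  run I := generalSchedule I.requests.length (requestSeq f s I.requests) s
  causal _ _ _ h := (agree_requestSeq hf s h).upTo_eq s
    (exists_nextService_eq_none _ _ s) (exists_nextService_eq_none _ _ s)

theorem sum_range_length {l : List Q} {g : ℕ → ℝ} {g' : Q → ℝ}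
    (h : ∀ (i : ℕ) (hi : i < l.length), g i = g' l[i]) :
    ∑ i ∈ Finset.range l.length, g i = (l.map g').sum := by
  rw [Finset.sum_range, ← Fin.sum_univ_fun_getElem]
  exact Finset.sum_congr rfl fun i _ => h i i.2

theorem three_add_logb_le {μ c : ℕ} (hc : 0 < c) (h : c ≤ μ + 1) :
    3 + Real.logb 2 (128 * c) ≤ 11 * (1 + Real.log μ) := by
  have hc' : (0 : ℝ) < c := by exact_mod_cast hc
  have h128 : Real.logb 2 128 = 7 := by
    rw [show (128 : ℝ) = 2 ^ (7 : ℝ) by norm_num]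
    exact Real.logb_rpow (by norm_num) (by norm_num)
  rw [Real.logb_mul (by norm_num) hc'.ne', h128]
  rcases Nat.eq_zero_or_pos μ with rfl | hμ
  · have : c = 1 := by omega
    subst this
    simp
    norm_num
  · have hμ1 : (1 : ℝ) ≤ μ := by exact_mod_cast hμ
    have hlog : 0 ≤ Real.log μ := Real.log_nonneg hμ1
    have h1 : Real.logb 2 c ≤ Real.logb 2 (2 * μ) := by
      refine Real.logb_le_logb_of_le (by norm_num) hc' ?_
      have : (c : ℝ) ≤ μ + 1 := by exact_mod_cast h
      linarith
    rw [Real.logb_mul (by norm_num) (by linarith), Real.logb_self_eq_one (by norm_num)] at h1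
    have h2 : Real.logb 2 μ ≤ 2 * Real.log μ := by
      rw [Real.logb, div_le_iff₀ (Real.log_pos (by norm_num))]
      nlinarith [Real.log_two_gt_d9]
    linarith

theorem Schedule.serviceTime_le {σ : Schedule X} {s : X} {q : Request X} {t : ℝ}
    (h : t ∈ σ.visitTimes s q) : σ.serviceTime s q ≤ t :=
  csInf_le ⟨q.release, fun _ hu => hu.1⟩ h

variable [MetricSpace X]

theorem generalAlgorithm_serves [Finite X] (f : Q → GeneralRequest X)
    (hf : ∀ q, (f q).release = rel q) (s : X) {Γ : ℝ} (hΓ : ∀ x y : X, dist x y ≤ Γ)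
    (hL : ∃ l : List X, l.Nodup ∧ (∀ x, x ∈ l) ∧ ∀ a, tour a l ≤ Γ) (I : Input Q rel) :
    ∀ q ∈ I.requests, ∃ t ∈ ((generalAlgorithm f hf s).run I).visitTimes s (f q).toRequest,
      (f q).lower t ≤ 36 * Γ := by
  intro q hq
  obtain ⟨i, hi, rfl⟩ := List.getElem_of_mem hq
  obtain ⟨S, d, M, m, h, hM, hm⟩ :=
    exists_complete_execution I.requests.length (requestSeq f s I.requests) s
  obtain ⟨t, h1, h2, h3⟩ := h.exists_visit hm hM hi
  rw [requestSeq_of_lt f s hi] at h1 h2 h3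
  exact ⟨t, ⟨h1, h2⟩, h3.trans (h.paid_le hΓ hL le_rfl i)⟩

/-- The constant rounds up `(10 + 9) * 8464 * 11`. -/
theorem generalAlgorithm_cost_le [Fintype X] (f : Q → GeneralRequest X)
    (hf : ∀ q, (f q).release = rel q) (s : X) (I : Input Q rel) (σ : Schedule X) (ts : Q → ℝ)
    (hts : ∀ q ∈ I.requests, ts q ∈ σ.visitTimes s (f q).toRequest)
    (heq : ∀ q ∈ I.requests, ∀ t < ts q, (f q).upper t = (f q).lower t) :
    ((generalAlgorithm f hf s).run I).movementCost s + (I.requests.map fun q =>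
        (f q).lower (((generalAlgorithm f hf s).run I).serviceTime s (f q).toRequest)).sum ≤
      2000000 * (1 + Real.log (min (Fintype.card X) I.numRequests : ℕ)) *
        (σ.movementCost s + (I.requests.map fun q => (f q).lower (ts q)).sum) := by
  classical
  set l := I.requests with hl
  set v := requestSeq f s l with hv
  have hvi : ∀ i (hi : i < l.length), v i = f l[i] := fun i hi => requestSeq_of_lt f s hi
  obtain ⟨S, d, M, m, h, hM, hm⟩ := exists_complete_execution l.length v s
  set τ := (generalAlgorithm f hf s).run I with hτ
  change τ.moves = M m at hM
  -- Restricting `σ` to the start and the request locations turns the number of points into `min n k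
  -- + 1`.
  set Y : Finset X := insert s ((l.map fun q => (f q).location).toFinset) with hY
  have hYl : ∀ q ∈ l, (f q).location ∈ Y := fun q hq =>
    Finset.mem_insert_of_mem (List.mem_toFinset.2 (List.mem_map.2 ⟨q, hq, rfl⟩))
  set ts' : ℕ → ℝ := fun i => (l[i]?.map ts).getD 0 with hts'
  have htsi : ∀ i (hi : i < l.length), ts' i = ts l[i] := fun i hi => by simp [hts', hi]
  have ho : IsOffline l.length v s (σ.restrict Y) ts' Y :=
    { release_le := fun i hi => by
        rw [htsi i hi, hvi i hi]
        exact (hts _ (List.getElem_mem hi)).1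
      visitsAt := fun i hi => by
        rw [htsi i hi, hvi i hi]
        exact (hts _ (List.getElem_mem hi)).2.restrict (hYl _ (List.getElem_mem hi))
      upper_eq := fun i hi => by
        rw [htsi i hi, hvi i hi]
        exact heq _ (List.getElem_mem hi)
      start_mem := Finset.mem_insert_self _ _
      moves_mem := fun m hm => (Schedule.mem_restrict_moves.1 hm).2 }
  have hY0 : 0 < Y.card := Finset.card_pos.2 ⟨s, ho.start_mem⟩
  have hYc : Y.card ≤ min (Fintype.card X) I.numRequests + 1 := by
    have h1 : Y.card ≤ Fintype.card X := Finset.card_le_univ Y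
    have h2 : Y.card ≤ I.numRequests + 1 := by
      refine (Finset.card_insert_le _ _).trans (Nat.succ_le_succ ?_)
      exact (List.toFinset_card_le _).trans_eq (List.length_map _)
    omega
  have hbase := sum_two_zpow_level_le h ho
  have hlog := three_add_logb_le hY0 hYc
  have hmove : τ.movementCost s ≤ 10 * ∑ i ∈ Finset.range m, (2 : ℝ) ^ (d i).level := by
    rw [Schedule.movementCost, travel_eq_pathLength, hM]
    exact h.pathLength_moves_le le_rfl
  have hdelay : (l.map fun q => (f q).lower (τ.serviceTime s (f q).toRequest)).sum ≤
      9 * ∑ i ∈ Finset.range m, (2 : ℝ) ^ (d i).level := by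
    refine le_trans ?_ (h.sum_paid_le le_rfl)
    rw [← sum_range_length (g := fun i => (v i).lower (τ.serviceTime s (v i).toRequest))
      fun i hi => by rw [hvi i hi]]
    refine Finset.sum_le_sum fun i hi => ?_
    obtain ⟨t, h1, h2, h3⟩ := h.exists_visit hm hM (Finset.mem_range.1 hi)
    exact ((v i).lower_mono (Schedule.serviceTime_le ⟨h1, h2⟩)).trans h3
  have hoff : ∑ i ∈ Finset.range l.length, (v i).lower (ts' i) =
      (l.map fun q => (f q).lower (ts q)).sum :=
    sum_range_length fun i hi => by rw [hvi i hi, htsi i hi]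
  have hres := Schedule.movementCost_restrict_le σ Y s
  have hres0 : 0 ≤ (σ.restrict Y).movementCost s := by
    rw [Schedule.movementCost, travel_eq_pathLength]
    exact pathLength_nonneg _ _
  have hD : 0 ≤ ∑ i ∈ Finset.range l.length, (v i).lower (ts' i) :=
    Finset.sum_nonneg fun i _ => (v i).lower_nonneg _
  rw [hoff] at hbase hD
  have hμ : 0 ≤ 1 + Real.log (min (Fintype.card X) I.numRequests : ℕ) :=
    add_nonneg zero_le_one (Real.log_natCast_nonneg _)
  generalize (l.map fun q => (f q).lower (ts q)).sum = D at *
  generalize Real.log (min (Fintype.card X) I.numRequests : ℕ) = Λ at *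
  have h1 : 8464 * (3 + Real.logb 2 (128 * Y.card)) * ((σ.restrict Y).movementCost s + D) ≤
      8464 * (11 * (1 + Λ)) * (σ.movementCost s + D) := by
    gcongr
  have h2 : 0 ≤ (1 + Λ) * (σ.movementCost s + D) := mul_nonneg hμ (by linarith)
  linarith

end General

/-! ### Delay and deadlines as instances. -/

section Problems

variable {X : Type*}

/-- A request with delay as a general request. -/
noncomputable def DelayRequest.toGeneral (q : DelayRequest X) : GeneralRequest X :=
  have hmono : Monotone fun t => q.delay (max t q.release) := fun _ _ h =>
    q.delay_mono (mem_Ici.2 (le_max_right _ _)) (mem_Ici.2 (le_max_right _ _))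
      (max_le_max_right _ h)
  have hcont : Continuous fun t => q.delay (max t q.release) :=
    q.delay_continuous.comp_continuous (continuous_id.max continuous_const)
      fun _ => mem_Ici.2 (le_max_right _ _)
  have hzero : ∀ t, t ≤ q.release → q.delay (max t q.release) = 0 := fun t h => by
    rw [max_eq_right h, q.delay_release]
  { toRequest := q.toRequest
    lower := fun t => q.delay (max t q.release)
    upper := fun t => q.delay (max t q.release)
    lower_mono := hmono
    upper_mono := hmono
    lower_le_upper := fun _ => le_rfl
    upper_le_lower := fun _ _ h => hmono h.le
    lower_eq_zero := hzero
    upper_eq_zero := fun t h => hzero t h.le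
    lower_lsc := hcont.lowerSemicontinuous
    upper_usc := hcont.upperSemicontinuous
    upper_unbounded := fun c => by
      obtain ⟨t, h1, h2⟩ := ((q.delay_tendsto.eventually_ge_atTop c).and
        (eventually_ge_atTop q.release)).exists
      exact ⟨t, by rwa [max_eq_left h2]⟩ }

/-- A request with a deadline as a general request: the delay cost jumps at the deadline from
`0` to `B`. -/
noncomputable def DeadlineRequest.toGeneral (B : ℝ) (hB : 0 ≤ B) (q : DeadlineRequest X) :
    GeneralRequest X where
  toRequest := q.toRequest
  lower t := if t ≤ q.deadline then 0 else B + (t - q.deadline)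
  upper t := if t < q.deadline then 0 else B + (t - q.deadline)
  lower_mono a b h := by dsimp only; split_ifs <;> linarith
  upper_mono a b h := by dsimp only; split_ifs <;> linarith
  lower_le_upper t := by split_ifs <;> linarith
  upper_le_lower a b h := by split_ifs <;> linarith
  lower_eq_zero t h := if_pos (h.trans q.release_le_deadline)
  upper_eq_zero t h := if_pos (h.trans_le q.release_le_deadline)
  lower_lsc t y hy := by
    dsimp only at hy ⊢
    split_ifs at hy with h
    · refine Eventually.of_forall fun u => ?_
      split_ifs <;> linarith
    · have h1 : ∀ᶠ u in nhds t, y < B + (u - q.deadline) :=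
        (continuous_const.add (continuous_id.sub continuous_const)).continuousAt.eventually
          (lt_mem_nhds hy)
      filter_upwards [h1, lt_mem_nhds (not_le.1 h)] with u hu hu'
      rwa [if_neg (not_le.2 hu')]
  upper_usc t y hy := by
    dsimp only at hy ⊢
    split_ifs at hy with h
    · filter_upwards [gt_mem_nhds h] with u hu
      rwa [if_pos hu]
    · have h1 : ∀ᶠ u in nhds t, B + (u - q.deadline) < y :=
        (continuous_const.add (continuous_id.sub continuous_const)).continuousAt.eventually
          (gt_mem_nhds hy)
      filter_upwards [h1] with u hu
      split_ifs with h2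
      · linarith
      · exact hu
  upper_unbounded c := by
    refine ⟨q.deadline + max c 0, ?_⟩
    rw [if_neg (by linarith [le_max_right c 0])]
    linarith [le_max_left c 0]

theorem DelayRequest.toGeneral_release (q : DelayRequest X) : q.toGeneral.release = q.release :=
  rfl

theorem DeadlineRequest.toGeneral_release (B : ℝ) (hB : 0 ≤ B) (q : DeadlineRequest X) :
    (q.toGeneral B hB).release = q.release :=
  rfl

variable [Fintype X] [MetricSpace X]

theorem exists_delayAlgorithm (s : X) : ∃ A : DelayAlgorithm X, A.IsCompetitive s fun I =>
    2000000 * (1 + Real.log (min (Fintype.card X) I.numRequests : ℕ)) := by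
  refine ⟨generalAlgorithm DelayRequest.toGeneral DelayRequest.toGeneral_release s, fun I => ?_⟩
  obtain ⟨Γ, hΓ, hL⟩ := exists_bound (X := X)
  have hsol : DelayInput.IsSolution s I
      ((generalAlgorithm DelayRequest.toGeneral DelayRequest.toGeneral_release s).run I) :=
    fun q hq =>
    let ⟨t, ht, _⟩ := generalAlgorithm_serves _ _ s hΓ hL I q hq
    ⟨t, ht⟩
  refine ⟨hsol, fun σ hσ => ?_⟩
  have hlower : ∀ τ : Schedule X, DelayInput.IsSolution s I τ →
      I.requests.map (fun q => q.delay (τ.serviceTime s q.toRequest)) =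
      I.requests.map (fun q => q.toGeneral.lower (τ.serviceTime s q.toRequest)) := by
    refine fun τ hτ => List.map_congr_left fun q hq => ?_
    have h1 := (τ.serviceTime_mem s q.toRequest (hτ q hq)).1
    exact congrArg q.delay (max_eq_left h1).symm
  rw [DelayInput.cost, DelayInput.cost, hlower _ hsol, hlower σ hσ]
  exact generalAlgorithm_cost_le _ _ s I σ (fun q => σ.serviceTime s q.toRequest)
    (fun q hq => σ.serviceTime_mem s q.toRequest (hσ q hq)) fun _ _ _ _ => rfl

theorem exists_deadlineAlgorithm (s : X) :
    ∃ A : DeadlineAlgorithm X, A.IsCompetitive s fun I =>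
      2000000 * (1 + Real.log (min (Fintype.card X) I.numRequests : ℕ)) := by
  obtain ⟨Γ, hΓ, hL⟩ := exists_bound (X := X)
  have hΓ0 : 0 ≤ Γ := by simpa using hΓ s s
  have hB : 0 ≤ 36 * Γ := by linarith
  refine ⟨generalAlgorithm (DeadlineRequest.toGeneral (36 * Γ) hB)
      (DeadlineRequest.toGeneral_release (36 * Γ) hB) s,
    fun I => ⟨fun q hq => ?_, fun σ hσ => ?_⟩⟩
  · obtain ⟨t, ht, hle⟩ := generalAlgorithm_serves (DeadlineRequest.toGeneral (36 * Γ) hB)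
      (DeadlineRequest.toGeneral_release (36 * Γ) hB) s hΓ hL I q hq
    refine ⟨t, ht, ?_⟩
    -- After the deadline the cost exceeds `36 * Γ`, more than is ever paid for a request.
    by_contra hcon
    have h1 : 36 * Γ + (t - q.deadline) ≤ 36 * Γ := by
      simpa only [DeadlineRequest.toGeneral, if_neg hcon] using hle
    linarith
  · have hts : ∀ q ∈ I.requests, σ.serviceTime s q.toRequest ≤ q.deadline := fun q hq =>
      let ⟨_, ht, htd⟩ := hσ q hq
      (Schedule.serviceTime_le ht).trans htd
    have h1 := generalAlgorithm_cost_le (DeadlineRequest.toGeneral (36 * Γ) hB)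
      (DeadlineRequest.toGeneral_release (36 * Γ) hB) s I
      σ (fun q => σ.serviceTime s q.toRequest)
      (fun q hq => σ.serviceTime_mem s q.toRequest (let ⟨t, ht, _⟩ := hσ q hq; ⟨t, ht⟩))
      fun q hq t ht => by
        have h2 := ht.trans_le (hts q hq)
        simp only [DeadlineRequest.toGeneral, if_pos h2, if_pos h2.le]
    have h2 : (I.requests.map fun q => (q.toGeneral (36 * Γ) hB).lower
        (σ.serviceTime s q.toRequest)).sum = 0 := by
      refine List.sum_eq_zero fun x hx => ?_
      obtain ⟨q, hq, rfl⟩ := List.mem_map.1 hx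
      exact if_pos (hts q hq)
    rw [h2, add_zero] at h1
    refine le_trans (le_add_of_nonneg_right (List.sum_nonneg fun x hx => ?_)) h1
    obtain ⟨q, -, rfl⟩ := List.mem_map.1 hx
    exact GeneralRequest.lower_nonneg _ _

end Problems

end OnlineService

theorem theoremB1 :
    ∃ C : ℝ, 0 < C ∧ ∀ (X : Type*) [Fintype X] [MetricSpace X] (s : X),
      (∃ A : OnlineService.DelayAlgorithm X,
        OnlineService.DelayAlgorithm.IsCompetitive A s (fun I =>
          C * (1 + Real.log (min (Fintype.card X) I.numRequests : ℕ)))) ∧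
      (∃ A : OnlineService.DeadlineAlgorithm X,
        OnlineService.DeadlineAlgorithm.IsCompetitive A s (fun I =>
          C * (1 + Real.log (min (Fintype.card X) I.numRequests : ℕ)))) :=
  ⟨2000000, by norm_num, fun _ _ _ s =>
    ⟨OnlineService.exists_delayAlgorithm s, OnlineService.exists_deadlineAlgorithm s⟩⟩
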